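/- **Setting.** Let $\mathcal X\subset\mathbb R^{d_x}$, $\mathcal A\subset\mathbb R^{d_a}$ be finite, and consider a Markov decision process with reward $r:\mathcal X\times\mathcal A\to[-1,1]$, transition probabilities $p(x'|x,a)$, initial distribution $\rho_0$ on $\mathcal X\times\mathcal A$ and discount factor $\gamma\in(0,1)$. Put $\tilde p(x'|x,a)=\gamma p(x'|x,a)+(1-\gamma)\sum_{a'}\rho_0(x',a')$. A policy $f(x,a)$ (a distribution over $a$ for each $x$) defines two Markov chains on $\mathcal X\times\mathcal A$ with transition probabilities $(x,a)\to(x',a')$ equal to $p(x'|x,a)f(x',a')$ and $\tilde p(x'|x,a)f(x',a')$. Assume that for every policy charging all actions in all states both chains are ergodic (irreducible and aperiodic), with stationary distributions $\pi^f$ and $\sigma^f_{\rho_0}$, and that for some $L>0$ and all such policies $f,f'$, $\max\{d_{TV}(\pi^f,\pi^{f'}),d_{TV}(\sigma_{\rho_0}^f,\sigma_{\rho_0}^{f'})\}\le L\,d_{TV}(f,f')$, where $d_{TV}(q,q')=\frac12\sum_{(x,a)}|q(x,a)-q'(x,a)|$. Let $\sigma\in C^3(\mathbb R)$ be bounded together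 with its first three derivatives, $\beta\in(\frac12,1)$, $\alpha>0$. For $N\ge1$ the actor and critic networks after $k$ updates are, with $\xi=(x,a)$, $$P_k^N(\xi)=N^{-\beta}\sum_{i=1}^N B_k^i\,\sigma(U_k^i\cdot\xi),\qquad Q_k^N(\xi)=N^{-\beta}\sum_{i=1}^N C_k^i\,\sigma(W_k^i\cdot\xi),$$ and $$f_k^N(x,a)=\frac{e^{P_k^N(x,a)}}{\sum_{a'}e^{P_k^N(x,a')}},\qquad g_k^N=\frac{\eta_k^N}{|\mathcal A|}+(1-\eta_k^N)f_k^N,\qquad \eta_k^N=\frac1{1+\log^2(1+k/N)}.$$ Initially the $(C_0^i,W_0^i)$ have law $v_0$, the $(B_0^i,U_0^i)$ have law $\mu_0$, all of the variables $C_0^i,W_0^i,B_0^i,U_0^i$ ($1\le i\le N$) are independent, $C_0^i,B_0^i$ are bounded with mean zero, and $\mathbb E\|W_0^i\|,\mathbb E\|U_0^i\|<\infty$. With $\alpha^N=\alpha N^{2\beta-2}$ and $\zeta^N_k=N^{2\beta-2}/(1+k/N)$, the updates are $$C_{k+1}^i=C_k^i+\tfrac{\alpha^N}{N^\beta}\delta_k\,\sigma(W_k^i\cdot\xi_k),\qquad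 W_{k+1}^i=W_k^i+\tfrac{\alpha^N}{N^\beta}\delta_k\,C_k^i\sigma'(W_k^i\cdot\xi_k)\xi_k,\qquad \delta_k=r(\xi_k)+\gamma Q_k^N(\xi_{k+1})-Q_k^N(\xi_k),$$ $$B_{k+1}^i=B_k^i+\tfrac{\zeta_k^N}{N^\beta}Q_k^N(\tilde\xi_k)\Big(\sigma(U_k^i\cdot\tilde\xi_k)-\sum_{a'}f_k^N(\tilde x_k,a')\sigma(U_k^i\cdot(\tilde x_k,a'))\Big),$$ $$U_{k+1}^i=U_k^i+\tfrac{\zeta_k^N}{N^\beta}Q_k^N(\tilde\xi_k)\Big(B_k^i\sigma'(U_k^i\cdot\tilde\xi_k)\tilde\xi_k-\sum_{a'}f_k^N(\tilde x_k,a')B_k^i\sigma'(U_k^i\cdot(\tilde x_k,a'))(\tilde x_k,a')\Big),$$ where $\xi_0,\tilde\xi_0\sim\rho_0$ and, given the initial parameters and both paths up to time $k$, $\xi_{k+1}=(x',a')$ has conditional probabilities $p(x'|\xi_k)\,g_k^N(x',a')$ and $\tilde\xi_{k+1}=(x',a')$ has conditional probabilities $\tilde p(x'|\tilde\xi_k)\,g_k^N(x',a')$.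 Write $P_t^N=P^N_{\lfloor Nt\rfloor}$ and $Q_t^N=Q^N_{\lfloor Nt\rfloor}$. **Limit system.** For $\xi,\xi'\in\mathcal X\times\mathcal A$ let $B_{\xi,\xi'}(c,w)=\sigma(w\cdot\xi)\sigma(w\cdot\xi')+c^2\sigma'(w\cdot\xi)\sigma'(w\cdot\xi')\,\xi\cdot\xi'$ and $\langle h,v\rangle=\int h\,dv$. Let $P^{(0)},Q^{(0)}$ be continuous on $[0,T]$ and satisfy there $$Q_t^{(0)}(\xi)=\alpha\int_0^t\sum_{\xi',x'',a''}\big(r(\xi')+\gamma Q_s^{(0)}(x'',a'')-Q_s^{(0)}(\xi')\big)\langle B_{\xi,\xi'},v_0\rangle\,\pi^{g_s^{(0)}}(\xi')\,g_s^{(0)}(x'',a'')\,p(x''|\xi')\,ds,$$ $$P_t^{(0)}(\xi)=\int_0^t\sum_{x',a',a''}\frac{Q_s^{(0)}(x',a')}{1+s}\big(\langle B_{\xi,(x',a')},\mu_0\rangle-\langle B_{\xi,(x',a'')},\mu_0\rangle\big)f_s^{(0)}(x',a'')\,\sigma_{\rho_0}^{g_s^{(0)}}(x',a')\,ds,$$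 where $f_t^{(0)}(x,a)=e^{P_t^{(0)}(x,a)}/\sum_{a'}e^{P_t^{(0)}(x,a')}$, $g_t^{(0)}=\eta_t/|\mathcal A|+(1-\eta_t)f_t^{(0)}$ and $\eta_t=1/(1+\log^2(1+t))$. **Theorem.** Let $0<T<\infty$ and let $p\ge1$ be an integer. Then $P_t^N\to P_t^{(0)}$ and $Q_t^N\to Q_t^{(0)}$ in $L_p$, uniformly on $[0,T]$: for every $\varepsilon>0$ both suprema below are at most $\varepsilon$ for all sufficiently large $N$. Moreover there are constants $C_{T,p}$ and $N_{T,p}$, independent of $N$, such that for all $N>N_{T,p}$ $$\sup_{t\in[0,T]}\mathbb E\Big[\max_{(x,a)}|P_t^N(x,a)-P_t^{(0)}(x,a)|^p\Big]\le C_{T,p}\big[N^{p(\beta-1)}+N^{p(\frac12-\beta)}\big],$$ $$\sup_{t\in[0,T]}\mathbb E\Big[\max_{(x,a)}|Q_t^N(x,a)-Q_t^{(0)}(x,a)|^p\Big]\le C_{T,p}\big[N^{p(\beta-1)}+N^{p(\frac12-\beta)}\big].$$ -/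

import Mathlib

open MeasureTheory

universe u

namespace ActorCritic

/-- The space `ℝ^{d_x + d_a}` in which the concatenated vectors `(x, a)` live. -/
abbrev Feat (dx da : ℕ) : Type := EuclideanSpace ℝ (Fin dx ⊕ Fin da)

/-- The parameters of a shallow network with `N` hidden units: unit `i` carries the pair
(outer weight, inner weight), that is `(C^i, W^i)` for the critic and `(B^i, U^i)` for the actor. -/
abbrev Params (dx da N : ℕ) : Type := Fin N → ℝ × Feat dx da

/-- A Markov decision process with finite state space `X ⊂ ℝ^{dx}`, finite action space
`A ⊂ ℝ^{da}`, reward with values in `[-1, 1]`, transition probabilities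
`trans (x, a) x' = p(x' | x, a)`, initial distribution `rho0` and discount factor `gamma`. -/
structure MDP (dx da : ℕ) where
  X : Finset (EuclideanSpace ℝ (Fin dx))
  A : Finset (EuclideanSpace ℝ (Fin da))
  reward : ↥X × ↥A → ℝ
  trans : ↥X × ↥A → ↥X → ℝ
  rho0 : ↥X × ↥A → ℝ
  gamma : ℝ
  reward_mem : ∀ s, reward s ∈ Set.Icc (-1 : ℝ) 1
  trans_nonneg : ∀ s x', 0 ≤ trans s x'
  trans_sum : ∀ s, ∑ x', trans s x' = 1
  rho0_nonneg : ∀ s, 0 ≤ rho0 s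
  rho0_sum : ∑ s, rho0 s = 1
  gamma_mem : gamma ∈ Set.Ioo (0 : ℝ) 1

/-- `ν` is a stationary probability vector of the transition matrix `P`. -/
def IsStationary {S : Type*} [Fintype S] (P : Matrix S S ℝ) (ν : S → ℝ) : Prop :=
  (∀ s, 0 ≤ ν s) ∧ ∑ s, ν s = 1 ∧ Matrix.vecMul ν P = ν

/-- The stationary distribution of `P`. It is used for ergodic chains only, which have
exactly one. -/
noncomputable def stationaryDist {S : Type*} [Fintype S] (P : Matrix S S ℝ) : S → ℝ :=
  Classical.epsilon (IsStationary P)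

/-- A chain on a finite set is ergodic if it is irreducible and aperiodic, that is, if its
transition matrix is primitive (some power has only positive entries). -/
def IsErgodic {S : Type*} [Fintype S] [DecidableEq S] (P : Matrix S S ℝ) : Prop :=
  P.IsPrimitive

/-- Total variation distance on a finite domain. -/
noncomputable def dTV {S : Type*} [Fintype S] (q q' : S → ℝ) : ℝ :=
  (1 / 2) * ∑ s, |q s - q' s|

namespace MDP

variable {dx da : ℕ} (M : MDP dx da)

/-- State-action pairs. -/
abbrev SA : Type := ↥M.X × ↥M.A

/-- The pair `(x, a)` as a vector of `ℝ^{dx + da}`. -/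
noncomputable def feat (s : M.SA) : Feat dx da :=
  WithLp.toLp 2 (Sum.elim (fun i => s.1.1 i) (fun i => s.2.1 i))

/-- A policy `f(x, a)` (the probability of `a` in state `x`) that gives every action
positive probability in every state. -/
def IsPosPolicy (f : M.SA → ℝ) : Prop :=
  (∀ s, 0 < f s) ∧ ∀ x, ∑ a, f (x, a) = 1

/-- `p̃(x' | x, a) = γ p(x' | x, a) + (1 - γ) ρ₀(x')`. -/
noncomputable def transAux (s : M.SA) (x' : ↥M.X) : ℝ :=
  M.gamma * M.trans s x' + (1 - M.gamma) * ∑ a, M.rho0 (x', a)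

/-- Transition matrix of the chain on state-action pairs under the policy `f`. -/
noncomputable def chain (f : M.SA → ℝ) : Matrix M.SA M.SA ℝ :=
  Matrix.of fun s s' => M.trans s s'.1 * f s'

/-- Transition matrix of the auxiliary chain (with `p̃` in place of `p`) under `f`. -/
noncomputable def auxChain (f : M.SA → ℝ) : Matrix M.SA M.SA ℝ :=
  Matrix.of fun s s' => M.transAux s s'.1 * f s'

/-- `π^f`. -/
noncomputable def piStat (f : M.SA → ℝ) : M.SA → ℝ := stationaryDist (M.chain f)

/-- `σ_{ρ₀}^f`. -/
noncomputable def sigmaStat (f : M.SA → ℝ) : M.SA → ℝ := stationaryDist (M.auxChain f)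

/-- Both chains are ergodic under every policy that charges all actions. -/
def Ergodic : Prop :=
  ∀ f, M.IsPosPolicy f → IsErgodic (M.chain f) ∧ IsErgodic (M.auxChain f)

/-- The stationary distributions depend on the policy in a Lipschitz way. -/
def LipschitzStationary : Prop :=
  ∃ L : ℝ, 0 < L ∧ ∀ f f', M.IsPosPolicy f → M.IsPosPolicy f' →
    max (dTV (M.piStat f) (M.piStat f')) (dTV (M.sigmaStat f) (M.sigmaStat f')) ≤ L * dTV f f'

/-- Softmax over the actions. -/
noncomputable def softmax (P : M.SA → ℝ) (s : M.SA) : ℝ :=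
  Real.exp (P s) / ∑ a, Real.exp (P (s.1, a))

/-- The exploration policy `η / |A| + (1 - η) f`. -/
noncomputable def explore (η : ℝ) (f : M.SA → ℝ) (s : M.SA) : ℝ :=
  η / (M.A.card : ℝ) + (1 - η) * f s

/-- The network output `N^{-β} ∑ᵢ cᵢ σ(wᵢ · (x, a))`. -/
noncomputable def net (σ : ℝ → ℝ) (β : ℝ) {N : ℕ} (θ : Params dx da N) (s : M.SA) : ℝ :=
  1 / (N : ℝ) ^ β * ∑ i, (θ i).1 * σ (inner ℝ (θ i).2 (M.feat s))

/-- The critic learning rate `α / N^{2 - 2β}`. -/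
noncomputable def critRate (α β : ℝ) (N : ℕ) : ℝ := α / (N : ℝ) ^ (2 - 2 * β)

/-- The actor learning rate `1 / (N^{2 - 2β} (1 + k / N))`. -/
noncomputable def actRate (β : ℝ) (N k : ℕ) : ℝ :=
  1 / ((N : ℝ) ^ (2 - 2 * β) * (1 + (k : ℝ) / N))

/-- The exploration rate `1 / (1 + log²(1 + t))` at rescaled time `t`; step `k` of the
algorithm uses `t = k / N`. -/
noncomputable def expRate (t : ℝ) : ℝ := 1 / (1 + Real.log (1 + t) ^ 2)

/-- One temporal-difference step of the critic parameters, from the observed transition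
`s → s'`. -/
noncomputable def critStep (σ : ℝ → ℝ) (α β : ℝ) {N : ℕ} (ω : Params dx da N)
    (s s' : M.SA) : Params dx da N := fun i =>
  let δ : ℝ := critRate α β N / (N : ℝ) ^ β *
    (M.reward s + M.gamma * M.net σ β ω s' - M.net σ β ω s)
  ((ω i).1 + δ * σ (inner ℝ (ω i).2 (M.feat s)),
   (ω i).2 + (δ * (ω i).1 * deriv σ (inner ℝ (ω i).2 (M.feat s))) • M.feat s)

/-- The `k`-th policy gradient step of the actor parameters `θ`, with critic parameters `ω`,
at the sampled pair `s = (x̃, ã)`. -/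
noncomputable def actStep (σ : ℝ → ℝ) (β : ℝ) {N : ℕ} (k : ℕ) (ω θ : Params dx da N)
    (s : M.SA) : Params dx da N := fun i =>
  let δ : ℝ := actRate β N k / (N : ℝ) ^ β * M.net σ β ω s
  let f : M.SA → ℝ := M.softmax (M.net σ β θ)
  ((θ i).1 + δ * (σ (inner ℝ (θ i).2 (M.feat s)) -
      ∑ a, f (s.1, a) * σ (inner ℝ (θ i).2 (M.feat (s.1, a)))),
   (θ i).2 + δ • (((θ i).1 * deriv σ (inner ℝ (θ i).2 (M.feat s))) • M.feat s -
      ∑ a, (f (s.1, a) * (θ i).1 * deriv σ (inner ℝ (θ i).2 (M.feat (s.1, a)))) •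
        M.feat (s.1, a)))

/-- The pair (critic parameters, actor parameters) after `k` updates, started from `init` and
driven by the sample paths `ξ` (critic process) and `ξ'` (actor process). -/
noncomputable def train (σ : ℝ → ℝ) (α β : ℝ) {N : ℕ}
    (init : Params dx da N × Params dx da N) (ξ ξ' : ℕ → M.SA) :
    ℕ → Params dx da N × Params dx da N
  | 0 => init
  | k + 1 =>
    (M.critStep σ α β (train σ α β init ξ ξ' k).1 (ξ k) (ξ (k + 1)),
     M.actStep σ β k (train σ α β init ξ ξ' k).1 (train σ α β init ξ ξ' k).2 (ξ' k))

/-- The exploration policy `g_k^N` determined by actor parameters `θ`. -/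
noncomputable def policy (σ : ℝ → ℝ) (β : ℝ) {N : ℕ} (k : ℕ) (θ : Params dx da N) :
    M.SA → ℝ :=
  M.explore (expRate ((k : ℝ) / N)) (M.softmax (M.net σ β θ))

section Run

variable {Ω : Type*} {N : ℕ}

/-- The σ-algebra generated by the initial parameters and by both sample paths up to step
`k`. -/
@[reducible] def history (init : Ω → Params dx da N × Params dx da N) (ξ ξ' : ℕ → Ω → M.SA) (k : ℕ) :
    MeasurableSpace Ω :=
  MeasurableSpace.comap init inferInstance ⊔
    ⨆ j ≤ k, (MeasurableSpace.comap (ξ j) inferInstance ⊔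
      MeasurableSpace.comap (ξ' j) inferInstance)

/-- The parameters after `k` updates, as random variables. -/
noncomputable def params (σ : ℝ → ℝ) (α β : ℝ) (init : Ω → Params dx da N × Params dx da N)
    (ξ ξ' : ℕ → Ω → M.SA) (k : ℕ) (ω : Ω) : Params dx da N × Params dx da N :=
  M.train σ α β (init ω) (fun j => ξ j ω) (fun j => ξ' j ω) k

/-- The random initial parameters `init` and sample paths `ξ`, `ξ'` form a run of the
actor-critic algorithm with `N` hidden units: the pairs `(C₀^i, W₀^i)` have law `νC ⊗ νW`,
the pairs `(B₀^i, U₀^i)` have law `νB ⊗ νU`, and all are independent; both paths start from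
`ρ₀`; given the past, the next critic pair is drawn from `p(x' | ξ_k) g_k^N(x', a')` and the
next actor pair from `p̃(x' | ξ'_k) g_k^N(x', a')`, where `g_k^N` is the current exploration
policy. The joint conditional law of the two new pairs given the past, and the dependence of the
two initial pairs on each other and on `init`, are left free. -/
structure IsRun [MeasurableSpace Ω] (μ : Measure Ω) (σ : ℝ → ℝ) (α β : ℝ)
    (νC νB : Measure ℝ) (νW νU : Measure (Feat dx da))
    (init : Ω → Params dx da N × Params dx da N) (ξ ξ' : ℕ → Ω → M.SA) : Prop where
  measurable_init : Measurable init
  measurable_crit : ∀ k, Measurable (ξ k)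
  measurable_act : ∀ k, Measurable (ξ' k)
  law_init : μ.map init =
    (Measure.pi fun _ : Fin N => νC.prod νW).prod (Measure.pi fun _ : Fin N => νB.prod νU)
  law_crit_zero : ∀ s, μ (ξ 0 ⁻¹' {s}) = ENNReal.ofReal (M.rho0 s)
  law_act_zero : ∀ s, μ (ξ' 0 ⁻¹' {s}) = ENNReal.ofReal (M.rho0 s)
  law_crit_succ : ∀ k s,
    μ[(ξ (k + 1) ⁻¹' {s}).indicator (fun _ => (1 : ℝ)) | M.history init ξ ξ' k] =ᵐ[μ]
      fun ω => M.chain (M.policy σ β k (M.params σ α β init ξ ξ' k ω).2) (ξ k ω) s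
  law_act_succ : ∀ k s,
    μ[(ξ' (k + 1) ⁻¹' {s}).indicator (fun _ => (1 : ℝ)) | M.history init ξ ξ' k] =ᵐ[μ]
      fun ω => M.auxChain (M.policy σ β k (M.params σ α β init ξ ξ' k ω).2) (ξ' k ω) s

/-- The time-rescaled critic output `Q_t^N = Q_{⌊Nt⌋}^N`. -/
noncomputable def critOut (σ : ℝ → ℝ) (α β : ℝ) (init : Ω → Params dx da N × Params dx da N)
    (ξ ξ' : ℕ → Ω → M.SA) (t : ℝ) (ω : Ω) : M.SA → ℝ :=
  M.net σ β (M.params σ α β init ξ ξ' ⌊(N : ℝ) * t⌋₊ ω).1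

/-- The time-rescaled actor output `P_t^N = P_{⌊Nt⌋}^N`. -/
noncomputable def actOut (σ : ℝ → ℝ) (α β : ℝ) (init : Ω → Params dx da N × Params dx da N)
    (ξ ξ' : ℕ → Ω → M.SA) (t : ℝ) (ω : Ω) : M.SA → ℝ :=
  M.net σ β (M.params σ α β init ξ ξ' ⌊(N : ℝ) * t⌋₊ ω).2

end Run

/-- `⟨B_{s, s'}, v⟩`, where `B_{s, s'}(c, w) = σ(w·s) σ(w·s') + c² σ'(w·s) σ'(w·s') (s·s')`. -/
noncomputable def bPair (σ : ℝ → ℝ) (v : Measure (ℝ × Feat dx da)) (s s' : M.SA) : ℝ :=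
  ∫ z, (σ (inner ℝ z.2 (M.feat s)) * σ (inner ℝ z.2 (M.feat s')) +
    z.1 ^ 2 * deriv σ (inner ℝ z.2 (M.feat s)) * deriv σ (inner ℝ z.2 (M.feat s')) *
      inner ℝ (M.feat s) (M.feat s')) ∂v

/-- The exploration policy `g_t^{(0)}` belonging to the limit actor output `P` at time `t`. -/
noncomputable def limitPolicy (t : ℝ) (P : M.SA → ℝ) : M.SA → ℝ :=
  M.explore (expRate t) (M.softmax P)

/-- `P` and `Q` are continuous on `[0, T]` and solve the limit system there, with initial
parameter laws `v₀` (critic) and `μ₀` (actor). -/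
structure IsLimitSolution (σ : ℝ → ℝ) (α : ℝ) (v₀ μ₀ : Measure (ℝ × Feat dx da)) (T : ℝ)
    (P Q : ℝ → M.SA → ℝ) : Prop where
  continuousOn_act : ContinuousOn P (Set.Icc 0 T)
  continuousOn_crit : ContinuousOn Q (Set.Icc 0 T)
  eq_crit : ∀ t ∈ Set.Icc 0 T, ∀ s, Q t s = α * ∫ τ in (0 : ℝ)..t,
    ∑ s', ∑ s'', (M.reward s' + M.gamma * Q τ s'' - Q τ s') * M.bPair σ v₀ s s' *
      M.piStat (M.limitPolicy τ (P τ)) s' * M.limitPolicy τ (P τ) s'' * M.trans s' s''.1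
  eq_act : ∀ t ∈ Set.Icc 0 T, ∀ s, P t s = ∫ τ in (0 : ℝ)..t,
    ∑ s' : M.SA, ∑ a'', 1 / (1 + τ) * Q τ s' *
      (M.bPair σ μ₀ s s' - M.bPair σ μ₀ s (s'.1, a'')) *
      M.softmax (P τ) (s'.1, a'') * M.sigmaStat (M.limitPolicy τ (P τ)) s'

end MDP

/-- `sup_{t ∈ [0, T]} E[max_e |Y_t(e) - y_t(e)|^p]`, as an extended nonnegative real. -/
noncomputable def supLpError {Ω E : Type*} [MeasurableSpace Ω] (μ : Measure Ω) (T : ℝ) (p : ℕ)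
    (Y : ℝ → Ω → E → ℝ) (y : ℝ → E → ℝ) : ENNReal :=
  ⨆ t ∈ Set.Icc (0 : ℝ) T, ∫⁻ ω, ⨆ e, ENNReal.ofReal (|Y t ω e - y t e| ^ p) ∂μ

end ActorCritic

open ActorCritic

/-! In this scaling the networks are in a lazy regime. One update shifts every unit by a combination
of the gradients of its own output, with total coefficient of order `N^(β-2)`, while the network
sums `N` units with weight `N^(-β)`. Since `N^(1-β) * N^(β-2) = 1/N`, an output moves by `1/N` per
step, and to first order this motion is the tangent kernel averaged over the units. In `N T` steps
the parameters move only by order `N^(β-1)`, so the kernel stays frozen at its initial empirical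
value up to that error, and the initial empirical value is within `N^(-1/2)` of `⟨B, v₀⟩` or `⟨B,
μ₀⟩`. The initial outputs are sums of centred independent terms, of size `N^(1/2-β)`, which
dominates `N^(-1/2)`. These are the two rates. All of this is deterministic given the initial
parameters; it is `exists_trainBound`.

The outputs then follow an Euler scheme of step `1/N`, but driven by a force evaluated at the
current sample and not by its stationary average. Averaging uses the Poisson equation `u - P u = h -
⟨h⟩` of the chain under the current policy: `h - ⟨h⟩` at `x_k` is the martingale increment
`u(x_{k+1}) - (P u)(x_k)` plus `u(x_k) - u(x_{k+1})`. As `u` depends on the policy and the outputs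
in a Lipschitz way, and those move by `1/N` per step, the last terms telescope to something bounded
uniformly in `N` (`abs_sum_force_sub_le`). After division by `N` the martingale contributes
`N^(-1/2)` and the telescoped part `1/N`. The estimates on `u` are uniform because exploration keeps
all policies up to time `T` in a compact set of policies bounded below, on which the matrices `I - P
+ J/|S|` are invertible with continuous inverse (`exists_poissonBound`). The stationary average of
`h` is the uniform mean of `u`, so the drift is Lipschitz as well.

Comparing with the limit equation and applying a discrete Grönwall inequality (`exists_outErr_le`)
bounds the error at step `n` by a constant times `N^(β-1) + N^(1/2-β)` times `w_n² + (1/N) ∑_{k<n}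
w_k²`. Here `w_n` dominates the rescaled initial outputs, kernel fluctuations and the values of the
martingales at time `n`. Hoeffding bounds give all of these exponential moments uniform in `N` and
`n` (`IsRun.exists_fluctuation`), hence all moments of the error. As the supremum over time stands
outside the expectation, no maximal inequality is needed, but the Grönwall inequality must accept
errors that are not monotone in `n`. -/

namespace ActorCritic

/-! ### Taylor bounds for the activation function -/

/-- Bounds on an activation function that hold as soon as it and its first two derivatives are
bounded by `κ`. -/
structure SmoothBound (σ : ℝ → ℝ) (κ : ℝ) : Prop where
  one_le : 1 ≤ κ
  abs_le : ∀ x, |σ x| ≤ κ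
  abs_deriv_le : ∀ x, |deriv σ x| ≤ κ
  abs_sub_le : ∀ x y, |σ y - σ x| ≤ κ * |y - x|
  abs_deriv_sub_le : ∀ x y, |deriv σ y - deriv σ x| ≤ κ * |y - x|
  taylor : ∀ x y, |σ y - σ x - deriv σ x * (y - x)| ≤ κ * (y - x) ^ 2

/-- Every larger `κ` is admitted, so that a single constant can later dominate the norms of the
feature vectors too. -/
theorem exists_smoothBound {σ : ℝ → ℝ} (hσ : ContDiff ℝ 3 σ)
    (hσb : ∃ K : ℝ, ∀ j ≤ 3, ∀ x : ℝ, |iteratedDeriv j σ x| ≤ K) :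
    ∃ κ₀ : ℝ, ∀ κ, κ₀ ≤ κ → SmoothBound σ κ := by
  obtain ⟨K, hK⟩ := hσb
  refine ⟨max 1 K, fun κ hκ => ?_⟩
  have h1 : 1 ≤ κ := (le_max_left _ _).trans hκ
  have hKκ : K ≤ κ := (le_max_right _ _).trans hκ
  have hd : Differentiable ℝ σ := hσ.differentiable (by norm_num)
  have hd' : Differentiable ℝ (deriv σ) := by
    have := hσ.differentiable_iteratedDeriv 1 (by norm_num)
    rwa [iteratedDeriv_one] at this
  have hb0 : ∀ x, |σ x| ≤ κ := fun x => by
    simpa using (hK 0 (by norm_num) x).trans hKκ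
  have hb1 : ∀ x, |deriv σ x| ≤ κ := fun x => by
    simpa [iteratedDeriv_one] using (hK 1 (by norm_num) x).trans hKκ
  have hb2 : ∀ x, |deriv (deriv σ) x| ≤ κ := fun x => by
    simpa [iteratedDeriv_succ, iteratedDeriv_zero] using (hK 2 (by norm_num) x).trans hKκ
  have hl1 : ∀ x y, |deriv σ y - deriv σ x| ≤ κ * |y - x| := fun x y => by
    simpa using convex_univ.norm_image_sub_le_of_norm_deriv_le (fun z _ => hd' z)
      (fun z _ => by simpa using hb2 z) (Set.mem_univ x) (Set.mem_univ y)
  refine ⟨h1, hb0, hb1, fun x y => ?_, hl1, fun x y => ?_⟩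
  · simpa using convex_univ.norm_image_sub_le_of_norm_deriv_le (fun z _ => hd z)
      (fun z _ => by simpa using hb1 z) (Set.mem_univ x) (Set.mem_univ y)
  -- The mean value inequality for `σ z - σ'(x) z`, whose derivative on the segment is at most `κ |y
  -- - x|`; this loses only the factor 1/2 of Taylor's formula.
  · have h := (convex_uIcc x y).norm_image_sub_le_of_norm_hasDerivWithin_le
      (f := fun z => σ z - deriv σ x * z) (f' := fun z => deriv σ z - deriv σ x) (C := κ * |y - x|)
      (fun z _ => by
        have := ((hd z).hasDerivAt.sub ((hasDerivAt_id z).const_mul (deriv σ x))).hasDerivWithinAt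
          (s := Set.uIcc x y)
        rw [mul_one] at this
        exact this)
      (fun z hz => (hl1 x z).trans (mul_le_mul_of_nonneg_left
        (Set.abs_sub_left_of_mem_uIcc hz) (by linarith)))
      Set.left_mem_uIcc Set.right_mem_uIcc
    have e : σ y - deriv σ x * y - (σ x - deriv σ x * x) = σ y - σ x - deriv σ x * (y - x) := by
      ring
    rw [e, Real.norm_eq_abs, Real.norm_eq_abs, mul_assoc, abs_mul_abs_self, ← pow_two] at h
    exact h

namespace SmoothBound

variable {σ : ℝ → ℝ} {κ : ℝ} (h : SmoothBound σ κ)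
include h

theorem nonneg : 0 ≤ κ := zero_le_one.trans h.one_le

theorem abs_unit_sub_sub_le (c x dc dx : ℝ) :
    |(c + dc) * σ (x + dx) - c * σ x - (dc * σ x + c * (deriv σ x * dx))| ≤
      κ * (|dc| * |dx|) + κ * (|c| * dx ^ 2) := by
  have e : (c + dc) * σ (x + dx) - c * σ x - (dc * σ x + c * (deriv σ x * dx)) =
      dc * (σ (x + dx) - σ x) + c * (σ (x + dx) - σ x - deriv σ x * (x + dx - x)) := by ring
  have h1 := h.abs_sub_le x (x + dx)
  have h2 := h.taylor x (x + dx)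
  rw [add_sub_cancel_left] at h1 h2
  rw [e]
  refine (abs_add_le _ _).trans (add_le_add ?_ ?_)
  · rw [abs_mul]
    calc |dc| * |σ (x + dx) - σ x| ≤ |dc| * (κ * |dx|) := by gcongr
      _ = _ := by ring
  · rw [abs_mul, add_sub_cancel_left]
    calc |c| * |σ (x + dx) - σ x - deriv σ x * dx| ≤ |c| * (κ * dx ^ 2) := by gcongr
      _ = _ := by ring

theorem abs_unit_sub_le (c x dc dx : ℝ) :
    |(c + dc) * σ (x + dx) - c * σ x| ≤ κ * |dc| + κ * (|c| * |dx|) := by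
  have e : (c + dc) * σ (x + dx) - c * σ x = dc * σ (x + dx) + c * (σ (x + dx) - σ x) := by ring
  have h1 := h.abs_sub_le x (x + dx)
  have h2 := h.abs_le (x + dx)
  rw [add_sub_cancel_left] at h1
  rw [e]
  refine (abs_add_le _ _).trans (add_le_add ?_ ?_)
  · rw [abs_mul]
    calc |dc| * |σ (x + dx)| ≤ |dc| * κ := by gcongr
      _ = _ := by ring
  · rw [abs_mul]
    calc |c| * |σ (x + dx) - σ x| ≤ |c| * (κ * |dx|) := by gcongr
      _ = _ := by ring

end SmoothBound

theorem abs_mul_sub_mul_le {a b a' b' K D : ℝ} (ha : |a| ≤ K) (hb' : |b'| ≤ K)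
    (h1 : |a - a'| ≤ D) (h2 : |b - b'| ≤ D) : |a * b - a' * b'| ≤ 2 * K * D := by
  have hK : 0 ≤ K := (abs_nonneg _).trans ha
  have e : a * b - a' * b' = a * (b - b') + (a - a') * b' := by ring
  rw [e]
  refine (abs_add_le _ _).trans ?_
  rw [abs_mul, abs_mul]
  have : |a| * |b - b'| ≤ K * D := mul_le_mul ha h2 (abs_nonneg _) hK
  have : |a - a'| * |b'| ≤ D * K := mul_le_mul h1 hb' (abs_nonneg _) ((abs_nonneg _).trans h1)
  linarith

/-! ### Effect of a gradient displacement on a shallow network -/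

namespace MDP

variable {dx da : ℕ} (M : MDP dx da)

/-- The integrand of `⟨B_{s, s'}, v⟩`. -/
noncomputable def unitKernel (σ : ℝ → ℝ) (s s' : M.SA) (z : ℝ × Feat dx da) : ℝ :=
  σ (inner ℝ z.2 (M.feat s)) * σ (inner ℝ z.2 (M.feat s')) +
    z.1 ^ 2 * deriv σ (inner ℝ z.2 (M.feat s)) * deriv σ (inner ℝ z.2 (M.feat s')) *
      inner ℝ (M.feat s) (M.feat s')

/-- The empirical mean of the unit kernel over the hidden units of a network. -/
noncomputable def empKernel (σ : ℝ → ℝ) {N : ℕ} (θ : Params dx da N) (s s' : M.SA) : ℝ :=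
  1 / (N : ℝ) * ∑ i, M.unitKernel σ s s' (θ i)

/-- Displacement of the parameters of every unit in the direction `∑ e(s) ∇(c σ(w · s))`. -/
noncomputable def gradStep (σ : ℝ → ℝ) {N : ℕ} (θ : Params dx da N) (e : M.SA → ℝ) :
    Params dx da N := fun i =>
  ((θ i).1 + ∑ s, e s * σ (inner ℝ (θ i).2 (M.feat s)),
   (θ i).2 + ∑ s, (e s * (θ i).1 * deriv σ (inner ℝ (θ i).2 (M.feat s))) • M.feat s)

variable {M} {σ : ℝ → ℝ} {κ a : ℝ} {N : ℕ}

theorem abs_inner_feat_le (hF : ∀ s, ‖M.feat s‖ ≤ κ) (w : Feat dx da) (s : M.SA) :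
    |inner ℝ w (M.feat s)| ≤ κ * ‖w‖ := by
  refine (abs_real_inner_le_norm _ _).trans ?_
  rw [mul_comm]
  exact mul_le_mul_of_nonneg_right (hF s) (norm_nonneg _)

theorem abs_unitKernel_le (h : SmoothBound σ κ) (hF : ∀ s, ‖M.feat s‖ ≤ κ) (ha : 1 ≤ a)
    (s s' : M.SA) {z : ℝ × Feat dx da} (hz : |z.1| ≤ a) :
    |M.unitKernel σ s s' z| ≤ 2 * κ ^ 4 * a ^ 2 := by
  have hκ := h.one_le
  have hκ0 := h.nonneg
  have h1 : |σ (inner ℝ z.2 (M.feat s)) * σ (inner ℝ z.2 (M.feat s'))| ≤ κ * κ := by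
    rw [abs_mul]; exact mul_le_mul (h.abs_le _) (h.abs_le _) (abs_nonneg _) hκ0
  have h2 : |z.1 ^ 2 * deriv σ (inner ℝ z.2 (M.feat s)) * deriv σ (inner ℝ z.2 (M.feat s')) *
      inner ℝ (M.feat s) (M.feat s')| ≤ a ^ 2 * κ * κ * (κ * κ) := by
    rw [abs_mul, abs_mul, abs_mul, abs_pow]
    gcongr
    · exact h.abs_deriv_le _
    · exact h.abs_deriv_le _
    · exact (abs_real_inner_le_norm _ _).trans
        (mul_le_mul (hF s) (hF s') (norm_nonneg _) hκ0)
  have h3 : κ * κ ≤ κ ^ 4 * a ^ 2 := by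
    have : κ ^ 2 * 1 ≤ κ ^ 4 * a ^ 2 :=
      mul_le_mul (pow_le_pow_right₀ hκ (by norm_num)) (one_le_pow₀ ha) zero_le_one (by positivity)
    linarith
  refine (abs_add_le _ _).trans ?_
  linarith

theorem abs_unitKernel_sub_le (h : SmoothBound σ κ) (hF : ∀ s, ‖M.feat s‖ ≤ κ) (ha : 1 ≤ a)
    (s s' : M.SA) {z z' : ℝ × Feat dx da} (hz : |z.1| ≤ a) (hz' : |z'.1| ≤ a) :
    |M.unitKernel σ s s' z - M.unitKernel σ s s' z'| ≤
      4 * κ ^ 5 * a ^ 2 * (|z.1 - z'.1| + ‖z.2 - z'.2‖) := by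
  have hκ := h.one_le
  have hκ0 := h.nonneg
  set D := κ ^ 2 * ‖z.2 - z'.2‖
  have hx : ∀ s, |inner ℝ z.2 (M.feat s) - inner ℝ z'.2 (M.feat s)| ≤ κ * ‖z.2 - z'.2‖ := by
    intro s
    rw [← inner_sub_left]
    exact abs_inner_feat_le hF _ _
  have hσ : ∀ s, |σ (inner ℝ z.2 (M.feat s)) - σ (inner ℝ z'.2 (M.feat s))| ≤ D := by
    intro s
    refine (h.abs_sub_le _ _).trans ?_
    calc _ ≤ κ * (κ * ‖z.2 - z'.2‖) := by gcongr; exact hx s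
      _ = D := by ring
  have hσ' : ∀ s, |deriv σ (inner ℝ z.2 (M.feat s)) - deriv σ (inner ℝ z'.2 (M.feat s))| ≤ D := by
    intro s
    refine (h.abs_deriv_sub_le _ _).trans ?_
    calc _ ≤ κ * (κ * ‖z.2 - z'.2‖) := by gcongr; exact hx s
      _ = D := by ring
  have h1 := abs_mul_sub_mul_le (h.abs_le _) (h.abs_le _) (hσ s) (hσ s')
  have h2 := abs_mul_sub_mul_le (h.abs_deriv_le _) (h.abs_deriv_le _) (hσ' s) (hσ' s')
  have hin : |inner ℝ (M.feat s) (M.feat s')| ≤ κ * κ :=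
    (abs_real_inner_le_norm _ _).trans (mul_le_mul (hF s) (hF s') (norm_nonneg _) hκ0)
  set x := inner ℝ z.2 (M.feat s)
  set y := inner ℝ z.2 (M.feat s')
  set x' := inner ℝ z'.2 (M.feat s)
  set y' := inner ℝ z'.2 (M.feat s')
  have e : M.unitKernel σ s s' z - M.unitKernel σ s s' z' = (σ x * σ y - σ x' * σ y') +
      ((z.1 + z'.1) * (z.1 - z'.1) * (deriv σ x * deriv σ y) * inner ℝ (M.feat s) (M.feat s') +
      z'.1 ^ 2 * (deriv σ x * deriv σ y - deriv σ x' * deriv σ y') *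
        inner ℝ (M.feat s) (M.feat s')) := by
    simp only [unitKernel, x, y, x', y']; ring
  have h3 : |(z.1 + z'.1) * (z.1 - z'.1) * (deriv σ x * deriv σ y) *
      inner ℝ (M.feat s) (M.feat s')| ≤ (2 * a) * |z.1 - z'.1| * (κ * κ) * (κ * κ) := by
    rw [abs_mul, abs_mul, abs_mul, abs_mul (deriv σ x)]
    gcongr
    · exact (abs_add_le _ _).trans (by linarith)
    · exact h.abs_deriv_le _
    · exact h.abs_deriv_le _
  have h4 : |z'.1 ^ 2 * (deriv σ x * deriv σ y - deriv σ x' * deriv σ y') *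
        inner ℝ (M.feat s) (M.feat s')| ≤ a ^ 2 * (2 * κ * D) * (κ * κ) := by
    rw [abs_mul, abs_mul, abs_pow]
    gcongr
  rw [e]
  refine (abs_add_le _ _).trans
    ((add_le_add h1 ((abs_add_le _ _).trans (add_le_add h3 h4))).trans ?_)
  have h5 : 2 * κ * D ≤ 2 * κ ^ 5 * a ^ 2 * ‖z.2 - z'.2‖ := by
    have : κ ^ 3 * 1 ≤ κ ^ 5 * a ^ 2 :=
      mul_le_mul (pow_le_pow_right₀ hκ (by norm_num)) (one_le_pow₀ ha) zero_le_one (by positivity)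
    have := mul_le_mul_of_nonneg_right this (norm_nonneg (z.2 - z'.2))
    simp only [D]; nlinarith
  have h6 : (2 * a) * |z.1 - z'.1| * (κ * κ) * (κ * κ) ≤ 4 * κ ^ 5 * a ^ 2 * |z.1 - z'.1| := by
    have : κ ^ 4 * a ≤ κ ^ 5 * a ^ 2 :=
      mul_le_mul (pow_le_pow_right₀ hκ (by norm_num)) (by nlinarith) (by linarith) (by positivity)
    have := mul_le_mul_of_nonneg_right this (abs_nonneg (z.1 - z'.1))
    have h0 : 0 ≤ κ ^ 5 * a ^ 2 * |z.1 - z'.1| := by positivity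
    nlinarith
  have h7 : a ^ 2 * (2 * κ * D) * (κ * κ) = 2 * κ ^ 5 * a ^ 2 * ‖z.2 - z'.2‖ := by
    simp only [D]; ring
  rw [h7]
  linarith

theorem abs_gradStep_fst_sub_le (h : SmoothBound σ κ) (θ : Params dx da N) (e : M.SA → ℝ)
    (i : Fin N) : |(M.gradStep σ θ e i).1 - (θ i).1| ≤ κ * ∑ s, |e s| := by
  simp only [gradStep, add_sub_cancel_left]
  refine (Finset.abs_sum_le_sum_abs _ _).trans ?_
  rw [Finset.mul_sum]
  refine Finset.sum_le_sum fun s _ => ?_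
  rw [abs_mul, mul_comm]
  exact mul_le_mul_of_nonneg_right (h.abs_le _) (abs_nonneg _)

theorem norm_gradStep_snd_sub_le (h : SmoothBound σ κ) (hF : ∀ s, ‖M.feat s‖ ≤ κ)
    (θ : Params dx da N) (e : M.SA → ℝ) (i : Fin N) (ha : |(θ i).1| ≤ a) :
    ‖(M.gradStep σ θ e i).2 - (θ i).2‖ ≤ κ ^ 2 * a * ∑ s, |e s| := by
  simp only [gradStep, add_sub_cancel_left]
  refine (norm_sum_le _ _).trans ?_
  rw [Finset.mul_sum]
  refine Finset.sum_le_sum fun s _ => ?_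
  have hκ := h.nonneg
  have ha0 : 0 ≤ a := (abs_nonneg _).trans ha
  rw [norm_smul, Real.norm_eq_abs, abs_mul, abs_mul]
  calc |e s| * |(θ i).1| * |deriv σ (inner ℝ (θ i).2 (M.feat s))| * ‖M.feat s‖
      ≤ |e s| * a * κ * κ := by
        gcongr
        · exact h.abs_deriv_le _
        · exact hF s
    _ = _ := by ring

/-- The effect of a displacement on the output of a single unit, to first and second order. -/
theorem abs_unit_gradStep_le (h : SmoothBound σ κ) (hF : ∀ s, ‖M.feat s‖ ≤ κ) (ha1 : 1 ≤ a)
    (θ : Params dx da N) (e : M.SA → ℝ) (i : Fin N) (ha : |(θ i).1| ≤ a) (s : M.SA) :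
    |(M.gradStep σ θ e i).1 * σ (inner ℝ (M.gradStep σ θ e i).2 (M.feat s)) -
        (θ i).1 * σ (inner ℝ (θ i).2 (M.feat s))| ≤ 2 * κ ^ 4 * a ^ 2 * ∑ s, |e s| ∧
    |(M.gradStep σ θ e i).1 * σ (inner ℝ (M.gradStep σ θ e i).2 (M.feat s)) -
        (θ i).1 * σ (inner ℝ (θ i).2 (M.feat s)) - ∑ s', e s' * M.unitKernel σ s s' (θ i)| ≤
      2 * κ ^ 7 * a ^ 3 * (∑ s, |e s|) ^ 2 := by
  have hκ := h.one_le
  have hκ0 := h.nonneg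
  set E := ∑ s, |e s|
  have hE : 0 ≤ E := Finset.sum_nonneg fun _ _ => abs_nonneg _
  set c := (θ i).1
  set x := inner ℝ (θ i).2 (M.feat s)
  set dc := (M.gradStep σ θ e i).1 - c
  set dw := (M.gradStep σ θ e i).2 - (θ i).2
  set dX := inner ℝ dw (M.feat s)
  have e1 : (M.gradStep σ θ e i).1 = c + dc := by simp [dc]
  have e2 : inner ℝ (M.gradStep σ θ e i).2 (M.feat s) = x + dX := by
    simp only [x, dX, dw, ← inner_add_left]; simp
  have hdc : |dc| ≤ κ * E := abs_gradStep_fst_sub_le h θ e i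
  have hdX : |dX| ≤ κ * (κ ^ 2 * a * E) :=
    (abs_inner_feat_le hF _ _).trans
      (mul_le_mul_of_nonneg_left (norm_gradStep_snd_sub_le h hF θ e i ha) hκ0)
  rw [e1, e2]
  constructor
  · refine (h.abs_unit_sub_le c x dc dX).trans ?_
    have h1 : κ * |dc| ≤ κ * (κ * E) := by gcongr
    have h2 : κ * (|c| * |dX|) ≤ κ * (a * (κ * (κ ^ 2 * a * E))) := by gcongr
    have h3 : κ ^ 2 * 1 ≤ κ ^ 4 * a ^ 2 :=
      mul_le_mul (pow_le_pow_right₀ hκ (by norm_num)) (one_le_pow₀ ha1) zero_le_one (by positivity)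
    have h4 := mul_le_mul_of_nonneg_right h3 hE
    calc _ ≤ κ * (κ * E) + κ * (a * (κ * (κ ^ 2 * a * E))) := add_le_add h1 h2
      _ ≤ _ := by nlinarith
  -- `unitKernel s s'` is the inner product of the parameter gradients of `c σ(w · s)` and `c σ(w ·
  -- s')`, so this sum is the derivative of the output at `s` along the displacement.
  · have e3 : ∑ s', e s' * M.unitKernel σ s s' (θ i) = dc * σ x + c * (deriv σ x * dX) := by
      have a1 : dc = ∑ s', e s' * σ (inner ℝ (θ i).2 (M.feat s')) := by
        simp [dc, gradStep, c]
      have a2 : dX = ∑ s', (e s' * c * deriv σ (inner ℝ (θ i).2 (M.feat s'))) *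
          inner ℝ (M.feat s') (M.feat s) := by
        simp [dX, dw, gradStep, c, sum_inner, inner_smul_left]
      rw [a1, a2, Finset.sum_mul, Finset.mul_sum, Finset.mul_sum, ← Finset.sum_add_distrib]
      refine Finset.sum_congr rfl fun s' _ => ?_
      rw [real_inner_comm (M.feat s) (M.feat s')]
      simp only [unitKernel, x, c]
      ring
    rw [e3]
    refine (h.abs_unit_sub_sub_le c x dc dX).trans ?_
    have h1 : κ * (|dc| * |dX|) ≤ κ * ((κ * E) * (κ * (κ ^ 2 * a * E))) := by gcongr
    have h2 : κ * (|c| * dX ^ 2) ≤ κ * (a * (κ * (κ ^ 2 * a * E)) ^ 2) := by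
      rw [← sq_abs dX]; gcongr
    have h3 : κ ^ 5 * a ≤ κ ^ 7 * a ^ 3 :=
      mul_le_mul (pow_le_pow_right₀ hκ (by norm_num))
        (by simpa using pow_le_pow_right₀ ha1 (show 1 ≤ 3 by norm_num)) (by linarith)
        (by positivity)
    have h4 := mul_le_mul_of_nonneg_right h3 (sq_nonneg E)
    calc _ ≤ κ * ((κ * E) * (κ * (κ ^ 2 * a * E))) + κ * (a * (κ * (κ ^ 2 * a * E)) ^ 2) :=
          add_le_add h1 h2
      _ = κ ^ 5 * a * E ^ 2 + κ ^ 7 * a ^ 3 * E ^ 2 := by ring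
      _ ≤ _ := by linarith

theorem abs_sum_fin_le {f : Fin N → ℝ} {B : ℝ} (hf : ∀ i, |f i| ≤ B) : |∑ i, f i| ≤ N * B := by
  refine (Finset.abs_sum_le_sum_abs _ _).trans ((Finset.sum_le_sum fun i _ => hf i).trans ?_)
  simp

theorem abs_one_div_mul_sum_fin_le {f : Fin N → ℝ} {B x : ℝ} (hx : 0 ≤ x) (hf : ∀ i, |f i| ≤ B) :
    |1 / x * ∑ i, f i| ≤ N / x * B := by
  have hx' : 0 ≤ 1 / x := by positivity
  rw [abs_mul, abs_of_nonneg hx']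
  exact (mul_le_mul_of_nonneg_left (abs_sum_fin_le hf) hx').trans_eq (by ring)

theorem abs_net_le (h : SmoothBound σ κ) (β : ℝ) (θ : Params dx da N)
    (hθ : ∀ i, |(θ i).1| ≤ a) (s : M.SA) : |M.net σ β θ s| ≤ N / (N : ℝ) ^ β * (a * κ) := by
  refine abs_one_div_mul_sum_fin_le (by positivity) fun i => ?_
  rw [abs_mul]
  exact mul_le_mul (hθ i) (h.abs_le _) (abs_nonneg _) ((abs_nonneg _).trans (hθ i))

theorem abs_net_gradStep_sub_le (h : SmoothBound σ κ) (hF : ∀ s, ‖M.feat s‖ ≤ κ) (ha1 : 1 ≤ a)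
    (β : ℝ) (θ : Params dx da N) (hθ : ∀ i, |(θ i).1| ≤ a) (e : M.SA → ℝ) (s : M.SA) :
    |M.net σ β (M.gradStep σ θ e) s - M.net σ β θ s| ≤
      N / (N : ℝ) ^ β * (2 * κ ^ 4 * a ^ 2 * ∑ s, |e s|) := by
  rw [net, net, ← mul_sub, ← Finset.sum_sub_distrib]
  exact abs_one_div_mul_sum_fin_le (by positivity)
    fun i => (abs_unit_gradStep_le h hF ha1 θ e i (hθ i) s).1

/-- Summing the expansion over the units turns their kernels into `N` times the empirical kernel;
this produces the prefactor `N^(1-β)` of the first-order term and of the quadratic remainder. -/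
theorem abs_net_gradStep_sub_sub_le (h : SmoothBound σ κ) (hF : ∀ s, ‖M.feat s‖ ≤ κ)
    (ha1 : 1 ≤ a) (β : ℝ) (θ : Params dx da N) (hθ : ∀ i, |(θ i).1| ≤ a)
    (e : M.SA → ℝ) (s : M.SA) :
    |M.net σ β (M.gradStep σ θ e) s - M.net σ β θ s -
        N / (N : ℝ) ^ β * ∑ s', e s' * M.empKernel σ θ s s'| ≤
      N / (N : ℝ) ^ β * (2 * κ ^ 7 * a ^ 3 * (∑ s, |e s|) ^ 2) := by
  rcases Nat.eq_zero_or_pos N with h0 | h0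
  · subst h0; simp [net]
  have hN0 : (N : ℝ) ≠ 0 := by positivity
  have e1 : N / (N : ℝ) ^ β * ∑ s', e s' * M.empKernel σ θ s s' =
      1 / (N : ℝ) ^ β * ∑ i, ∑ s', e s' * M.unitKernel σ s s' (θ i) := by
    rw [Finset.sum_comm, Finset.mul_sum, Finset.mul_sum]
    refine Finset.sum_congr rfl fun s' _ => ?_
    rw [← Finset.mul_sum, empKernel]
    field_simp
  rw [e1, net, net, ← mul_sub, ← Finset.sum_sub_distrib, ← mul_sub, ← Finset.sum_sub_distrib]
  exact abs_one_div_mul_sum_fin_le (by positivity)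
    fun i => (abs_unit_gradStep_le h hF ha1 θ e i (hθ i) s).2

theorem abs_empKernel_sub_le (h : SmoothBound σ κ) (hF : ∀ s, ‖M.feat s‖ ≤ κ) (ha1 : 1 ≤ a)
    (θ θ' : Params dx da N) (hθ : ∀ i, |(θ i).1| ≤ a) (hθ' : ∀ i, |(θ' i).1| ≤ a) (s s' : M.SA)
    {D : ℝ} (hD0 : 0 ≤ D) (hD : ∀ i, |(θ i).1 - (θ' i).1| + ‖(θ i).2 - (θ' i).2‖ ≤ D) :
    |M.empKernel σ θ s s' - M.empKernel σ θ' s s'| ≤ 4 * κ ^ 5 * a ^ 2 * D := by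
  have hκ := h.nonneg
  have hN : (0 : ℝ) ≤ 1 / (N : ℝ) := by positivity
  rcases Nat.eq_zero_or_pos N with h0 | h0
  · subst h0; simp only [empKernel]; simp; positivity
  have hN0 : (N : ℝ) ≠ 0 := by positivity
  rw [empKernel, empKernel, ← mul_sub, ← Finset.sum_sub_distrib, abs_mul, abs_of_nonneg hN]
  calc _ ≤ 1 / (N : ℝ) * (N * (4 * κ ^ 5 * a ^ 2 * D)) := mul_le_mul_of_nonneg_left
        (abs_sum_fin_le fun i => (abs_unitKernel_sub_le h hF ha1 s s' (hθ i) (hθ' i)).trans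
          (mul_le_mul_of_nonneg_left (hD i) (by positivity))) hN
    _ = _ := by field_simp

/-! ### Critic and actor updates as gradient displacements -/

/-- The coefficients of the critic update as a displacement. -/
noncomputable def critCoeff (σ : ℝ → ℝ) (α β : ℝ) {N : ℕ} (ω : Params dx da N)
    (s s' : M.SA) : M.SA → ℝ :=
  Pi.single s (critRate α β N / (N : ℝ) ^ β *
    (M.reward s + M.gamma * M.net σ β ω s' - M.net σ β ω s))

/-- The coefficients of the actor update as a displacement. -/
noncomputable def actCoeff (σ : ℝ → ℝ) (β : ℝ) {N : ℕ} (k : ℕ) (ω θ : Params dx da N)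
    (s : M.SA) : M.SA → ℝ := fun s' =>
  actRate β N k / (N : ℝ) ^ β * M.net σ β ω s *
    ((Pi.single s 1 : M.SA → ℝ) s' - if s'.1 = s.1 then M.softmax (M.net σ β θ) s' else 0)

theorem sum_pi_single_mul {S : Type*} [Fintype S] [DecidableEq S] (s : S) (c : ℝ) (f : S → ℝ) :
    ∑ s', (Pi.single s c : S → ℝ) s' * f s' = c * f s := by
  simp [Pi.single_apply, ite_mul]

theorem sum_ite_fst_eq (s : M.SA) {E : Type*} [AddCommMonoid E] (f : M.SA → E) :
    ∑ s' : M.SA, (if s'.1 = s.1 then f s' else 0) = ∑ a, f (s.1, a) := by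
  rw [Fintype.sum_prod_type_right]
  simp

theorem critStep_eq (α β : ℝ) (ω : Params dx da N) (s s' : M.SA) :
    M.critStep σ α β ω s s' = M.gradStep σ ω (M.critCoeff σ α β ω s s') := by
  funext i
  simp only [critStep, gradStep, critCoeff, mul_assoc, sum_pi_single_mul, Prod.mk.injEq, true_and]
  congr 1
  rw [Finset.sum_eq_single s]
  · simp [mul_assoc]
  · intro b _ hb; simp [hb]
  · simp

/-- The gradient of `log f(x, a)` is the network gradient at `(x, a)` minus its softmax average over
the actions at `x`, so the coefficients are a unit mass minus `f(x, ·)`. With `critStep_eq` this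
lets one displacement calculus serve both networks. -/
theorem actStep_eq (β : ℝ) (k : ℕ) (ω θ : Params dx da N) (s : M.SA) :
    M.actStep σ β k ω θ s = M.gradStep σ θ (M.actCoeff σ β k ω θ s) := by
  funext i
  simp only [actStep, gradStep, actCoeff, Prod.mk.injEq]
  constructor
  · congr 1
    simp only [mul_assoc, ← Finset.mul_sum, sub_mul, Finset.sum_sub_distrib, sum_pi_single_mul,
      ite_mul, zero_mul, one_mul]
    rw [sum_ite_fst_eq s]
  · congr 1
    simp only [mul_assoc, mul_smul, ← Finset.smul_sum, sub_smul, Finset.sum_sub_distrib, smul_sub]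
    congr 3
    · rw [Finset.sum_eq_single s]
      · simp
      · intro b _ hb; simp [hb]
      · simp
    · rw [← sum_ite_fst_eq s (fun s' => M.softmax (M.net σ β θ) s' • (θ i).1 •
        deriv σ (inner ℝ (θ i).2 (M.feat s')) • M.feat s')]
      refine Finset.sum_congr rfl fun s' _ => ?_
      split_ifs <;> simp

end MDP

/-! ### The Poisson equation of a finite ergodic chain -/

section Poisson

variable {S : Type*} [Fintype S] {P P' : Matrix S S ℝ}

theorem IsStationary.sum_mul_mulVec {ν : S → ℝ} (hν : IsStationary P ν) (x : S → ℝ) :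
    ∑ s, ν s * Matrix.mulVec P x s = ∑ s, ν s * x s := by
  have := Matrix.dotProduct_mulVec ν P x
  rw [hν.2.2] at this
  exact this

variable [DecidableEq S]

theorem sum_pow_apply_eq_one (hP : ∀ i, ∑ j, P i j = 1) (k : ℕ) (i : S) :
    ∑ j, (P ^ k) i j = 1 := by
  have h1 : Matrix.mulVec P 1 = 1 := by
    funext i; simpa [Matrix.mulVec, dotProduct] using hP i
  have h2 : ∀ k : ℕ, Matrix.mulVec (P ^ k) 1 = 1 := by
    intro k
    induction k with
    | zero => simp
    | succ k ih => rw [pow_succ, ← Matrix.mulVec_mulVec, h1, ih]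
  simpa [Matrix.mulVec, dotProduct] using congrFun (h2 k) i

/-- Harmonic functions of an ergodic chain are constant. -/
theorem IsErgodic.eq_of_mulVec_eq (hE : IsErgodic P) (hP : ∀ i, ∑ j, P i j = 1) {x : S → ℝ}
    (hx : Matrix.mulVec P x = x) (i j : S) : x i = x j := by
  obtain ⟨k, -, hk⟩ := hE.exists_pos_pow
  have hkx : ∀ m : ℕ, Matrix.mulVec (P ^ m) x = x := by
    intro m
    induction m with
    | zero => simp
    | succ m ih => rw [pow_succ, ← Matrix.mulVec_mulVec, hx, ih]
  have : Nonempty S := ⟨i⟩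
  -- Maximum principle: at a maximiser the value is an average of all values with the strictly
  -- positive weights of row `m` of `P ^ k`, so all values equal the maximum.
  obtain ⟨m, hm⟩ := Finite.exists_max x
  have h0 : ∑ j, (P ^ k) m j * (x m - x j) = 0 := by
    simp only [mul_sub, Finset.sum_sub_distrib, ← Finset.sum_mul]
    rw [sum_pow_apply_eq_one hP, one_mul]
    have := congrFun (hkx k) m
    simp only [Matrix.mulVec, dotProduct] at this
    rw [this, sub_self]
  have h1 := (Finset.sum_eq_zero_iff_of_nonneg
    (fun j _ => mul_nonneg (hk m j).le (sub_nonneg.2 (hm j)))).1 h0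
  have h2 : ∀ j, x j = x m := fun j => by
    rcases mul_eq_zero.1 (h1 j (Finset.mem_univ j)) with h | h
    · exact absurd h (hk m j).ne'
    · linarith
  rw [h2 i, h2 j]

/-- Since `1 - P` annihilates the constant vector it is singular, hence has a left null vector `v`.
The triangle inequality gives `|v| ≤ |v| P` entrywise, and both sides have equal total mass because
the rows sum to one; so `|v|` is invariant and can be normalised. -/
theorem exists_isStationary [Nonempty S] (h0 : ∀ i j, 0 ≤ P i j) (hP : ∀ i, ∑ j, P i j = 1) :
    ∃ ν, IsStationary P ν := by
  have hdet : (1 - P).det = 0 := by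
    rw [← Matrix.exists_mulVec_eq_zero_iff]
    refine ⟨1, one_ne_zero, ?_⟩
    funext i
    rw [Matrix.sub_mulVec, Matrix.one_mulVec]
    simpa [Matrix.mulVec, dotProduct, sub_eq_zero] using (hP i).symm
  obtain ⟨v, hv0, hv⟩ := Matrix.exists_vecMul_eq_zero_iff.2 hdet
  rw [Matrix.vecMul_sub, Matrix.vecMul_one, sub_eq_zero] at hv
  have hle : ∀ j, |v j| ≤ ∑ i, |v i| * P i j := fun j => by
    have hj : v j = ∑ i, v i * P i j := by
      have := congrFun hv j
      simpa [Matrix.vecMul, dotProduct] using this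
    rw [hj]
    refine (Finset.abs_sum_le_sum_abs _ _).trans_eq (Finset.sum_congr rfl fun i _ => ?_)
    rw [abs_mul, abs_of_nonneg (h0 i j)]
  have hsum : ∑ j, ∑ i, |v i| * P i j = ∑ j, |v j| := by
    rw [Finset.sum_comm]
    refine Finset.sum_congr rfl fun i _ => ?_
    rw [← Finset.mul_sum, hP, mul_one]
  have heq : ∀ j, |v j| = ∑ i, |v i| * P i j := fun j =>
    (Finset.sum_eq_sum_iff_of_le fun j _ => hle j).1 hsum.symm j (Finset.mem_univ j)
  have hpos : 0 < ∑ j, |v j| := by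
    obtain ⟨j, hj⟩ := Function.ne_iff.1 hv0
    exact Finset.sum_pos' (fun _ _ => abs_nonneg _) ⟨j, Finset.mem_univ j, abs_pos.2 hj⟩
  refine ⟨fun j => |v j| / ∑ j, |v j|, fun j => by positivity, ?_, ?_⟩
  · rw [← Finset.sum_div, div_self hpos.ne']
  · funext j
    simp only [Matrix.vecMul, dotProduct, div_mul_eq_mul_div]
    rw [← Finset.sum_div, ← heq j]

theorem isStationary_stationaryDist [Nonempty S] (h0 : ∀ i j, 0 ≤ P i j)
    (hP : ∀ i, ∑ j, P i j = 1) : IsStationary P (stationaryDist P) :=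
  Classical.epsilon_spec (exists_isStationary h0 hP)

/-- The matrix `I - P + J / |S|`, where all entries of `J` are one. -/
noncomputable def poissonMatrix (P : Matrix S S ℝ) : Matrix S S ℝ :=
  1 - P + Matrix.of fun _ _ => 1 / (Fintype.card S : ℝ)

/-- The solution `u` of the Poisson equation `u - P u = h - ⟨h⟩` whose mean is `⟨h⟩`. -/
noncomputable def poissonSol (P : Matrix S S ℝ) (h : S → ℝ) : S → ℝ :=
  Matrix.mulVec (poissonMatrix P)⁻¹ h

theorem poissonMatrix_mulVec (P : Matrix S S ℝ) (x : S → ℝ) (s : S) :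
    Matrix.mulVec (poissonMatrix P) x s =
      x s - Matrix.mulVec P x s + 1 / (Fintype.card S : ℝ) * ∑ s', x s' := by
  rw [poissonMatrix, Matrix.add_mulVec, Matrix.sub_mulVec, Matrix.one_mulVec]
  simp [Matrix.mulVec, dotProduct, Finset.mul_sum]

theorem IsStationary.sum_mul_poissonMatrix {ν : S → ℝ} (hν : IsStationary P ν) (x : S → ℝ) :
    ∑ s, ν s * Matrix.mulVec (poissonMatrix P) x s = 1 / (Fintype.card S : ℝ) * ∑ s', x s' := by
  simp only [poissonMatrix_mulVec, mul_add, mul_sub, Finset.sum_add_distrib,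
    Finset.sum_sub_distrib, hν.sum_mul_mulVec, ← Finset.sum_mul, hν.2.1]
  ring

/-- Pairing a null vector `x` with a stationary `ν` kills `I - P` and leaves the mean of `x`, which
is therefore zero. Then `P x = x`, so `x` is constant by ergodicity, and a constant of mean zero
vanishes. -/
theorem isUnit_det_poissonMatrix [Nonempty S] (hE : IsErgodic P) (hP : ∀ i, ∑ j, P i j = 1) :
    IsUnit (poissonMatrix P).det := by
  obtain ⟨ν, hν⟩ := exists_isStationary hE.nonneg hP
  rw [isUnit_iff_ne_zero]
  intro h0
  obtain ⟨x, hx0, hx⟩ := Matrix.exists_mulVec_eq_zero_iff.2 h0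
  have hmean : 1 / (Fintype.card S : ℝ) * ∑ s', x s' = 0 := by
    rw [← hν.sum_mul_poissonMatrix, hx]; simp
  have hPx : Matrix.mulVec P x = x := by
    funext s
    have := congrFun hx s
    rw [poissonMatrix_mulVec, hmean] at this
    simp only [Pi.zero_apply] at this
    linarith
  refine hx0 (funext fun i => ?_)
  have hc : ∀ j, x j = x i := fun j => hE.eq_of_mulVec_eq hP hPx j i
  simp only [hc] at hmean
  simpa using hmean

theorem poissonMatrix_mulVec_poissonSol (hu : IsUnit (poissonMatrix P).det) (h : S → ℝ) :
    Matrix.mulVec (poissonMatrix P) (poissonSol P h) = h := by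
  rw [poissonSol, Matrix.mulVec_mulVec, Matrix.mul_nonsing_inv _ hu, Matrix.one_mulVec]

/-- This replaces the stationary weights by uniform ones: a stationary average depends on the chain
only through the Poisson solution, and so inherits its regularity. -/
theorem IsStationary.sum_mul_eq_mean_poissonSol {ν : S → ℝ} (hν : IsStationary P ν)
    (hu : IsUnit (poissonMatrix P).det) (h : S → ℝ) :
    ∑ s, ν s * h s = 1 / (Fintype.card S : ℝ) * ∑ s, poissonSol P h s := by
  rw [← hν.sum_mul_poissonMatrix, poissonMatrix_mulVec_poissonSol hu]

theorem IsStationary.poisson_equation {ν : S → ℝ} (hν : IsStationary P ν)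
    (hu : IsUnit (poissonMatrix P).det) (h : S → ℝ) (s : S) :
    h s - ∑ s', ν s' * h s' = poissonSol P h s - Matrix.mulVec P (poissonSol P h) s := by
  have := congrFun (poissonMatrix_mulVec_poissonSol hu h) s
  rw [poissonMatrix_mulVec, ← hν.sum_mul_eq_mean_poissonSol hu] at this
  linarith

/-- The resolvent identity: the rank-one terms of the two Poisson matrices cancel, so these differ
exactly by `P' - P`. -/
theorem poissonSol_sub (hu : IsUnit (poissonMatrix P).det) (hu' : IsUnit (poissonMatrix P').det)
    (h h' : S → ℝ) : poissonSol P h - poissonSol P' h' =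
      poissonSol P (h - h' + Matrix.mulVec (P - P') (poissonSol P' h')) := by
  set w := poissonSol P' h' with hw
  have h1 : w = Matrix.mulVec (poissonMatrix P)⁻¹ (Matrix.mulVec (poissonMatrix P) w) := by
    rw [Matrix.mulVec_mulVec, Matrix.nonsing_inv_mul _ hu, Matrix.one_mulVec]
  have h2 : Matrix.mulVec (poissonMatrix P) w = h' - Matrix.mulVec (P - P') w := by
    rw [← poissonMatrix_mulVec_poissonSol hu' h', ← hw]
    rw [eq_sub_iff_add_eq, ← Matrix.add_mulVec]
    congr 1
    simp only [poissonMatrix]; abel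
  conv_lhs => rw [h1, h2, poissonSol, ← Matrix.mulVec_sub]
  rw [poissonSol]
  congr 1
  abel

/-- The inverse is the adjugate over the determinant, hence continuous where the determinant does
not vanish, and its entries are bounded on a compact set. -/
theorem exists_norm_poissonSol_le {G : Type*} [TopologicalSpace G] {K : Set G} (hK : IsCompact K)
    {P : G → Matrix S S ℝ} (hc : Continuous P) (hu : ∀ g ∈ K, IsUnit (poissonMatrix (P g)).det) :
    ∃ C, ∀ g ∈ K, ∀ h : S → ℝ, ‖poissonSol (P g) h‖ ≤ C * ‖h‖ := by
  have hcA : Continuous fun g => poissonMatrix (P g) := by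
    unfold poissonMatrix
    fun_prop
  have hcI : ContinuousOn (fun g => (poissonMatrix (P g))⁻¹) K := by
    simp only [Matrix.inv_def, Ring.inverse_eq_inv']
    exact (hcA.matrix_det.continuousOn.inv₀ fun g hg => (hu g hg).ne_zero).smul
      hcA.matrix_adjugate.continuousOn
  have hcF : ContinuousOn (fun g => ∑ i, ∑ j, |(poissonMatrix (P g))⁻¹ i j|) K := by
    refine continuousOn_finsetSum _ fun i _ => continuousOn_finsetSum _ fun j _ => ?_
    exact ((continuous_apply_apply i j).comp_continuousOn hcI).abs
  obtain ⟨C, hC⟩ := hK.exists_bound_of_continuousOn hcF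
  refine ⟨max C 0, fun g hg h => (pi_norm_le_iff_of_nonneg (by positivity)).2 fun i => ?_⟩
  rw [poissonSol, Matrix.mulVec, dotProduct, Real.norm_eq_abs]
  calc |∑ j, (poissonMatrix (P g))⁻¹ i j * h j|
      ≤ ∑ j, |(poissonMatrix (P g))⁻¹ i j| * ‖h‖ := by
        refine (Finset.abs_sum_le_sum_abs _ _).trans (Finset.sum_le_sum fun j _ => ?_)
        rw [abs_mul]
        exact mul_le_mul_of_nonneg_left (norm_le_pi_norm h j) (abs_nonneg _)
    _ = (∑ j, |(poissonMatrix (P g))⁻¹ i j|) * ‖h‖ := by rw [Finset.sum_mul]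
    _ ≤ max C 0 * ‖h‖ := by
        refine mul_le_mul_of_nonneg_right (le_trans ?_ (le_max_left _ _)) (norm_nonneg _)
        refine le_trans ?_ ((le_abs_self _).trans (hC g hg))
        exact Finset.single_le_sum (f := fun i => ∑ j, |(poissonMatrix (P g))⁻¹ i j|)
          (fun i _ => Finset.sum_nonneg fun j _ => abs_nonneg _) (Finset.mem_univ i)

end Poisson

/-! ### Uniform Poisson estimates over policies bounded below -/

namespace MDP

variable {dx da : ℕ} {M : MDP dx da}

theorem nonempty_SA (M : MDP dx da) : Nonempty M.SA := by
  by_contra h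
  rw [not_nonempty_iff] at h
  have := M.rho0_sum
  simp at this

theorem card_A_pos (M : MDP dx da) : (0 : ℝ) < M.A.card := by
  obtain ⟨s⟩ := M.nonempty_SA
  exact_mod_cast Finset.card_pos.2 ⟨_, s.2.2⟩

/-- Probability transition kernels from state-action pairs to states. -/
def IsKernel (k : M.SA → ↥M.X → ℝ) : Prop :=
  (∀ s x', 0 ≤ k s x') ∧ ∀ s, ∑ x', k s x' = 1

/-- The transition matrix on state-action pairs of a transition kernel and a policy. -/
noncomputable def policyChain (k : M.SA → ↥M.X → ℝ) (f : M.SA → ℝ) : Matrix M.SA M.SA ℝ :=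
  Matrix.of fun s s' => k s s'.1 * f s'

theorem isKernel_trans (M : MDP dx da) : IsKernel M.trans := ⟨M.trans_nonneg, M.trans_sum⟩

theorem isKernel_transAux (M : MDP dx da) : IsKernel M.transAux := by
  have h0 := M.gamma_mem.1.le
  have h1 : 0 ≤ 1 - M.gamma := sub_nonneg.2 M.gamma_mem.2.le
  refine ⟨fun s x' => add_nonneg (mul_nonneg h0 (M.trans_nonneg _ _))
    (mul_nonneg h1 (Finset.sum_nonneg fun _ _ => M.rho0_nonneg _)), fun s => ?_⟩
  simp only [transAux, Finset.sum_add_distrib, ← Finset.mul_sum, M.trans_sum]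
  rw [← Fintype.sum_prod_type, M.rho0_sum]
  ring

/-- The policies with all probabilities at least `c`. -/
def policySet (M : MDP dx da) (c : ℝ) : Set (M.SA → ℝ) :=
  {g | (∀ s, c ≤ g s) ∧ ∀ x, ∑ a, g (x, a) = 1}

theorem le_one_of_mem_policySet {c : ℝ} (hc : 0 ≤ c) {g : M.SA → ℝ} (hg : g ∈ M.policySet c)
    (s : M.SA) : g s ≤ 1 := by
  rw [← hg.2 s.1]
  exact Finset.single_le_sum (f := fun a => g (s.1, a)) (fun a _ => hc.trans (hg.1 _))
    (Finset.mem_univ s.2)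

theorem isCompact_policySet (M : MDP dx da) {c : ℝ} (hc : 0 ≤ c) :
    IsCompact (M.policySet c) := by
  refine (isCompact_Icc (a := (0 : M.SA → ℝ)) (b := 1)).of_isClosed_subset ?_ fun g hg =>
    ⟨fun s => hc.trans (hg.1 s), fun s => le_one_of_mem_policySet hc hg s⟩
  refine IsClosed.inter ?_ ?_
  · change IsClosed {g : M.SA → ℝ | ∀ s, c ≤ g s}
    simp only [Set.ofPred_forall]
    exact isClosed_iInter fun s => isClosed_le continuous_const (continuous_apply s)
  · change IsClosed {g : M.SA → ℝ | ∀ x, ∑ a, g (x, a) = 1}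
    simp only [Set.ofPred_forall]
    exact isClosed_iInter fun x => isClosed_eq
      (continuous_finsetSum _ fun a _ => continuous_apply _) continuous_const

theorem isPosPolicy_of_mem_policySet {c : ℝ} (hc : 0 < c) {g : M.SA → ℝ}
    (hg : g ∈ M.policySet c) : M.IsPosPolicy g :=
  ⟨fun s => hc.trans_le (hg.1 s), hg.2⟩

variable {k : M.SA → ↥M.X → ℝ}

theorem sum_policyChain (hk : IsKernel k) {c : ℝ} {g : M.SA → ℝ} (hg : g ∈ M.policySet c)
    (s : M.SA) : ∑ s', policyChain k g s s' = 1 := by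
  simp only [policyChain, Matrix.of_apply]
  rw [Fintype.sum_prod_type]
  simp only [← Finset.mul_sum, hg.2, mul_one, hk.2]

theorem policyChain_nonneg (hk : IsKernel k) {c : ℝ} (hc : 0 ≤ c) {g : M.SA → ℝ}
    (hg : g ∈ M.policySet c) (s s' : M.SA) : 0 ≤ policyChain k g s s' :=
  mul_nonneg (hk.1 _ _) (hc.trans (hg.1 _))

theorem IsKernel.le_one (hk : IsKernel k) (s : M.SA) (x : ↥M.X) : k s x ≤ 1 := by
  rw [← hk.2 s]
  exact Finset.single_le_sum (f := fun x => k s x) (fun x _ => hk.1 _ _) (Finset.mem_univ x)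

theorem norm_policyChain_mulVec_le (hk : IsKernel k) {c : ℝ} (hc : 0 ≤ c) {g : M.SA → ℝ}
    (hg : g ∈ M.policySet c) (x : M.SA → ℝ) : ‖Matrix.mulVec (policyChain k g) x‖ ≤ ‖x‖ := by
  refine (pi_norm_le_iff_of_nonneg (norm_nonneg _)).2 fun s => ?_
  calc ‖∑ s', policyChain k g s s' * x s'‖ ≤ ∑ s', policyChain k g s s' * ‖x‖ := by
        refine (norm_sum_le _ _).trans (Finset.sum_le_sum fun s' _ => ?_)
        rw [norm_mul, Real.norm_of_nonneg (policyChain_nonneg hk hc hg s s')]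
        exact mul_le_mul_of_nonneg_left (norm_le_pi_norm x s') (policyChain_nonneg hk hc hg s s')
    _ = ‖x‖ := by rw [← Finset.sum_mul, sum_policyChain hk hg, one_mul]

theorem norm_policyChain_sub_mulVec_le (hk : IsKernel k) (g g' x : M.SA → ℝ) :
    ‖Matrix.mulVec (policyChain k g - policyChain k g') x‖ ≤
      Fintype.card M.SA * (‖g - g'‖ * ‖x‖) := by
  refine (pi_norm_le_iff_of_nonneg (by positivity)).2 fun s => ?_
  refine (norm_sum_le _ _).trans ((Finset.sum_le_card_nsmul _ _ (‖g - g'‖ * ‖x‖)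
    fun s' _ => ?_).trans_eq (by simp))
  rw [norm_mul]
  refine mul_le_mul ?_ (norm_le_pi_norm x s') (norm_nonneg _) (norm_nonneg _)
  change ‖k s s'.1 * g s' - k s s'.1 * g' s'‖ ≤ ‖g - g'‖
  rw [← mul_sub, norm_mul, Real.norm_of_nonneg (hk.1 _ _)]
  calc k s s'.1 * ‖g s' - g' s'‖ ≤ 1 * ‖g - g'‖ :=
        mul_le_mul (hk.le_one _ _) (norm_le_pi_norm (g - g') s') (norm_nonneg _) zero_le_one
    _ = _ := one_mul _

/-- Uniform bounds for the solutions of the Poisson equation under the policies in a compact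
set. -/
structure PoissonBound (k : M.SA → ↥M.X → ℝ) (c C : ℝ) : Prop where
  one_le : 1 ≤ C
  norm_le : ∀ g ∈ M.policySet c, ∀ h, ‖poissonSol (policyChain k g) h‖ ≤ C * ‖h‖
  norm_sub_le : ∀ g ∈ M.policySet c, ∀ g' ∈ M.policySet c, ∀ h h',
    ‖poissonSol (policyChain k g) h - poissonSol (policyChain k g') h'‖ ≤
      C * (‖h - h'‖ + ‖g - g'‖ * ‖h'‖)
  equation : ∀ g ∈ M.policySet c, ∀ (h : M.SA → ℝ) (s : M.SA),
    h s - ∑ s', stationaryDist (policyChain k g) s' * h s' = poissonSol (policyChain k g) h s -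
      Matrix.mulVec (policyChain k g) (poissonSol (policyChain k g) h) s
  abs_stationary_sub_le : ∀ g ∈ M.policySet c, ∀ g' ∈ M.policySet c, ∀ h h' : M.SA → ℝ,
    |∑ s, stationaryDist (policyChain k g) s * h s -
      ∑ s, stationaryDist (policyChain k g') s * h' s| ≤ C * (‖h - h'‖ + ‖g - g'‖ * ‖h'‖)

theorem abs_mean_le {S : Type*} [Fintype S] [Nonempty S] (x : S → ℝ) :
    |1 / (Fintype.card S : ℝ) * ∑ s, x s| ≤ ‖x‖ := by
  have hc : (0 : ℝ) < Fintype.card S := by exact_mod_cast Fintype.card_pos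
  rw [abs_mul, abs_of_pos (by positivity), one_div, inv_mul_le_iff₀ hc]
  refine (Finset.abs_sum_le_sum_abs _ _).trans ((Finset.sum_le_card_nsmul _ _ ‖x‖
    fun s _ => norm_le_pi_norm x s).trans_eq (by simp))

/-- Policies with all probabilities at least `c > 0` form a compact set on which every chain is
ergodic, so the Poisson inverses are uniformly bounded. The resolvent identity upgrades this to
Lipschitz dependence on force and policy, and stationary averages follow as uniform means of Poisson
solutions. Any larger constant is allowed, so that both chains can share one. -/
theorem exists_poissonBound (hk : IsKernel k)
    (hE : ∀ f, M.IsPosPolicy f → IsErgodic (policyChain k f)) {c : ℝ} (hc : 0 < c) :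
    ∃ C, ∀ C', C ≤ C' → PoissonBound k c C' := by
  have := M.nonempty_SA
  have hu : ∀ g ∈ M.policySet c, IsUnit (poissonMatrix (policyChain k g)).det := fun g hg =>
    isUnit_det_poissonMatrix (hE g (isPosPolicy_of_mem_policySet hc hg)) (sum_policyChain hk hg)
  have hcont : Continuous (policyChain k) := by
    refine continuous_matrix fun i j => ?_
    simp only [policyChain, Matrix.of_apply]
    fun_prop
  have hst : ∀ g ∈ M.policySet c, IsStationary (policyChain k g)
      (stationaryDist (policyChain k g)) := fun g hg =>
    isStationary_stationaryDist (policyChain_nonneg hk hc.le hg) (sum_policyChain hk hg)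
  obtain ⟨C, hC⟩ := exists_norm_poissonSol_le (M.isCompact_policySet hc.le) hcont hu
  set n : ℝ := ((Fintype.card M.SA : ℕ) : ℝ)
  have hn : 0 ≤ n := by positivity
  -- The sign of `C` is not known, hence `max C 0`. The last entry is the factor from the resolvent
  -- identity: two inverses, and `n` for the change of the transition matrix.
  refine ⟨max 1 (max C (max (max C 0) (max C 0 * n * max C 0))), fun C' hC' => ?_⟩
  obtain ⟨h1, h2, h3, h4⟩ : 1 ≤ C' ∧ C ≤ C' ∧ max C 0 ≤ C' ∧ max C 0 * n * max C 0 ≤ C' := by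
    simpa [max_le_iff, and_assoc] using hC'
  have hsub : ∀ g ∈ M.policySet c, ∀ g' ∈ M.policySet c, ∀ h h',
    ‖poissonSol (policyChain k g) h - poissonSol (policyChain k g') h'‖ ≤
      C' * (‖h - h'‖ + ‖g - g'‖ * ‖h'‖) := by
    intro g hg g' hg' h h'
    have hC0 : 0 ≤ max C 0 := le_max_right _ _
    rw [poissonSol_sub (hu g hg) (hu g' hg')]
    calc _ ≤ max C 0 * ‖h - h' + Matrix.mulVec (policyChain k g - policyChain k g')
              (poissonSol (policyChain k g') h')‖ :=
          (hC g hg _).trans (mul_le_mul_of_nonneg_right (le_max_left _ _) (norm_nonneg _))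
      _ ≤ max C 0 * (‖h - h'‖ + n * (‖g - g'‖ * (max C 0 * ‖h'‖))) := by
          gcongr
          refine (norm_add_le _ _).trans (add_le_add le_rfl
            ((norm_policyChain_sub_mulVec_le hk g g' _).trans ?_))
          gcongr
          exact (hC g' hg' _).trans (mul_le_mul_of_nonneg_right (le_max_left _ _) (norm_nonneg _))
      _ = max C 0 * ‖h - h'‖ + max C 0 * n * max C 0 * (‖g - g'‖ * ‖h'‖) := by ring
      _ ≤ C' * ‖h - h'‖ + C' * (‖g - g'‖ * ‖h'‖) := by gcongr
      _ = _ := by ring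
  refine ⟨h1, fun g hg h => (hC g hg h).trans (mul_le_mul_of_nonneg_right h2 (norm_nonneg _)),
    hsub, fun g hg h s => (hst g hg).poisson_equation (hu g hg) h s, fun g hg g' hg' h h' => ?_⟩
  rw [(hst g hg).sum_mul_eq_mean_poissonSol (hu g hg),
    (hst g' hg').sum_mul_eq_mean_poissonSol (hu g' hg'), ← mul_sub, ← Finset.sum_sub_distrib]
  exact (abs_mean_le (poissonSol (policyChain k g) h - poissonSol (policyChain k g') h')).trans
    (hsub g hg g' hg' h h')

end MDP
-- Hoeffding's lemma and conditional laws on a finite set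
theorem sum_mul_exp_le {S : Type*} [Fintype S] {q y : S → ℝ} (hq : ∀ s, 0 ≤ q s)
    (hq1 : ∑ s, q s = 1) (hy : ∀ s, |y s| ≤ 2) (hy0 : ∑ s, q s * y s = 0) (t : ℝ) :
    ∑ s, q s * Real.exp (t * y s) ≤ Real.exp (2 * t ^ 2) := by
  -- On `[-2, 2]` convexity puts `exp (t y)` below its chord. Averaging removes the linear part
  -- because `y` is centred, and leaves `cosh (2 t)`.
  have h1 : ∀ s, q s * Real.exp (t * y s) ≤
      q s * Real.cosh (2 * t) + q s * y s * (Real.sinh (2 * t) / 2) := by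
    intro s
    have hs : |y s / 2| ≤ 1 := by
      rw [abs_div, abs_two]; linarith [hy s]
    have := Real.exp_mul_le_cosh_add_mul_sinh hs (2 * t)
    rw [show y s / 2 * (2 * t) = t * y s by ring] at this
    calc _ ≤ q s * (Real.cosh (2 * t) + y s / 2 * Real.sinh (2 * t)) :=
          mul_le_mul_of_nonneg_left this (hq s)
      _ = _ := by ring
  calc _ ≤ ∑ s, (q s * Real.cosh (2 * t) + q s * y s * (Real.sinh (2 * t) / 2)) :=
        Finset.sum_le_sum fun s _ => h1 s
    _ = Real.cosh (2 * t) := by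
        rw [Finset.sum_add_distrib, ← Finset.sum_mul, ← Finset.sum_mul, hq1, hy0]; ring
    _ ≤ Real.exp ((2 * t) ^ 2 / 2) := Real.cosh_le_exp_half_sq _
    _ = _ := by ring_nf

theorem measurable_apply_of_finite {Ω S E : Type*} {m : MeasurableSpace Ω} [MeasurableSpace S]
    [Finite S] [MeasurableSingletonClass S] [MeasurableSpace E] {f : Ω → S → E} {x : Ω → S}
    (hf : ∀ s, Measurable[m] fun ω => f ω s) (hx : Measurable[m] x) :
    Measurable[m] fun ω => f ω (x ω) := by
  have : Measurable fun p : Ω × S => f p.1 p.2 := measurable_from_prod_countable_left hf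
  exact this.comp (measurable_id.prodMk hx)

section CondLaw

variable {Ω : Type*} {m m0 : MeasurableSpace Ω} {μ : Measure Ω} [IsProbabilityMeasure μ]

/-- On the smaller σ-algebra `μ` restricted to `A` and the measure with density `q` coincide, by the
definition of conditional expectation. Working with measures allows an arbitrary nonnegative `W`,
without integrability; the exponentials below are of this kind. -/
theorem setLIntegral_eq_of_condExp_indicator (hm : m ≤ m0) {A : Set Ω} (hA : MeasurableSet A)
    {q : Ω → ℝ} (hq0 : ∀ ω, 0 ≤ q ω) (hqm : Measurable[m] q)
    (h : μ[A.indicator (fun _ => (1 : ℝ)) | m] =ᵐ[μ] q) {W : Ω → ENNReal}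
    (hW : Measurable[m] W) :
    ∫⁻ ω in A, W ω ∂μ = ∫⁻ ω, ENNReal.ofReal (q ω) * W ω ∂μ := by
  have hq' : Measurable fun ω => ENNReal.ofReal (q ω) := (hqm.mono hm le_rfl).ennreal_ofReal
  have hqi : Integrable q μ := integrable_condExp.congr h
  have hmeas : (μ.restrict A).trim hm =
      (μ.withDensity fun ω => ENNReal.ofReal (q ω)).trim hm := by
    refine @Measure.ext _ m _ _ fun B hB => ?_
    have hB' : MeasurableSet[m0] B := hm _ hB
    rw [trim_measurableSet_eq hm hB, trim_measurableSet_eq hm hB, Measure.restrict_apply hB',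
      withDensity_apply _ hB', ← ofReal_integral_eq_lintegral_ofReal hqi.integrableOn
        (Filter.Eventually.of_forall hq0),
      ← setIntegral_congr_ae hB' (h.mono fun ω hω _ => hω),
      setIntegral_condExp hm ((integrable_const 1).indicator hA) hB, setIntegral_indicator hA]
    simp
  rw [← lintegral_trim hm hW, hmeas, lintegral_trim hm hW,
    lintegral_withDensity_eq_lintegral_mul _ hq' (hW.mono hm le_rfl)]
  rfl

theorem lintegral_apply_eq_of_condExp {S : Type*} [MeasurableSpace S] [Fintype S]
    [MeasurableSingletonClass S] (hm : m ≤ m0) {X : Ω → S} (hX : Measurable X)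
    {q : Ω → S → ℝ} (hq0 : ∀ ω s, 0 ≤ q ω s) (hqm : ∀ s, Measurable[m] fun ω => q ω s)
    (h : ∀ s, μ[(X ⁻¹' {s}).indicator (fun _ => (1 : ℝ)) | m] =ᵐ[μ] fun ω => q ω s)
    {W : Ω → S → ENNReal} (hW : ∀ s, Measurable[m] fun ω => W ω s) :
    ∫⁻ ω, W ω (X ω) ∂μ = ∫⁻ ω, ∑ s, ENNReal.ofReal (q ω s) * W ω s ∂μ := by
  have hA : ∀ s, MeasurableSet (X ⁻¹' {s}) := fun s => hX (measurableSet_singleton s)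
  have e : ∀ ω, W ω (X ω) = ∑ s, (X ⁻¹' {s}).indicator (fun ω => W ω s) ω := by
    intro ω
    classical
    simp [Set.indicator_apply]
  simp_rw [e]
  have hqW : ∀ s, Measurable fun ω => ENNReal.ofReal (q ω s) * W ω s := fun s =>
    ((hqm s).mono hm le_rfl).ennreal_ofReal.mul ((hW s).mono hm le_rfl)
  rw [lintegral_finsetSum _ fun s _ => ((hW s).mono hm le_rfl).indicator (hA s),
    lintegral_finsetSum _ fun s _ => hqW s]
  refine Finset.sum_congr rfl fun s _ => ?_
  rw [lintegral_indicator (hA s)]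
  exact setLIntegral_eq_of_condExp_indicator hm (hA s) (fun ω => hq0 ω s) (hqm s) (h s) (hW s)

end CondLaw

/-! ### Exponential moments of martingales driven by a finite chain -/

section Martingale

variable {Ω : Type*} {m0 : MeasurableSpace Ω} {μ : Measure Ω}
  {S : Type*} [MeasurableSpace S] [Fintype S] [MeasurableSingletonClass S]

/-- The martingale with increments `G_k(x_{k+1}) - E[G_k(x_{k+1}) | F_k]`, where `q_k` is the
conditional law of `x_{k+1}`. -/
noncomputable def martSum (x : ℕ → Ω → S) (q G : ℕ → Ω → S → ℝ) (n : ℕ) (ω : Ω) : ℝ :=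
  ∑ k ∈ Finset.range n, (G k ω (x (k + 1) ω) - ∑ s, q k ω s * G k ω s)

/-- A process `x` adapted to `F` together with its conditional laws `q`. -/
structure HasCondLaw (μ : Measure Ω) (F : ℕ → MeasurableSpace Ω) (x : ℕ → Ω → S)
    (q : ℕ → Ω → S → ℝ) : Prop where
  mono : Monotone F
  le : ∀ k, F k ≤ m0
  meas : ∀ k, Measurable[F k] (x k)
  nonneg : ∀ k ω s, 0 ≤ q k ω s
  sum_eq : ∀ k ω, ∑ s, q k ω s = 1
  meas_law : ∀ k s, Measurable[F k] fun ω => q k ω s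
  law : ∀ k s, μ[(x (k + 1) ⁻¹' {s}).indicator (fun _ => (1 : ℝ)) | F k] =ᵐ[μ] fun ω => q k ω s

variable {F : ℕ → MeasurableSpace Ω} {x : ℕ → Ω → S} {q G : ℕ → Ω → S → ℝ}

theorem HasCondLaw.measurable_martSum (h : HasCondLaw μ F x q)
    (hG : ∀ k s, Measurable[F k] fun ω => G k ω s) (n : ℕ) :
    Measurable[F n] (martSum x q G n) := by
  unfold martSum
  refine Finset.measurable_fun_sum _ fun k hk => ?_
  have hkn : k + 1 ≤ n := Finset.mem_range.1 hk
  have hk1 : F k ≤ F n := h.mono (Nat.le_of_succ_le hkn)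
  refine Measurable.sub ?_ (Finset.measurable_fun_sum _ fun s _ => ?_)
  · exact measurable_apply_of_finite (fun s => (hG k s).mono hk1 le_rfl)
      ((h.meas (k + 1)).mono (h.mono hkn) le_rfl)
  · exact ((h.meas_law k s).mono hk1 le_rfl).mul ((hG k s).mono hk1 le_rfl)

/-- Azuma's induction: given `F n` the factor of the first `n` increments is fixed, and Hoeffding's
lemma bounds the factor of the last one by `exp (2 t²)`. -/
theorem HasCondLaw.lintegral_exp_martSum_le [IsProbabilityMeasure μ] (h : HasCondLaw μ F x q)
    (hG : ∀ k s, Measurable[F k] fun ω => G k ω s) (n : ℕ)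
    (hG1 : ∀ k < n, ∀ᵐ ω ∂μ, ∀ s, |G k ω s| ≤ 1) (t : ℝ) :
    ∫⁻ ω, ENNReal.ofReal (Real.exp (t * martSum x q G n ω)) ∂μ ≤
      ENNReal.ofReal (Real.exp (2 * t ^ 2 * n)) := by
  induction n with
  | zero => simp [martSum]
  | succ n ih =>
    have hM := (h.measurable_martSum hG n).const_mul t
    -- The exponential at time `n + 1` as a function of the next state `s`, with coefficients
    -- measurable at time `n`; averaging over the law `q n` then integrates out `x (n + 1)`.
    set W : Ω → S → ENNReal := fun ω s => ENNReal.ofReal (Real.exp (t * martSum x q G n ω) *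
      Real.exp (t * (G n ω s - ∑ s, q n ω s * G n ω s))) with hWdef
    have hW : ∀ s, Measurable[F n] fun ω => W ω s := fun s =>
      ((Real.measurable_exp.comp hM).mul (Real.measurable_exp.comp (((hG n s).sub
        (Finset.measurable_fun_sum _ fun s _ => (h.meas_law n s).mul (hG n s))).const_mul
          t))).ennreal_ofReal
    have e : ∀ ω, ENNReal.ofReal (Real.exp (t * martSum x q G (n + 1) ω)) = W ω (x (n + 1) ω) := by
      intro ω
      simp only [hWdef, martSum, Finset.sum_range_succ, mul_add, Real.exp_add]
    simp_rw [e]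
    rw [lintegral_apply_eq_of_condExp (h.le n) ((h.meas (n + 1)).mono (h.le _) le_rfl)
      (h.nonneg n) (h.meas_law n) (h.law n) hW]
    calc _ ≤ ∫⁻ ω, ENNReal.ofReal (Real.exp (t * martSum x q G n ω)) *
            ENNReal.ofReal (Real.exp (2 * t ^ 2)) ∂μ := by
          refine lintegral_mono_ae ?_
          filter_upwards [hG1 n (Nat.lt_succ_self n)] with ω hω
          have hb : |∑ s, q n ω s * G n ω s| ≤ 1 := by
            refine (Finset.abs_sum_le_sum_abs _ _).trans ?_
            rw [← h.sum_eq n ω]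
            refine Finset.sum_le_sum fun s _ => ?_
            rw [abs_mul, abs_of_nonneg (h.nonneg n ω s)]
            exact mul_le_of_le_one_right (h.nonneg n ω s) (hω s)
          -- The force is bounded by 1 and so is its conditional mean, which gives the bound 2 for
          -- the centred increment.
          have key := sum_mul_exp_le (h.nonneg n ω) (h.sum_eq n ω)
            (y := fun s => G n ω s - ∑ s, q n ω s * G n ω s)
            (fun s => (abs_sub _ _).trans (by linarith [hω s]))
            (by simp only [mul_sub, Finset.sum_sub_distrib, ← Finset.sum_mul, h.sum_eq n ω]; ring) t
          rw [← ENNReal.ofReal_mul (Real.exp_nonneg _)]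
          simp only [hWdef]
          simp_rw [← ENNReal.ofReal_mul (h.nonneg n ω _)]
          rw [← ENNReal.ofReal_sum_of_nonneg fun s _ => by
            have := h.nonneg n ω s; positivity]
          refine ENNReal.ofReal_le_ofReal ?_
          calc _ = Real.exp (t * martSum x q G n ω) * ∑ s, q n ω s *
                Real.exp (t * (G n ω s - ∑ s, q n ω s * G n ω s)) := by
                rw [Finset.mul_sum]
                exact Finset.sum_congr rfl fun s _ => by ring
            _ ≤ _ := mul_le_mul_of_nonneg_left key (Real.exp_nonneg _)
      _ = (∫⁻ ω, ENNReal.ofReal (Real.exp (t * martSum x q G n ω)) ∂μ) *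
            ENNReal.ofReal (Real.exp (2 * t ^ 2)) :=
          lintegral_mul_const _ (Real.measurable_exp.comp (hM.mono (h.le n) le_rfl)).ennreal_ofReal
      _ ≤ ENNReal.ofReal (Real.exp (2 * t ^ 2 * n)) * ENNReal.ofReal (Real.exp (2 * t ^ 2)) :=
          mul_le_mul_left (ih fun k hk => hG1 k (hk.trans (Nat.lt_succ_self n))) _
      _ = _ := by
          rw [← ENNReal.ofReal_mul (Real.exp_nonneg _), ← Real.exp_add]
          push_cast
          ring_nf

end Martingale

/-! ### Variables with exponential moments: martingales and independent sums -/

section ExpBound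

variable {Ω : Type*} {m0 : MeasurableSpace Ω} {μ : Measure Ω}

/-- `X` is a random variable with `E exp |X| ≤ K`. -/
structure ExpBound (μ : Measure Ω) (K : ℝ) (X : Ω → ℝ) : Prop where
  measurable : Measurable X
  lintegral_le : ∫⁻ ω, ENNReal.ofReal (Real.exp |X ω|) ∂μ ≤ ENNReal.ofReal K

theorem ExpBound.mono {K K' : ℝ} {X : Ω → ℝ} (h : ExpBound μ K X) (hK : K ≤ K') :
    ExpBound μ K' X := ⟨h.1, h.2.trans (ENNReal.ofReal_le_ofReal hK)⟩

theorem expBound_of_exp_le {K : ℝ} {X : Ω → ℝ} (hX : Measurable X)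
    (h1 : ∫⁻ ω, ENNReal.ofReal (Real.exp (X ω)) ∂μ ≤ ENNReal.ofReal K)
    (h2 : ∫⁻ ω, ENNReal.ofReal (Real.exp (-X ω)) ∂μ ≤ ENNReal.ofReal K) (hK : 0 ≤ K) :
    ExpBound μ (2 * K) X := by
  refine ⟨hX, ?_⟩
  calc _ ≤ ∫⁻ ω, (ENNReal.ofReal (Real.exp (X ω)) + ENNReal.ofReal (Real.exp (-X ω))) ∂μ := by
        refine lintegral_mono fun ω => ?_
        rcases abs_cases (X ω) with ⟨h, _⟩ | ⟨h, _⟩ <;> simp only [h]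
        · exact le_self_add
        · exact le_add_self
    _ = _ := lintegral_add_left (Real.measurable_exp.comp hX).ennreal_ofReal _
    _ ≤ ENNReal.ofReal K + ENNReal.ofReal K := add_le_add h1 h2
    _ = _ := by rw [← ENNReal.ofReal_add hK hK, two_mul]

theorem ExpBound.lintegral_pow_le {K : ℝ} {X : Ω → ℝ} (h : ExpBound μ K X) (n : ℕ) :
    ∫⁻ ω, ENNReal.ofReal (|X ω| ^ n) ∂μ ≤ ENNReal.ofReal (n.factorial * K) := by
  rw [ENNReal.ofReal_mul (by positivity)]
  refine le_trans ?_ (mul_le_mul_right h.lintegral_le _)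
  have hm : Measurable fun ω => ENNReal.ofReal (Real.exp |X ω|) :=
    (Real.measurable_exp.comp h.measurable.abs).ennreal_ofReal
  rw [← lintegral_const_mul _ hm]
  refine lintegral_mono fun ω => ?_
  rw [← ENNReal.ofReal_mul (by positivity)]
  refine ENNReal.ofReal_le_ofReal ?_
  have := Real.pow_div_factorial_le_exp |X ω| (abs_nonneg _) n
  rwa [div_le_iff₀' (by positivity)] at this

/-- Take `t = ± N^(-1/2)` in the exponential estimate: the exponent `2 t² n` is at most `2 T`,
uniformly in `n ≤ N T`. -/
theorem HasCondLaw.expBound_martSum [IsProbabilityMeasure μ] {S : Type*} [MeasurableSpace S]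
    [Fintype S] [MeasurableSingletonClass S] {F : ℕ → MeasurableSpace Ω} {x : ℕ → Ω → S}
    {q G : ℕ → Ω → S → ℝ} (h : HasCondLaw μ F x q)
    (hG : ∀ k s, Measurable[F k] fun ω => G k ω s) {n N : ℕ} (hN : 0 < N) {T : ℝ}
    (hn : (n : ℝ) ≤ N * T) (hG1 : ∀ k < n, ∀ᵐ ω ∂μ, ∀ s, |G k ω s| ≤ 1) :
    ExpBound μ (2 * Real.exp (2 * T)) fun ω => (Real.sqrt N)⁻¹ * martSum x q G n ω := by
  have hN' : (0 : ℝ) < N := by exact_mod_cast hN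
  have hsq : (Real.sqrt N)⁻¹ ^ 2 = (N : ℝ)⁻¹ := by rw [inv_pow, Real.sq_sqrt hN'.le]
  have hb : ∀ t : ℝ, t ^ 2 = (N : ℝ)⁻¹ → ENNReal.ofReal (Real.exp (2 * t ^ 2 * n)) ≤
      ENNReal.ofReal (Real.exp (2 * T)) := fun t ht => by
    refine ENNReal.ofReal_le_ofReal (Real.exp_le_exp.2 ?_)
    rw [ht]
    calc 2 * (N : ℝ)⁻¹ * n ≤ 2 * (N : ℝ)⁻¹ * (N * T) := by gcongr
      _ = 2 * T := by field_simp
  refine expBound_of_exp_le ?_ ((h.lintegral_exp_martSum_le hG n hG1 _).trans (hb _ hsq)) ?_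
    (Real.exp_nonneg _)
  · exact (((h.measurable_martSum hG n).mono (h.le n) le_rfl)).const_mul _
  · have := (h.lintegral_exp_martSum_le hG n hG1 (-(Real.sqrt N)⁻¹)).trans
      (hb _ (by rw [neg_sq, hsq]))
    simpa only [neg_mul] using this

/-- Hoeffding's lemma for a bounded centred variable, by the same comparison of the exponential with
its chord. -/
theorem integral_exp_le_of_integral_eq_zero {Z : Type*} [MeasurableSpace Z] {ν : Measure Z}
    [IsProbabilityMeasure ν] {φ : Z → ℝ} (hφ : Measurable φ) {b : ℝ} (hb : 0 < b)
    (hφb : ∀ᵐ z ∂ν, |φ z| ≤ b) (hφ0 : ∫ z, φ z ∂ν = 0) (t : ℝ) :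
    Integrable (fun z => Real.exp (t * φ z)) ν ∧
      ∫ z, Real.exp (t * φ z) ∂ν ≤ Real.exp (t ^ 2 * b ^ 2 / 2) := by
  have hφi : Integrable φ ν := Integrable.of_bound hφ.aestronglyMeasurable b hφb
  have hi : Integrable (fun z => Real.exp (t * φ z)) ν := by
    refine Integrable.of_bound
      (Real.measurable_exp.comp (hφ.const_mul t)).aestronglyMeasurable (Real.exp (|t| * b)) ?_
    filter_upwards [hφb] with z hz
    rw [Real.norm_of_nonneg (Real.exp_nonneg _)]
    refine Real.exp_le_exp.2 ((le_abs_self _).trans ?_)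
    rw [abs_mul]
    gcongr
  refine ⟨hi, ?_⟩
  calc _ ≤ ∫ z, (Real.cosh (t * b) + φ z * (Real.sinh (t * b) / b)) ∂ν := by
        refine integral_mono_ae hi ((integrable_const _).add (hφi.mul_const _)) ?_
        filter_upwards [hφb] with z hz
        have hz' : |φ z / b| ≤ 1 := by
          rw [abs_div, abs_of_pos hb]; exact div_le_one_of_le₀ hz hb.le
        have := Real.exp_mul_le_cosh_add_mul_sinh hz' (t * b)
        rw [show φ z / b * (t * b) = t * φ z by field_simp] at this
        exact this.trans_eq (by ring)
    _ = Real.cosh (t * b) := by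
        rw [integral_add (integrable_const _) (hφi.mul_const _), integral_mul_const, hφ0]
        simp
    _ ≤ Real.exp ((t * b) ^ 2 / 2) := Real.cosh_le_exp_half_sq _
    _ = _ := by ring_nf

/-- Under the product law the exponential of the sum factors, and each factor is at most `exp (t² b²
/ 2)`. With `t = ± 1 / (b √N)` the `N` factors multiply to at most `exp (1/2)`. -/
theorem expBound_sum_iid {Z : Type*} [MeasurableSpace Z] {ν : Measure Z}
    [IsProbabilityMeasure ν] {φ : Z → ℝ} (hφ : Measurable φ) {b : ℝ} (hb : 0 < b)
    (hφb : ∀ᵐ z ∂ν, |φ z| ≤ b) (hφ0 : ∫ z, φ z ∂ν = 0) {N : ℕ} (hN : 0 < N)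
    {Y : Ω → Fin N → Z} (hY : Measurable Y) (hlaw : μ.map Y = Measure.pi fun _ => ν) :
    ExpBound μ (2 * Real.exp (1 / 2)) fun ω => (b * Real.sqrt N)⁻¹ * ∑ i, φ (Y ω i) := by
  have hN' : (0 : ℝ) < N := by exact_mod_cast hN
  have hmS : Measurable fun y : Fin N → Z => ∑ i, φ (y i) :=
    Finset.measurable_fun_sum _ fun i _ => hφ.comp (measurable_pi_apply i)
  have key : ∀ t : ℝ, t ^ 2 = (b ^ 2 * N)⁻¹ →
      ∫⁻ ω, ENNReal.ofReal (Real.exp (t * ∑ i, φ (Y ω i))) ∂μ ≤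
        ENNReal.ofReal (Real.exp (1 / 2)) := by
    intro t ht
    obtain ⟨hi, hle⟩ := integral_exp_le_of_integral_eq_zero hφ hb hφb hφ0 t
    rw [← lintegral_map (f := fun y : Fin N → Z => ENNReal.ofReal (Real.exp (t * ∑ i, φ (y i))))
      (Real.measurable_exp.comp (hmS.const_mul t)).ennreal_ofReal hY, hlaw]
    have e : ∀ y : Fin N → Z, Real.exp (t * ∑ i, φ (y i)) = ∏ i, Real.exp (t * φ (y i)) := by
      intro y; rw [Finset.mul_sum, Real.exp_sum]
    simp_rw [e]
    rw [← ofReal_integral_eq_lintegral_ofReal (Integrable.fintype_prod fun _ => hi)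
      (Filter.Eventually.of_forall fun y => Finset.prod_nonneg fun i _ => Real.exp_nonneg _),
      integral_fintype_prod_eq_pow (ι := Fin N) (fun z => Real.exp (t * φ z))]
    refine ENNReal.ofReal_le_ofReal ?_
    calc _ ≤ Real.exp (t ^ 2 * b ^ 2 / 2) ^ Fintype.card (Fin N) :=
          pow_le_pow_left₀ (integral_nonneg fun _ => Real.exp_nonneg _) hle _
      _ = Real.exp (1 / 2) := by
          rw [← Real.exp_nat_mul, ht, Fintype.card_fin]
          congr 1
          field_simp
  have hsq : (b * Real.sqrt N)⁻¹ ^ 2 = (b ^ 2 * N)⁻¹ := by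
    rw [inv_pow, mul_pow, Real.sq_sqrt hN'.le]
  refine expBound_of_exp_le ((hmS.comp hY).const_mul _) (key _ hsq) ?_ (Real.exp_nonneg _)
  simpa only [neg_mul] using key (-(b * Real.sqrt N)⁻¹) (by rw [neg_sq, hsq])

end ExpBound

/-! ### Lipschitz bounds for policies, forces and drifts -/

namespace MDP

variable {dx da : ℕ} {M : MDP dx da}

theorem sum_exp_pos (P : M.SA → ℝ) (s : M.SA) : 0 < ∑ a, Real.exp (P (s.1, a)) :=
  Finset.sum_pos (fun _ _ => Real.exp_pos _) ⟨s.2, Finset.mem_univ _⟩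

theorem softmax_pos (P : M.SA → ℝ) (s : M.SA) : 0 < M.softmax P s :=
  div_pos (Real.exp_pos _) (sum_exp_pos P s)

theorem nonempty_A (M : MDP dx da) : Nonempty ↥M.A := M.nonempty_SA.map Prod.snd

theorem sum_softmax (P : M.SA → ℝ) (x : ↥M.X) : ∑ a, M.softmax P (x, a) = 1 := by
  obtain ⟨a⟩ := M.nonempty_A
  simp only [softmax]
  rw [← Finset.sum_div, div_self (sum_exp_pos P (x, a)).ne']

theorem softmax_le_one (P : M.SA → ℝ) (s : M.SA) : M.softmax P s ≤ 1 := by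
  rw [← sum_softmax P s.1]
  exact Finset.single_le_sum (f := fun a => M.softmax P (s.1, a))
    (fun a _ => (softmax_pos P _).le) (Finset.mem_univ s.2)

/-- Numerator and denominator each change by a factor of at most `exp ‖P - P'‖`. Hence the Lipschitz
constant of the softmax does not depend on the number of actions. -/
theorem softmax_le_mul_exp (P P' : M.SA → ℝ) (s : M.SA) :
    M.softmax P s ≤ M.softmax P' s * Real.exp (2 * ‖P - P'‖) := by
  set d := ‖P - P'‖
  have hd : ∀ s, |P s - P' s| ≤ d := fun s => norm_le_pi_norm (P - P') s
  have h1 : Real.exp (P s) ≤ Real.exp (P' s) * Real.exp d := by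
    rw [← Real.exp_add]
    exact Real.exp_le_exp.2 (by linarith [(abs_le.1 (hd s)).2])
  have h2 : ∑ a, Real.exp (P' (s.1, a)) ≤ (∑ a, Real.exp (P (s.1, a))) * Real.exp d := by
    rw [Finset.sum_mul]
    refine Finset.sum_le_sum fun a _ => ?_
    rw [← Real.exp_add]
    exact Real.exp_le_exp.2 (by linarith [(abs_le.1 (hd (s.1, a))).1])
  rw [softmax, softmax, div_mul_eq_mul_div, div_le_div_iff₀ (sum_exp_pos P s) (sum_exp_pos P' s),
    two_mul, Real.exp_add]
  calc _ ≤ (Real.exp (P' s) * Real.exp d) * ((∑ a, Real.exp (P (s.1, a))) * Real.exp d) :=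
        mul_le_mul h1 h2 (sum_exp_pos P' s).le (by positivity)
    _ = _ := by ring

theorem softmax_sub_le (P P' : M.SA → ℝ) (s : M.SA) :
    M.softmax P s - M.softmax P' s ≤ 4 * ‖P - P'‖ := by
  have hd : 0 ≤ ‖P - P'‖ := norm_nonneg _
  have h0 := (softmax_pos P' s).le
  have h1 := softmax_le_one P' s
  rcases le_or_gt (2 * ‖P - P'‖) 1 with h | h
  -- For small distance `exp (2 d) - 1 ≤ 4 d`; otherwise `4 d > 2` already exceeds any difference of
  -- probabilities.
  · have h2 := softmax_le_mul_exp P P' s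
    have h3 := Real.abs_exp_sub_one_le (x := 2 * ‖P - P'‖) (by rwa [abs_of_nonneg (by positivity)])
    rw [abs_of_nonneg (a := 2 * ‖P - P'‖) (by positivity)] at h3
    have h4 := (le_abs_self _).trans h3
    nlinarith
  · linarith [softmax_le_one P s]

theorem abs_softmax_sub_le (P P' : M.SA → ℝ) (s : M.SA) :
    |M.softmax P s - M.softmax P' s| ≤ 4 * ‖P - P'‖ := by
  rw [abs_sub_le_iff]
  refine ⟨softmax_sub_le P P' s, ?_⟩
  rw [norm_sub_rev]
  exact softmax_sub_le P' P s

theorem expRate_pos (t : ℝ) : 0 < expRate t := by unfold expRate; positivity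

theorem expRate_le_one (t : ℝ) : expRate t ≤ 1 := by
  unfold expRate
  exact div_le_one_of_le₀ (by nlinarith [sq_nonneg (Real.log (1 + t))]) (by positivity)

theorem expRate_anti {t T : ℝ} (ht : 0 ≤ t) (htT : t ≤ T) : expRate T ≤ expRate t := by
  unfold expRate
  have h1 : Real.log (1 + t) ≤ Real.log (1 + T) := Real.log_le_log (by linarith) (by linarith)
  have h0 : 0 ≤ Real.log (1 + t) := Real.log_nonneg (by linarith)
  gcongr

theorem abs_log_one_add_sub_le {t t' : ℝ} (ht : 0 ≤ t) (ht' : 0 ≤ t') :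
    |Real.log (1 + t) - Real.log (1 + t')| ≤ |t - t'| := by
  wlog h : t' ≤ t generalizing t t'
  · rw [abs_sub_comm, abs_sub_comm t]
    exact this ht' ht (le_of_not_ge h)
  have h1 : Real.log (1 + t') ≤ Real.log (1 + t) := Real.log_le_log (by linarith) (by linarith)
  rw [abs_of_nonneg (by linarith), abs_of_nonneg (by linarith),
    ← Real.log_div (by linarith) (by linarith)]
  refine (Real.log_le_sub_one_of_pos (by positivity)).trans ?_
  rw [div_sub_one (by linarith), div_le_iff₀ (by linarith)]
  nlinarith

theorem abs_expRate_sub_le {t t' : ℝ} (ht : 0 ≤ t) (ht' : 0 ≤ t') :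
    |expRate t - expRate t'| ≤ |t - t'| := by
  refine le_trans ?_ (abs_log_one_add_sub_le ht ht')
  unfold expRate
  set x := Real.log (1 + t)
  set y := Real.log (1 + t')
  have e : 1 / (1 + x ^ 2) - 1 / (1 + y ^ 2) =
      (y - x) * ((y + x) / ((1 + x ^ 2) * (1 + y ^ 2))) := by
    have : (1 + x ^ 2) ≠ 0 := by positivity
    have : (1 + y ^ 2) ≠ 0 := by positivity
    field_simp
    ring
  rw [e, abs_mul, abs_sub_comm]
  refine mul_le_of_le_one_right (abs_nonneg _) ?_
  rw [abs_div, abs_of_pos (a := (1 + x ^ 2) * (1 + y ^ 2)) (by positivity)]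
  refine div_le_one_of_le₀ (abs_le.2 ⟨?_, ?_⟩) (by positivity)
  · nlinarith [sq_nonneg (x + 1), sq_nonneg (y + 1), sq_nonneg (x * y), sq_nonneg (x + y)]
  · nlinarith [sq_nonneg (x - 1), sq_nonneg (y - 1), sq_nonneg (x * y), sq_nonneg (x + y)]

/-- The exploration rate decreases in time, so up to time `T` every action keeps probability at
least `expRate T / |A|`, whatever the actor output. This is the compact set on which the Poisson
bounds are used. -/
theorem limitPolicy_mem_policySet {t T : ℝ} (ht : t ∈ Set.Icc 0 T) (P : M.SA → ℝ) :
    M.limitPolicy t P ∈ M.policySet (expRate T / M.A.card) := by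
  have hA := M.card_A_pos
  have h1 : 0 ≤ 1 - expRate t := sub_nonneg.2 (expRate_le_one t)
  refine ⟨fun s => ?_, fun x => ?_⟩
  · have h2 : expRate T / M.A.card ≤ expRate t / M.A.card := by
      have := expRate_anti ht.1 ht.2
      gcongr
    have h3 := mul_nonneg h1 (softmax_pos P s).le
    simp only [limitPolicy, explore]
    linarith
  · simp only [limitPolicy, explore, Finset.sum_add_distrib, ← Finset.mul_sum, sum_softmax]
    simp only [Finset.sum_const, Finset.card_univ, Fintype.card_coe, nsmul_eq_mul]
    field_simp
    ring

theorem norm_limitPolicy_sub_le {t t' : ℝ} (ht : 0 ≤ t) (ht' : 0 ≤ t') (P P' : M.SA → ℝ) :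
    ‖M.limitPolicy t P - M.limitPolicy t' P'‖ ≤ 4 * (‖P - P'‖ + |t - t'|) := by
  refine (pi_norm_le_iff_of_nonneg (by positivity)).2 fun s => ?_
  have hA : (1 : ℝ) ≤ M.A.card := by exact_mod_cast M.card_A_pos
  have hA' : 1 / (M.A.card : ℝ) ≤ 1 := div_le_one_of_le₀ hA (by linarith)
  have hA'' : 0 ≤ 1 / (M.A.card : ℝ) := by positivity
  have e : (M.limitPolicy t P - M.limitPolicy t' P') s =
      (expRate t - expRate t') * (1 / M.A.card - M.softmax P s) +
        (1 - expRate t') * (M.softmax P s - M.softmax P' s) := by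
    simp only [limitPolicy, explore, Pi.sub_apply]
    ring
  rw [e, Real.norm_eq_abs]
  refine (abs_add_le _ _).trans ?_
  rw [abs_mul, abs_mul]
  have h1 : |expRate t - expRate t'| * |1 / M.A.card - M.softmax P s| ≤ |t - t'| * 1 := by
    refine mul_le_mul (abs_expRate_sub_le ht ht') ?_ (abs_nonneg _) (abs_nonneg _)
    rw [abs_le]
    constructor <;> linarith [softmax_pos P s, softmax_le_one P s]
  have h2 : |1 - expRate t'| * |M.softmax P s - M.softmax P' s| ≤ 1 * (4 * ‖P - P'‖) := by
    refine mul_le_mul ?_ (abs_softmax_sub_le P P' s) (abs_nonneg _) zero_le_one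
    rw [abs_le]
    constructor <;> linarith [expRate_pos t', expRate_le_one t']
  linarith [abs_nonneg (t - t')]

/-- A functional `h(t, p, q)(s, s')` of time, actor output and critic output whose average over
`s'` drives the output at `s`: growth and Lipschitz bounds. -/
structure ForceBound (T K : ℝ) (h : ℝ → (M.SA → ℝ) → (M.SA → ℝ) → M.SA → M.SA → ℝ) : Prop where
  one_le : 1 ≤ K
  norm_le : ∀ t ∈ Set.Icc 0 T, ∀ p q s, ‖h t p q s‖ ≤ K * (1 + ‖q‖)
  norm_sub_le : ∀ t ∈ Set.Icc 0 T, ∀ t' ∈ Set.Icc 0 T, ∀ p p' q q' s,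
    ‖h t p q s - h t' p' q' s‖ + ‖M.limitPolicy t p - M.limitPolicy t' p'‖ * ‖h t' p' q' s‖ ≤
      K * (‖q - q'‖ + (1 + ‖q'‖) * (‖p - p'‖ + |t - t'|))

/-- The temporal difference at `s'`, averaged over the next pair and weighted by the kernel. -/
noncomputable def critForce (B : M.SA → M.SA → ℝ) (t : ℝ) (p q : M.SA → ℝ) (s s' : M.SA) : ℝ :=
  B s s' * (M.reward s' + M.gamma * Matrix.mulVec (policyChain M.trans (M.limitPolicy t p)) q s' -
    q s')

/-- The policy gradient at `s'`. -/
noncomputable def actForce (B : M.SA → M.SA → ℝ) (t : ℝ) (p q : M.SA → ℝ) (s s' : M.SA) : ℝ :=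
  1 / (1 + t) * q s' * (B s s' - ∑ a, M.softmax p (s'.1, a) * B s (s'.1, a))

/-- The average of a force over the stationary distribution of the exploration policy. -/
noncomputable def drift (k : M.SA → ↥M.X → ℝ)
    (h : ℝ → (M.SA → ℝ) → (M.SA → ℝ) → M.SA → M.SA → ℝ) (t : ℝ) (p q : M.SA → ℝ) (s : M.SA) : ℝ :=
  ∑ s', stationaryDist (policyChain k (M.limitPolicy t p)) s' * h t p q s s'

variable {B : M.SA → M.SA → ℝ} {b T : ℝ}

theorem abs_reward_le (s : M.SA) : |M.reward s| ≤ 1 := abs_le.2 (M.reward_mem s)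

theorem card_SA_ge_one (M : MDP dx da) : (1 : ℝ) ≤ Fintype.card M.SA := by
  have := M.nonempty_SA
  exact_mod_cast Fintype.card_pos (α := M.SA)

theorem norm_critForce_le (hb : 0 ≤ b) (hB : ∀ s s', |B s s'| ≤ b) {t : ℝ}
    (ht : t ∈ Set.Icc 0 T) (p q : M.SA → ℝ) (s : M.SA) :
    ‖M.critForce B t p q s‖ ≤ 2 * b * (1 + ‖q‖) := by
  refine (pi_norm_le_iff_of_nonneg (by positivity)).2 fun s' => ?_
  have hg := limitPolicy_mem_policySet (M := M) ht p
  have hc : 0 ≤ expRate T / M.A.card := div_nonneg (expRate_pos T).le (Nat.cast_nonneg _)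
  have h1 := (norm_le_pi_norm _ s').trans (norm_policyChain_mulVec_le M.isKernel_trans hc hg q)
  have h2 := norm_le_pi_norm q s'
  have h3 := abs_reward_le (M := M) s'
  rw [critForce, norm_mul]
  have h4 : ‖M.reward s' + M.gamma * Matrix.mulVec (policyChain M.trans (M.limitPolicy t p)) q s' -
      q s'‖ ≤ 1 + 1 * ‖q‖ + ‖q‖ := by
    refine (norm_sub_le _ _).trans (add_le_add ((norm_add_le _ _).trans (add_le_add h3 ?_)) h2)
    rw [norm_mul]
    refine mul_le_mul ?_ h1 (norm_nonneg _) zero_le_one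
    rw [Real.norm_of_nonneg M.gamma_mem.1.le]
    exact M.gamma_mem.2.le
  calc _ ≤ b * (1 + 1 * ‖q‖ + ‖q‖) := mul_le_mul (hB s s') h4 (norm_nonneg _) hb
    _ ≤ _ := by nlinarith [norm_nonneg q]

theorem norm_critForce_sub_le (hb : 0 ≤ b) (hB : ∀ s s', |B s s'| ≤ b) {t t' : ℝ}
    (ht : t ∈ Set.Icc 0 T) (ht' : t' ∈ Set.Icc 0 T) (p p' q q' : M.SA → ℝ) (s : M.SA) :
    ‖M.critForce B t p q s - M.critForce B t' p' q' s‖ ≤ 2 * b * ‖q - q'‖ +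
      4 * b * Fintype.card M.SA * ((‖p - p'‖ + |t - t'|) * ‖q'‖) := by
  refine (pi_norm_le_iff_of_nonneg (by positivity)).2 fun s' => ?_
  set n : ℝ := ((Fintype.card M.SA : ℕ) : ℝ)
  set g := M.limitPolicy t p
  set g' := M.limitPolicy t' p'
  set d := ‖p - p'‖ + |t - t'|
  have hg : g ∈ _ := limitPolicy_mem_policySet (M := M) ht p
  have hc : 0 ≤ expRate T / M.A.card := div_nonneg (expRate_pos T).le (Nat.cast_nonneg _)
  have e : (M.critForce B t p q s - M.critForce B t' p' q' s) s' =
      B s s' * (M.gamma * (Matrix.mulVec (policyChain M.trans g) (q - q') s' +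
        Matrix.mulVec (policyChain M.trans g - policyChain M.trans g') q' s') -
          (q - q') s') := by
    simp only [critForce, Pi.sub_apply, Matrix.mulVec_sub, Matrix.sub_mulVec, g, g']
    ring
  have h1 := (norm_le_pi_norm _ s').trans
    (norm_policyChain_mulVec_le M.isKernel_trans hc hg (q - q'))
  have h2 := (norm_le_pi_norm _ s').trans
    (norm_policyChain_sub_mulVec_le M.isKernel_trans g g' q')
  have h3 : n * (‖g - g'‖ * ‖q'‖) ≤ n * (4 * d * ‖q'‖) := by
    have := norm_limitPolicy_sub_le (M := M) ht.1 ht'.1 p p'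
    gcongr
  have h4 := norm_le_pi_norm (q - q') s'
  rw [e, norm_mul]
  have h5 : ‖M.gamma * (Matrix.mulVec (policyChain M.trans g) (q - q') s' +
        Matrix.mulVec (policyChain M.trans g - policyChain M.trans g') q' s') -
          (q - q') s'‖ ≤ 1 * (‖q - q'‖ + n * (4 * d * ‖q'‖)) + ‖q - q'‖ := by
    refine (norm_sub_le _ _).trans (add_le_add ?_ h4)
    rw [norm_mul]
    refine mul_le_mul ?_ ((norm_add_le _ _).trans (add_le_add h1 (h2.trans h3))) (norm_nonneg _)
      zero_le_one
    rw [Real.norm_of_nonneg M.gamma_mem.1.le]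
    exact M.gamma_mem.2.le
  calc _ ≤ b * (1 * (‖q - q'‖ + n * (4 * d * ‖q'‖)) + ‖q - q'‖) :=
        mul_le_mul (hB s s') h5 (norm_nonneg _) hb
    _ = _ := by ring

theorem abs_sub_sum_softmax_le (hB : ∀ s s', |B s s'| ≤ b) (p : M.SA → ℝ) (s s' : M.SA) :
    |B s s' - ∑ a, M.softmax p (s'.1, a) * B s (s'.1, a)| ≤ 2 * b := by
  have h1 : |∑ a, M.softmax p (s'.1, a) * B s (s'.1, a)| ≤ b := by
    calc _ ≤ ∑ a, M.softmax p (s'.1, a) * b := by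
          refine (Finset.abs_sum_le_sum_abs _ _).trans (Finset.sum_le_sum fun a _ => ?_)
          rw [abs_mul, abs_of_pos (softmax_pos p _)]
          exact mul_le_mul_of_nonneg_left (hB _ _) (softmax_pos p _).le
      _ = b := by rw [← Finset.sum_mul, sum_softmax, one_mul]
  refine (abs_sub _ _).trans ?_
  linarith [hB s s']

theorem abs_inv_one_add_sub_le {t t' : ℝ} (ht : 0 ≤ t) (ht' : 0 ≤ t') :
    |1 / (1 + t) - 1 / (1 + t')| ≤ |t - t'| := by
  have h1 : (1 : ℝ) + t ≠ 0 := by positivity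
  have h2 : (1 : ℝ) + t' ≠ 0 := by positivity
  have e : 1 / (1 + t) - 1 / (1 + t') = (t' - t) / ((1 + t) * (1 + t')) := by
    field_simp
    ring
  rw [e, abs_div, abs_sub_comm, abs_of_pos (a := (1 + t) * (1 + t')) (by positivity)]
  exact div_le_self (abs_nonneg _) (by nlinarith)

theorem norm_actForce_le (hb : 0 ≤ b) (hB : ∀ s s', |B s s'| ≤ b) {t : ℝ}
    (ht : t ∈ Set.Icc 0 T) (p q : M.SA → ℝ) (s : M.SA) :
    ‖M.actForce B t p q s‖ ≤ 2 * b * (1 + ‖q‖) := by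
  refine (pi_norm_le_iff_of_nonneg (by positivity)).2 fun s' => ?_
  have h0 : (0 : ℝ) ≤ 1 + t := by linarith [ht.1]
  rw [actForce, norm_mul, norm_mul, Real.norm_of_nonneg (r := 1 / (1 + t)) (by positivity)]
  calc _ ≤ 1 * ‖q‖ * (2 * b) := by
        refine mul_le_mul (mul_le_mul (div_le_one_of_le₀ (by linarith [ht.1]) h0)
          (norm_le_pi_norm q s') (norm_nonneg _) zero_le_one)
          (abs_sub_sum_softmax_le hB p s s') (norm_nonneg _) (by positivity)
    _ ≤ _ := by nlinarith [norm_nonneg q]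

theorem norm_actForce_sub_le (hb : 0 ≤ b) (hB : ∀ s s', |B s s'| ≤ b) {t t' : ℝ}
    (ht : t ∈ Set.Icc 0 T) (ht' : t' ∈ Set.Icc 0 T) (p p' q q' : M.SA → ℝ) (s : M.SA) :
    ‖M.actForce B t p q s - M.actForce B t' p' q' s‖ ≤ 2 * b * ‖q - q'‖ +
      4 * b * Fintype.card M.SA * ((‖p - p'‖ + |t - t'|) * ‖q'‖) := by
  refine (pi_norm_le_iff_of_nonneg (by positivity)).2 fun s' => ?_
  have hn := M.card_SA_ge_one
  set n : ℝ := ((Fintype.card M.SA : ℕ) : ℝ)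
  set D := B s s' - ∑ a, M.softmax p (s'.1, a) * B s (s'.1, a) with hD
  set D' := B s s' - ∑ a, M.softmax p' (s'.1, a) * B s (s'.1, a) with hD'
  have e : (M.actForce B t p q s - M.actForce B t' p' q' s) s' =
      1 / (1 + t) * (q s' - q' s') * D + ((1 / (1 + t) - 1 / (1 + t')) * q' s' * D +
        1 / (1 + t') * q' s' * (D - D')) := by
    simp only [actForce, Pi.sub_apply, ← hD, ← hD']
    ring
  have hDb : |D| ≤ 2 * b := abs_sub_sum_softmax_le hB p s s'
  have hDD : |D - D'| ≤ n * (4 * ‖p - p'‖ * b) := by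
    have : D - D' = ∑ a, (M.softmax p' (s'.1, a) - M.softmax p (s'.1, a)) * B s (s'.1, a) := by
      simp only [hD, hD', sub_mul, Finset.sum_sub_distrib]; ring
    rw [this]
    calc _ ≤ ∑ a : ↥M.A, 4 * ‖p - p'‖ * b := by
          refine (Finset.abs_sum_le_sum_abs _ _).trans (Finset.sum_le_sum fun a _ => ?_)
          rw [abs_mul]
          refine mul_le_mul ?_ (hB _ _) (abs_nonneg _) (by positivity)
          rw [abs_sub_comm]
          exact abs_softmax_sub_le p p' _
      _ = Fintype.card ↥M.A * (4 * ‖p - p'‖ * b) := by simp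
      _ ≤ _ := by
          refine mul_le_mul_of_nonneg_right ?_ (by positivity)
          have : Fintype.card ↥M.A ≤ Fintype.card M.SA :=
            Fintype.card_le_of_injective (fun a => ((M.nonempty_SA.some.1, a) : M.SA))
              fun a a' h => (Prod.ext_iff.1 h).2
          exact Nat.cast_le.2 this
  have hf : ∀ {t : ℝ}, t ∈ Set.Icc 0 T → |1 / (1 + t)| ≤ 1 := fun {t} ht => by
    have h0 : (0 : ℝ) ≤ 1 + t := by linarith [ht.1]
    rw [abs_of_nonneg (by positivity)]
    exact div_le_one_of_le₀ (by linarith [ht.1]) h0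
  have hq := norm_le_pi_norm (q - q') s'
  have hq' := norm_le_pi_norm q' s'
  simp only [Pi.sub_apply, Real.norm_eq_abs] at hq hq'
  rw [e, Real.norm_eq_abs]
  have h1 : |1 / (1 + t) * (q s' - q' s') * D| ≤ 1 * ‖q - q'‖ * (2 * b) := by
    rw [abs_mul, abs_mul]
    exact mul_le_mul (mul_le_mul (hf ht) hq (abs_nonneg _) zero_le_one) hDb (abs_nonneg _)
      (by positivity)
  have h2 : |(1 / (1 + t) - 1 / (1 + t')) * q' s' * D| ≤ |t - t'| * ‖q'‖ * (2 * b) := by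
    rw [abs_mul, abs_mul]
    exact mul_le_mul (mul_le_mul (abs_inv_one_add_sub_le ht.1 ht'.1) hq' (abs_nonneg _)
      (abs_nonneg _)) hDb (abs_nonneg _) (by positivity)
  have h3 : |1 / (1 + t') * q' s' * (D - D')| ≤ 1 * ‖q'‖ * (n * (4 * ‖p - p'‖ * b)) := by
    rw [abs_mul, abs_mul]
    exact mul_le_mul (mul_le_mul (hf ht') hq' (abs_nonneg _) zero_le_one) hDD (abs_nonneg _)
      (by positivity)
  have h4 : |t - t'| * ‖q'‖ * (2 * b) ≤ 4 * b * n * (|t - t'| * ‖q'‖) := by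
    have : 0 ≤ |t - t'| * ‖q'‖ * b := by positivity
    nlinarith
  refine (abs_add_le _ _).trans
    ((add_le_add h1 ((abs_add_le _ _).trans (add_le_add h2 h3))).trans ?_)
  linarith

/-- In `ForceBound` the change of the force is grouped with the change of the policy times the size
of the force, because exactly this combination controls Poisson solutions and stationary averages in
`PoissonBound`. -/
theorem forceBound_of_le (hb : 1 ≤ b) {h : ℝ → (M.SA → ℝ) → (M.SA → ℝ) → M.SA → M.SA → ℝ}
    (h1 : ∀ t ∈ Set.Icc 0 T, ∀ p q s, ‖h t p q s‖ ≤ 2 * b * (1 + ‖q‖))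
    (h2 : ∀ t ∈ Set.Icc 0 T, ∀ t' ∈ Set.Icc 0 T, ∀ p p' q q' s,
      ‖h t p q s - h t' p' q' s‖ ≤ 2 * b * ‖q - q'‖ +
        4 * b * Fintype.card M.SA * ((‖p - p'‖ + |t - t'|) * ‖q'‖)) :
    ForceBound T (b * (4 * Fintype.card M.SA + 8)) h := by
  have hn := M.card_SA_ge_one
  set n : ℝ := ((Fintype.card M.SA : ℕ) : ℝ)
  refine ⟨by nlinarith, fun t ht p q s => (h1 t ht p q s).trans ?_,
    fun t ht t' ht' p p' q q' s => ?_⟩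
  · exact mul_le_mul_of_nonneg_right (by nlinarith) (by positivity)
  · have h3 := norm_limitPolicy_sub_le (M := M) ht.1 ht'.1 p p'
    set d := ‖p - p'‖ + |t - t'|
    have hd : 0 ≤ d := by positivity
    have h4 : ‖M.limitPolicy t p - M.limitPolicy t' p'‖ * ‖h t' p' q' s‖ ≤
        4 * d * (2 * b * (1 + ‖q'‖)) :=
      mul_le_mul h3 (h1 t' ht' p' q' s) (norm_nonneg _) (by positivity)
    have h5 : 2 * b * ‖q - q'‖ ≤ b * (4 * n + 8) * ‖q - q'‖ :=
      mul_le_mul_of_nonneg_right (by nlinarith) (norm_nonneg _)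
    have h6 : 0 ≤ 4 * b * n * d := by positivity
    calc _ ≤ 2 * b * ‖q - q'‖ + 4 * b * n * (d * ‖q'‖) + 4 * d * (2 * b * (1 + ‖q'‖)) :=
          add_le_add (h2 t ht t' ht' p p' q q' s) h4
      _ ≤ b * (4 * n + 8) * ‖q - q'‖ + b * (4 * n + 8) * ((1 + ‖q'‖) * d) := by nlinarith
      _ = _ := by ring

theorem forceBound_critForce (hb : 1 ≤ b) (hB : ∀ s s', |B s s'| ≤ b) :
    ForceBound T (b * (4 * Fintype.card M.SA + 8)) (M.critForce B) :=
  forceBound_of_le hb (fun _ ht => norm_critForce_le (by linarith) hB ht)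
    fun _ ht _ ht' => norm_critForce_sub_le (by linarith) hB ht ht'

theorem forceBound_actForce (hb : 1 ≤ b) (hB : ∀ s s', |B s s'| ≤ b) :
    ForceBound T (b * (4 * Fintype.card M.SA + 8)) (M.actForce B) :=
  forceBound_of_le hb (fun _ ht => norm_actForce_le (by linarith) hB ht)
    fun _ ht _ ht' => norm_actForce_sub_le (by linarith) hB ht ht'

variable {k : M.SA → ↥M.X → ℝ} {C K : ℝ}
  {h : ℝ → (M.SA → ℝ) → (M.SA → ℝ) → M.SA → M.SA → ℝ}

/-- The growth factor falls on `q'` alone. With the limit solution in the primed place, the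
Lipschitz constant does not involve the discrete critic. -/
theorem abs_drift_sub_le (hP : PoissonBound k (expRate T / M.A.card) C) (hF : ForceBound T K h)
    {t t' : ℝ} (ht : t ∈ Set.Icc 0 T) (ht' : t' ∈ Set.Icc 0 T) (p p' q q' : M.SA → ℝ) (s : M.SA) :
    |drift k h t p q s - drift k h t' p' q' s| ≤
      C * K * (‖q - q'‖ + (1 + ‖q'‖) * (‖p - p'‖ + |t - t'|)) := by
  refine (hP.abs_stationary_sub_le _ (limitPolicy_mem_policySet ht p) _
    (limitPolicy_mem_policySet ht' p') _ _).trans ?_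
  rw [mul_assoc]
  exact mul_le_mul_of_nonneg_left (hF.norm_sub_le t ht t' ht' p p' q q' s)
    (by linarith [hP.one_le])

theorem norm_poissonSol_force_sub_le (hP : PoissonBound k (expRate T / M.A.card) C)
    (hF : ForceBound T K h) {t t' : ℝ} (ht : t ∈ Set.Icc 0 T) (ht' : t' ∈ Set.Icc 0 T)
    (p p' q q' : M.SA → ℝ) (s : M.SA) :
    ‖poissonSol (policyChain k (M.limitPolicy t p)) (h t p q s) -
      poissonSol (policyChain k (M.limitPolicy t' p')) (h t' p' q' s)‖ ≤
      C * K * (‖q - q'‖ + (1 + ‖q'‖) * (‖p - p'‖ + |t - t'|)) := by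
  refine (hP.norm_sub_le _ (limitPolicy_mem_policySet ht p) _
    (limitPolicy_mem_policySet ht' p') _ _).trans ?_
  rw [mul_assoc]
  exact mul_le_mul_of_nonneg_left (hF.norm_sub_le t ht t' ht' p p' q q' s)
    (by linarith [hP.one_le])

theorem norm_poissonSol_force_le (hP : PoissonBound k (expRate T / M.A.card) C)
    (hF : ForceBound T K h) {t : ℝ} (ht : t ∈ Set.Icc 0 T) (p q : M.SA → ℝ) (s : M.SA) :
    ‖poissonSol (policyChain k (M.limitPolicy t p)) (h t p q s)‖ ≤ C * K * (1 + ‖q‖) := by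
  refine (hP.norm_le _ (limitPolicy_mem_policySet ht p) _).trans ?_
  rw [mul_assoc]
  exact mul_le_mul_of_nonneg_left (hF.norm_le t ht p q s) (by linarith [hP.one_le])

/-- The sum over the next pair acts only on its critic value, since the transition probabilities sum
to one; what remains is the conditional mean of the temporal difference. -/
theorem drift_critForce_eq (σ : ℝ → ℝ) (v : Measure (ℝ × Feat dx da)) {t : ℝ}
    (ht : t ∈ Set.Icc 0 T) (p q : M.SA → ℝ) (s : M.SA) :
    ∑ s', ∑ s'', (M.reward s' + M.gamma * q s'' - q s') * M.bPair σ v s s' *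
      M.piStat (M.limitPolicy t p) s' * M.limitPolicy t p s'' * M.trans s' s''.1 =
    drift M.trans (M.critForce (M.bPair σ v)) t p q s := by
  refine Finset.sum_congr rfl fun s' _ => ?_
  set g := M.limitPolicy t p
  have h1 : ∑ s'', M.trans s' s''.1 * g s'' = 1 :=
    sum_policyChain M.isKernel_trans (limitPolicy_mem_policySet ht p) s'
  have h2 : Matrix.mulVec (policyChain M.trans g) q s' =
      ∑ s'', M.trans s' s''.1 * g s'' * q s'' := rfl
  have h3 : stationaryDist (policyChain M.trans g) s' = M.piStat g s' := rfl
  have h4 : ∑ s'', (M.reward s' + M.gamma * q s'' - q s') * M.bPair σ v s s' *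
      M.piStat g s' * g s'' * M.trans s' s''.1 = M.bPair σ v s s' * M.piStat g s' *
      ((M.reward s' - q s') * ∑ s'', M.trans s' s''.1 * g s'' +
        M.gamma * ∑ s'', M.trans s' s''.1 * g s'' * q s'') := by
    rw [Finset.mul_sum, Finset.mul_sum, ← Finset.sum_add_distrib, Finset.mul_sum]
    exact Finset.sum_congr rfl fun s'' _ => by ring
  rw [h4, h1, critForce, h2, h3]
  ring

theorem drift_actForce_eq (σ : ℝ → ℝ) (v : Measure (ℝ × Feat dx da)) (t : ℝ)
    (p q : M.SA → ℝ) (s : M.SA) :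
    ∑ s' : M.SA, ∑ a'', 1 / (1 + t) * q s' *
      (M.bPair σ v s s' - M.bPair σ v s (s'.1, a'')) *
      M.softmax p (s'.1, a'') * M.sigmaStat (M.limitPolicy t p) s' =
    drift M.transAux (M.actForce (M.bPair σ v)) t p q s := by
  refine Finset.sum_congr rfl fun s' _ => ?_
  have h3 : stationaryDist (policyChain M.transAux (M.limitPolicy t p)) s' =
    M.sigmaStat (M.limitPolicy t p) s' := rfl
  have h4 : ∑ a'', 1 / (1 + t) * q s' * (M.bPair σ v s s' - M.bPair σ v s (s'.1, a'')) *
      M.softmax p (s'.1, a'') * M.sigmaStat (M.limitPolicy t p) s' =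
      M.sigmaStat (M.limitPolicy t p) s' * (1 / (1 + t) * q s' *
        (M.bPair σ v s s' * ∑ a'', M.softmax p (s'.1, a'') -
          ∑ a'', M.softmax p (s'.1, a'') * M.bPair σ v s (s'.1, a''))) := by
    rw [Finset.mul_sum, ← Finset.sum_sub_distrib, Finset.mul_sum, Finset.mul_sum]
    exact Finset.sum_congr rfl fun s'' _ => by ring
  rw [h4, sum_softmax, mul_one, h3, actForce]

end MDP
-- Discrete Grönwall and deterministic bounds along a training path
theorem one_add_div_pow_le_exp {c T : ℝ} (hc : 0 ≤ c) {N k : ℕ} (hN : 0 < N)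
    (hk : (k : ℝ) ≤ N * T) : (1 + c / N) ^ k ≤ Real.exp (c * T) := by
  have hN' : (0 : ℝ) < N := by exact_mod_cast hN
  calc (1 + c / N) ^ k ≤ Real.exp (c / N) ^ k := by
        refine pow_le_pow_left₀ (by positivity) ?_ k
        rw [add_comm]; exact Real.add_one_le_exp _
    _ = Real.exp (c * k / N) := by rw [← Real.exp_nat_mul]; congr 1; ring
    _ ≤ _ := by
        refine Real.exp_le_exp.2 ?_
        rw [div_le_iff₀ hN']
        calc c * k ≤ c * (N * T) := by gcongr
          _ = _ := by ring

/-- A discrete Grönwall inequality for an error term that need not be monotone. -/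
theorem discrete_gronwall {d e : ℕ → ℝ} {ε : ℝ} (hε : 0 ≤ ε) (he : ∀ k, 0 ≤ e k) {m : ℕ}
    (h : ∀ n ≤ m, d n ≤ e n + ε * ∑ k ∈ Finset.range n, d k) :
    ∀ n ≤ m, d n ≤ e n + ε * ((1 + ε) ^ n * ∑ k ∈ Finset.range n, e k) := by
  have hS : ∀ n ≤ m, ∑ k ∈ Finset.range n, d k ≤ (1 + ε) ^ n * ∑ k ∈ Finset.range n, e k := by
    intro n
    induction n with
    | zero => simp
    | succ n ih =>
      intro hn
      have h1 := ih (Nat.le_of_succ_le hn)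
      have h2 := h n (Nat.le_of_succ_le hn)
      rw [Finset.sum_range_succ, Finset.sum_range_succ]
      have h3 : e n ≤ (1 + ε) ^ (n + 1) * e n :=
        le_mul_of_one_le_left (he n) (one_le_pow₀ (by linarith))
      have h4 := mul_le_mul_of_nonneg_left h1 (by linarith : 0 ≤ 1 + ε)
      rw [mul_add, pow_succ']
      rw [pow_succ'] at h3
      nlinarith
  intro n hn
  exact (h n hn).trans (add_le_add le_rfl (mul_le_mul_of_nonneg_left (hS n hn) hε))

namespace MDP

variable {dx da : ℕ} {M : MDP dx da} {σ : ℝ → ℝ} {κ α β : ℝ} {N : ℕ}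

theorem critRate_div_eq (hN : 0 < N) (α β : ℝ) :
    critRate α β N / (N : ℝ) ^ β = α * (N : ℝ) ^ (β - 2) := by
  have hN' : (0 : ℝ) < N := by exact_mod_cast hN
  rw [critRate, div_div, ← Real.rpow_add hN', div_eq_mul_inv, ← Real.rpow_neg hN'.le]
  ring_nf

theorem actRate_div_eq (hN : 0 < N) (β : ℝ) (k : ℕ) :
    actRate β N k / (N : ℝ) ^ β = 1 / (1 + k / N) * (N : ℝ) ^ (β - 2) := by
  have h := critRate_div_eq hN 1 β
  rw [one_mul, critRate] at h
  rw [← h, actRate]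
  have hN' : (0 : ℝ) < N := by exact_mod_cast hN
  have : (N : ℝ) ^ (2 - 2 * β) ≠ 0 := (Real.rpow_pos_of_pos hN' _).ne'
  have : (N : ℝ) ^ β ≠ 0 := (Real.rpow_pos_of_pos hN' _).ne'
  field_simp

/-- The scaling identity: `N` units of weight `N^(-β)` turn a displacement of size `N^(β-2)` into an
output change of size `1/N`, the Euler step. -/
theorem width_mul_rpow (hN : 0 < N) (β : ℝ) : N / (N : ℝ) ^ β * (N : ℝ) ^ (β - 2) = 1 / N := by
  have hN' : (0 : ℝ) < N := by exact_mod_cast hN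
  rw [Real.rpow_sub hN', Real.rpow_two]
  have : (N : ℝ) ^ β ≠ 0 := (Real.rpow_pos_of_pos hN' _).ne'
  field_simp

theorem rpow_sub_two_eq (hN : 0 < N) (β : ℝ) : (N : ℝ) ^ (β - 2) = (N : ℝ) ^ (β - 1) / N := by
  have hN' : (0 : ℝ) < N := by exact_mod_cast hN
  rw [show β - 2 = β - 1 - 1 by ring, Real.rpow_sub_one hN'.ne']

theorem rpow_sub_one_le_one (hN : 0 < N) (hβ : β < 1) : (N : ℝ) ^ (β - 1) ≤ 1 :=
  Real.rpow_le_one_of_one_le_of_nonpos (by exact_mod_cast hN) (by linarith)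

theorem abs_tdError_le (q : M.SA → ℝ) (s s' : M.SA) :
    |M.reward s + M.gamma * q s' - q s| ≤ 2 * (1 + ‖q‖) := by
  have h1 := norm_le_pi_norm q s
  have h2 := norm_le_pi_norm q s'
  have h3 : |M.gamma * q s'| ≤ 1 * ‖q‖ := by
    rw [abs_mul, abs_of_pos M.gamma_mem.1]
    exact mul_le_mul M.gamma_mem.2.le h2 (abs_nonneg _) zero_le_one
  have h4 := abs_reward_le (M := M) s
  rw [Real.norm_eq_abs] at h1
  refine (abs_sub _ _).trans ?_
  have := abs_add_le (M.reward s) (M.gamma * q s')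
  linarith [norm_nonneg q]

theorem sum_abs_critCoeff_le (hN : 0 < N) (hα : 0 < α) (ω : Params dx da N) (s s' : M.SA) :
    ∑ z, |M.critCoeff σ α β ω s s' z| ≤
      2 * (α + 1) * ((N : ℝ) ^ (β - 2) * (1 + ‖M.net σ β ω‖)) := by
  have h0 : (0 : ℝ) ≤ (N : ℝ) ^ (β - 2) := by positivity
  rw [critCoeff, Finset.sum_eq_single s (fun b _ hb => by simp [hb]) (by simp), Pi.single_eq_same,
    critRate_div_eq hN, abs_mul, abs_of_nonneg (by positivity)]
  calc _ ≤ α * (N : ℝ) ^ (β - 2) * (2 * (1 + ‖M.net σ β ω‖)) :=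
        mul_le_mul_of_nonneg_left (abs_tdError_le _ s s') (by positivity)
    _ = 2 * α * ((N : ℝ) ^ (β - 2) * (1 + ‖M.net σ β ω‖)) := by ring
    _ ≤ _ := by gcongr; linarith

theorem sum_abs_actCoeff_le (hN : 0 < N) (hα : 0 < α) (k : ℕ) (ω θ : Params dx da N) (s : M.SA) :
    ∑ z, |M.actCoeff σ β k ω θ s z| ≤
      2 * (α + 1) * ((N : ℝ) ^ (β - 2) * (1 + ‖M.net σ β ω‖)) := by
  have h0 : (0 : ℝ) ≤ (N : ℝ) ^ (β - 2) := by positivity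
  -- A difference of two probability vectors has total mass at most 2. Together with `1 / (1 + k /
  -- N) ≤ 1` this fits the constant `2 (α + 1)` shared with the critic.
  have h1 : ∑ z, |(Pi.single s 1 : M.SA → ℝ) z -
      if z.1 = s.1 then M.softmax (M.net σ β θ) z else 0| ≤ 2 := by
    calc _ ≤ ∑ z, ((Pi.single s 1 : M.SA → ℝ) z +
            if z.1 = s.1 then M.softmax (M.net σ β θ) z else 0) := by
          refine Finset.sum_le_sum fun z _ => (abs_sub _ _).trans_eq ?_
          congr 1
          · rw [Pi.single_apply]; split_ifs <;> simp
          · split_ifs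
            · exact abs_of_pos (softmax_pos _ _)
            · simp
      _ = 2 := by
          rw [Finset.sum_add_distrib, sum_ite_fst_eq s, sum_softmax,
            Finset.sum_pi_single' s (1 : ℝ)]
          norm_num
  have h2 : |1 / (1 + (k : ℝ) / N)| ≤ 1 := by
    have : (0 : ℝ) ≤ (k : ℝ) / N := by positivity
    rw [abs_of_nonneg (by positivity)]
    exact div_le_one_of_le₀ (by linarith) (by linarith)
  simp only [actCoeff, abs_mul, ← Finset.mul_sum]
  have h3 := norm_le_pi_norm (M.net σ β ω) s
  rw [actRate_div_eq hN, abs_mul, abs_of_nonneg h0]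
  calc _ ≤ 1 * (N : ℝ) ^ (β - 2) * ‖M.net σ β ω‖ * 2 := by
        gcongr
        exact h3
    _ = 2 * ((N : ℝ) ^ (β - 2) * ‖M.net σ β ω‖) := by ring
    _ ≤ _ := by
        gcongr
        · linarith
        · linarith

/-- The critic output after `k` updates along given sample paths. -/
noncomputable def critSeq (M : MDP dx da) (σ : ℝ → ℝ) (α β : ℝ) {N : ℕ}
    (init : Params dx da N × Params dx da N) (ξ ξ' : ℕ → M.SA) (k : ℕ) : M.SA → ℝ :=
  M.net σ β (M.train σ α β init ξ ξ' k).1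

/-- The actor output after `k` updates along given sample paths. -/
noncomputable def actSeq (M : MDP dx da) (σ : ℝ → ℝ) (α β : ℝ) {N : ℕ}
    (init : Params dx da N × Params dx da N) (ξ ξ' : ℕ → M.SA) (k : ℕ) : M.SA → ℝ :=
  M.net σ β (M.train σ α β init ξ ξ' k).2

section Apriori

variable {init : Params dx da N × Params dx da N} {ξ ξ' : ℕ → M.SA} {K₀ T : ℝ}

/-- The step size `e` of the `k`-th displacements of both networks. -/
theorem exists_coeff (hN : 0 < N) (hα : 0 < α) (k : ℕ) : ∃ e e' : M.SA → ℝ,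
    (M.train σ α β init ξ ξ' (k + 1)).1 = M.gradStep σ (M.train σ α β init ξ ξ' k).1 e ∧
    (M.train σ α β init ξ ξ' (k + 1)).2 = M.gradStep σ (M.train σ α β init ξ ξ' k).2 e' ∧
    ∑ s, |e s| ≤ 2 * (α + 1) * ((N : ℝ) ^ (β - 2) * (1 + ‖M.critSeq σ α β init ξ ξ' k‖)) ∧
    ∑ s, |e' s| ≤ 2 * (α + 1) * ((N : ℝ) ^ (β - 2) * (1 + ‖M.critSeq σ α β init ξ ξ' k‖)) :=
  ⟨_, _, critStep_eq α β _ _ _, actStep_eq β k _ _ _, sum_abs_critCoeff_le hN hα _ _ _,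
    sum_abs_actCoeff_le hN hα k _ _ _⟩

/-- A crude bootstrap: outer weights at most `A` allow outputs of size `N^(1-β) A κ`, but after
multiplication by the step `N^(β-2)` these move a weight only by order `A / N`. So the weights grow
at most geometrically with ratio `1 + O(1/N)`. -/
theorem one_add_abs_weight_le (h : SmoothBound σ κ) (hN : 0 < N) (hα : 0 < α) (hβ : β < 1)
    (hi : ∀ i, |(init.1 i).1| ≤ K₀ ∧ |(init.2 i).1| ≤ K₀) (k : ℕ) (i : Fin N) :
    1 + |((M.train σ α β init ξ ξ' k).1 i).1| ≤
        (1 + K₀) * (1 + 2 * (α + 1) * κ ^ 2 / N) ^ k ∧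
      1 + |((M.train σ α β init ξ ξ' k).2 i).1| ≤
        (1 + K₀) * (1 + 2 * (α + 1) * κ ^ 2 / N) ^ k := by
  have hN' : (0 : ℝ) < N := by exact_mod_cast hN
  have hκ := h.one_le
  induction k generalizing i with
  | zero =>
    simp only [train, pow_zero, mul_one]
    exact ⟨by linarith [(hi i).1], by linarith [(hi i).2]⟩
  | succ k ih =>
    obtain ⟨e, e', he1, he2, hE, hE'⟩ := exists_coeff (M := M) (σ := σ) (β := β) (init := init)
      (ξ := ξ) (ξ' := ξ') hN hα k
    set A := (1 + K₀) * (1 + 2 * (α + 1) * κ ^ 2 / N) ^ k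
    have hA : 1 ≤ A := by linarith [(ih i).1, abs_nonneg ((M.train σ α β init ξ ξ' k).1 i).1]
    have hq : ‖M.critSeq σ α β init ξ ξ' k‖ ≤ N / (N : ℝ) ^ β * ((A - 1) * κ) := by
      refine (pi_norm_le_iff_of_nonneg ?_).2 fun s =>
        abs_net_le h β _ (fun i => by linarith [(ih i).1]) s
      have : 0 ≤ A - 1 := by linarith
      have := h.nonneg
      positivity
    have hr1 : (N : ℝ) ^ (β - 2) ≤ 1 / N := by
      rw [rpow_sub_two_eq hN]
      exact div_le_div_of_nonneg_right (rpow_sub_one_le_one hN hβ) hN'.le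
    have hr2 := width_mul_rpow hN β
    have hr0 : (0 : ℝ) ≤ (N : ℝ) ^ (β - 2) := by positivity
    have hb : (N : ℝ) ^ (β - 2) * (1 + ‖M.critSeq σ α β init ξ ξ' k‖) ≤ κ * A / N := by
      calc _ ≤ (N : ℝ) ^ (β - 2) * (1 + N / (N : ℝ) ^ β * ((A - 1) * κ)) := by gcongr
        _ = (N : ℝ) ^ (β - 2) + (N / (N : ℝ) ^ β * (N : ℝ) ^ (β - 2)) * ((A - 1) * κ) := by ring
        _ ≤ 1 / N + 1 / N * ((A - 1) * κ) := by rw [hr2]; gcongr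
        _ = (1 + (A - 1) * κ) / N := by ring
        _ ≤ _ := by
          refine div_le_div_of_nonneg_right ?_ hN'.le
          nlinarith
    have hstep : ∀ (θ θ' : Params dx da N) (e : M.SA → ℝ), θ' = M.gradStep σ θ e →
        1 + |(θ i).1| ≤ A → ∑ s, |e s| ≤ 2 * (α + 1) * ((N : ℝ) ^ (β - 2) *
          (1 + ‖M.critSeq σ α β init ξ ξ' k‖)) →
        1 + |(θ' i).1| ≤ A * (1 + 2 * (α + 1) * κ ^ 2 / N) := by
      intro θ θ' e he hθ hE
      rw [he]
      have h1 := abs_gradStep_fst_sub_le (M := M) h θ e i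
      have h2 : κ * ∑ s, |e s| ≤ κ * (2 * (α + 1) * (κ * A / N)) :=
        mul_le_mul_of_nonneg_left (hE.trans (by gcongr)) h.nonneg
      have h3 := abs_sub_abs_le_abs_sub (M.gradStep σ θ e i).1 (θ i).1
      have h4 : κ * (2 * (α + 1) * (κ * A / N)) = A * (2 * (α + 1) * κ ^ 2 / N) := by ring
      rw [mul_add, mul_one, ← h4]
      linarith
    rw [pow_succ, ← mul_assoc]
    exact ⟨hstep _ _ e he1 (ih i).1 hE, hstep _ _ e' he2 (ih i).2 hE'⟩

end Apriori

/-- Bounds along a training path: growth and increments of the outputs, and the increments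
compared with those computed from matrices `B`, `B'` in place of the empirical kernels. Here `Y`
and `Y'` bound the difference between these matrices and the initial empirical kernels. -/
structure TrainBound (M : MDP dx da) (α β T : ℝ) (N : ℕ) (A : ℝ) (ξ ξ' : ℕ → M.SA)
    (B B' : M.SA → M.SA → ℝ) (Y Y' : ℝ) (p q : ℕ → M.SA → ℝ) : Prop where
  crit_le : ∀ k : ℕ, (k : ℝ) ≤ N * T → 1 + ‖q k‖ ≤ A * (1 + ‖q 0‖)
  crit_step : ∀ k : ℕ, (k : ℝ) ≤ N * T → ‖q (k + 1) - q k‖ ≤ A * (1 + ‖q 0‖) / N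
  act_step : ∀ k : ℕ, (k : ℝ) ≤ N * T → ‖p (k + 1) - p k‖ ≤ A * (1 + ‖q 0‖) / N
  crit_lin : ∀ k : ℕ, (k : ℝ) ≤ N * T → ∀ s, |q (k + 1) s - q k s -
    α / N * ((M.reward (ξ k) + M.gamma * q k (ξ (k + 1)) - q k (ξ k)) * B s (ξ k))| ≤
      A * ((1 + ‖q 0‖) ^ 2 * (N : ℝ) ^ (β - 1) + (1 + ‖q 0‖) * Y) / N
  act_lin : ∀ k : ℕ, (k : ℝ) ≤ N * T → ∀ s, |p (k + 1) s - p k s -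
    1 / N * M.actForce B' (k / N) (p k) (q k) s (ξ' k)| ≤
      A * ((1 + ‖q 0‖) ^ 2 * (N : ℝ) ^ (β - 1) + (1 + ‖q 0‖) * Y') / N

section

variable {init : Params dx da N × Params dx da N} {ξ ξ' : ℕ → M.SA} {K₀ T a C : ℝ}

/-- Second stage of the bootstrap: once the outer weights are bounded independently of `N`, the
critic increment is at most `c' / N` times `1 + ‖q_k‖`. So the critic grows from its initial value
by a bounded factor only, without a power of `N`. -/
theorem exists_one_add_norm_critSeq_le (h : SmoothBound σ κ) (hF : ∀ s, ‖M.feat s‖ ≤ κ)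
    (hα : 0 < α) (hβ : β < 1) (hK₀ : 0 ≤ K₀) (T : ℝ) :
    ∃ a C : ℝ, 1 ≤ a ∧ 1 ≤ C ∧ ∀ (N : ℕ) (init : Params dx da N × Params dx da N)
      (ξ ξ' : ℕ → M.SA), 0 < N → (∀ i, |(init.1 i).1| ≤ K₀ ∧ |(init.2 i).1| ≤ K₀) →
      ∀ k : ℕ, (k : ℝ) ≤ N * T →
        (∀ i, |((M.train σ α β init ξ ξ' k).1 i).1| ≤ a ∧
          |((M.train σ α β init ξ ξ' k).2 i).1| ≤ a) ∧
        1 + ‖M.critSeq σ α β init ξ ξ' k‖ ≤ C * (1 + ‖M.critSeq σ α β init ξ ξ' 0‖) := by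
  have hκ := h.nonneg
  set c := 2 * (α + 1) * κ ^ 2 with hc
  have hc0 : 0 ≤ c := by positivity
  -- No sign of `T` is assumed here; the absolute value keeps the constants at least 1.
  set a := (1 + K₀) * Real.exp |c * T| with ha
  have ha1 : 1 ≤ a := one_le_mul_of_one_le_of_one_le (by linarith) (Real.one_le_exp (abs_nonneg _))
  set c' := 2 * κ ^ 4 * a ^ 2 * (2 * (α + 1)) with hc'
  have hc'0 : 0 ≤ c' := by positivity
  refine ⟨a, Real.exp |c' * T|, ha1, Real.one_le_exp (abs_nonneg _),
    fun N init ξ ξ' hN hi k hk => ?_⟩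
  have hN' : (0 : ℝ) < N := by exact_mod_cast hN
  have hw : ∀ k : ℕ, (k : ℝ) ≤ N * T → ∀ i, |((M.train σ α β init ξ ξ' k).1 i).1| ≤ a ∧
      |((M.train σ α β init ξ ξ' k).2 i).1| ≤ a := by
    intro k hk i
    have h1 := one_add_abs_weight_le (M := M) (ξ := ξ) (ξ' := ξ') h hN hα hβ hi k i
    have h2 : (1 + K₀) * (1 + c / N) ^ k ≤ a := by
      refine mul_le_mul_of_nonneg_left ((one_add_div_pow_le_exp hc0 hN hk).trans ?_) (by linarith)
      exact Real.exp_le_exp.2 (le_abs_self _)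
    exact ⟨by linarith [h1.1], by linarith [h1.2]⟩
  refine ⟨hw k hk, ?_⟩
  have hq : ∀ k : ℕ, (k : ℝ) ≤ N * T → 1 + ‖M.critSeq σ α β init ξ ξ' k‖ ≤
      (1 + ‖M.critSeq σ α β init ξ ξ' 0‖) * (1 + c' / N) ^ k := by
    intro k
    induction k with
    | zero => simp
    | succ k ih =>
      intro hk
      have hk' : (k : ℝ) ≤ N * T := le_trans (by push_cast; linarith) hk
      obtain ⟨e, e', he1, he2, hE, hE'⟩ := exists_coeff (M := M) (σ := σ) (β := β) (init := init)
        (ξ := ξ) (ξ' := ξ') hN hα k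
      have hd : ‖M.critSeq σ α β init ξ ξ' (k + 1) - M.critSeq σ α β init ξ ξ' k‖ ≤
          c' / N * (1 + ‖M.critSeq σ α β init ξ ξ' k‖) := by
        refine (pi_norm_le_iff_of_nonneg (by positivity)).2 fun s => ?_
        rw [Pi.sub_apply, critSeq, he1]
        refine (abs_net_gradStep_sub_le h hF ha1 β _ (fun i => (hw k hk' i).1) e s).trans ?_
        calc _ ≤ N / (N : ℝ) ^ β * (2 * κ ^ 4 * a ^ 2 * (2 * (α + 1) * ((N : ℝ) ^ (β - 2) *
                (1 + ‖M.critSeq σ α β init ξ ξ' k‖)))) := by gcongr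
          _ = (N / (N : ℝ) ^ β * (N : ℝ) ^ (β - 2)) * c' *
                (1 + ‖M.critSeq σ α β init ξ ξ' k‖) := by rw [hc']; ring
          _ = _ := by rw [width_mul_rpow hN]; ring
      have h1 := norm_sub_norm_le (M.critSeq σ α β init ξ ξ' (k + 1)) (M.critSeq σ α β init ξ ξ' k)
      calc _ ≤ (1 + ‖M.critSeq σ α β init ξ ξ' k‖) * (1 + c' / N) := by linarith
        _ ≤ (1 + ‖M.critSeq σ α β init ξ ξ' 0‖) * (1 + c' / N) ^ k * (1 + c' / N) := by
            have := ih hk'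
            gcongr
        _ = _ := by ring
  calc _ ≤ _ := hq k hk
    _ ≤ (1 + ‖M.critSeq σ α β init ξ ξ' 0‖) * Real.exp |c' * T| := by
        refine mul_le_mul_of_nonneg_left ((one_add_div_pow_le_exp hc'0 hN hk).trans ?_)
          (by positivity)
        exact Real.exp_le_exp.2 (le_abs_self _)
    _ = _ := mul_comm _ _

theorem sum_critCoeff_mul (hN : 0 < N) (ω : Params dx da N) (s s' : M.SA) (E : M.SA → ℝ) :
    N / (N : ℝ) ^ β * ∑ z, M.critCoeff σ α β ω s s' z * E z =
      α / N * ((M.reward s + M.gamma * M.net σ β ω s' - M.net σ β ω s) * E s) := by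
  rw [critCoeff, sum_pi_single_mul, critRate_div_eq hN]
  have := width_mul_rpow hN β
  calc _ = (N / (N : ℝ) ^ β * (N : ℝ) ^ (β - 2)) * α *
        ((M.reward s + M.gamma * M.net σ β ω s' - M.net σ β ω s) * E s) := by ring
    _ = _ := by rw [this]; ring

theorem sum_actCoeff_mul (hN : 0 < N) (k : ℕ) (ω θ : Params dx da N) (s z : M.SA)
    (E : M.SA → M.SA → ℝ) :
    N / (N : ℝ) ^ β * ∑ s', M.actCoeff σ β k ω θ s s' * E z s' =
      1 / N * M.actForce E (k / N) (M.net σ β θ) (M.net σ β ω) z s := by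
  have h1 : ∑ s', M.actCoeff σ β k ω θ s s' * E z s' = actRate β N k / (N : ℝ) ^ β *
      M.net σ β ω s * (E z s - ∑ a, M.softmax (M.net σ β θ) (s.1, a) * E z (s.1, a)) := by
    simp only [actCoeff, mul_assoc, ← Finset.mul_sum, sub_mul, Finset.sum_sub_distrib,
      sum_pi_single_mul, ite_mul, zero_mul, one_mul]
    rw [sum_ite_fst_eq s]
  rw [h1, actRate_div_eq hN, actForce]
  have := width_mul_rpow hN β
  calc _ = (N / (N : ℝ) ^ β * (N : ℝ) ^ (β - 2)) * (1 / (1 + k / N) * M.net σ β ω s *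
        (E z s - ∑ a, M.softmax (M.net σ β θ) (s.1, a) * E z (s.1, a))) := by ring
    _ = _ := by rw [this]

/-- Empirical kernels stay close to their initial values along displacements of controlled size. -/
theorem abs_empKernel_iterate_sub_le (h : SmoothBound σ κ) (hF : ∀ s, ‖M.feat s‖ ≤ κ)
    (ha1 : 1 ≤ a) {θ : ℕ → Params dx da N} {n : ℕ} (hθ : ∀ k ≤ n, ∀ i, |(θ k i).1| ≤ a) {D : ℝ}
    (hD : 0 ≤ D)
    (hstep : ∀ k < n, ∃ e : M.SA → ℝ, θ (k + 1) = M.gradStep σ (θ k) e ∧ ∑ s, |e s| ≤ D)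
    (s s' : M.SA) :
    |M.empKernel σ (θ n) s s' - M.empKernel σ (θ 0) s s'| ≤
      4 * κ ^ 5 * a ^ 2 * ((κ + κ ^ 2 * a) * (n * D)) := by
  have hκ := h.nonneg
  refine abs_empKernel_sub_le h hF ha1 _ _ (hθ n le_rfl) (hθ 0 (Nat.zero_le _)) s s'
    (by positivity) fun i => ?_
  have key : ∀ m ≤ n, |(θ m i).1 - (θ 0 i).1| + ‖(θ m i).2 - (θ 0 i).2‖ ≤
      (κ + κ ^ 2 * a) * (m * D) := by
    intro m
    induction m with
    | zero => simp
    | succ m ih =>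
      intro hm
      obtain ⟨e, he, hE⟩ := hstep m hm
      have h1 := ih (Nat.le_of_succ_le hm)
      have h2 := abs_gradStep_fst_sub_le (M := M) h (θ m) e i
      have h3 := norm_gradStep_snd_sub_le h hF (θ m) e i (hθ m (Nat.le_of_succ_le hm) i)
      rw [← he] at h2 h3
      have h4 := abs_sub_le (θ (m + 1) i).1 (θ m i).1 (θ 0 i).1
      have h5 := norm_sub_le_norm_sub_add_norm_sub (θ (m + 1) i).2 (θ m i).2 (θ 0 i).2
      have h6 : κ * ∑ s, |e s| + κ ^ 2 * a * ∑ s, |e s| ≤ (κ + κ ^ 2 * a) * D := by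
        rw [← add_mul]
        exact mul_le_mul_of_nonneg_left hE (by positivity)
      push_cast
      linarith
  exact key n le_rfl

set_option maxHeartbeats 1000000 in
-- With `R = 1 + ‖q 0‖`, displacements have total size `O(N^(β-2) R)`, so over `N T` steps the
-- kernels drift by `O(N^(β-1) R)` on top of their initial deviation. One more factor `R / N` from
-- the step itself gives the error of the linearised increment; the quadratic remainder, of order
-- `N^(β-2) R² / N`, is smaller.
theorem exists_trainBound (h : SmoothBound σ κ) (hF : ∀ s, ‖M.feat s‖ ≤ κ)
    (hα : 0 < α) (hβ : β < 1) (hK₀ : 0 ≤ K₀) (hT : 0 < T) :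
    ∃ A : ℝ, 1 ≤ A ∧ ∀ (N : ℕ) (init : Params dx da N × Params dx da N) (ξ ξ' : ℕ → M.SA)
      (B B' : M.SA → M.SA → ℝ) (Y Y' : ℝ), 0 < N →
      (∀ i, |(init.1 i).1| ≤ K₀ ∧ |(init.2 i).1| ≤ K₀) →
      (∀ s s', |M.empKernel σ init.1 s s' - B s s'| ≤ Y) →
      (∀ s s', |M.empKernel σ init.2 s s' - B' s s'| ≤ Y') →
      TrainBound M α β T N A ξ ξ' B B' Y Y' (M.actSeq σ α β init ξ ξ')
        (M.critSeq σ α β init ξ ξ') := by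
  obtain ⟨a, C, ha1, hC1, hbd⟩ := exists_one_add_norm_critSeq_le h hF hα hβ hK₀ T
  have hκ := h.nonneg
  -- `e₀` measures a displacement, `c₁` the output increment it causes, `c₂` the quadratic
  -- remainder, and `c₃` the motion of the kernel over the whole horizon.
  set e₀ := 2 * (α + 1) * C with he₀
  have he₀0 : 0 ≤ e₀ := by positivity
  set c₁ := 2 * κ ^ 4 * a ^ 2 * e₀ with hc₁
  set c₂ := 2 * κ ^ 7 * a ^ 3 * e₀ ^ 2 with hc₂
  set c₃ := 4 * κ ^ 5 * a ^ 2 * ((κ + κ ^ 2 * a) * (T * e₀)) with hc₃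
  have hc₁0 : 0 ≤ c₁ := by positivity
  have hc₂0 : 0 ≤ c₂ := by positivity
  have hc₃0 : 0 ≤ c₃ := by positivity
  have he₃ := mul_nonneg he₀0 hc₃0
  refine ⟨C + c₁ + c₂ + e₀ * (c₃ + 1), by linarith, ?_⟩
  intro N init ξ ξ' B B' Y Y' hN hi hY hY'
  have hN' : (0 : ℝ) < N := by exact_mod_cast hN
  set q := M.critSeq σ α β init ξ ξ' with hq
  set p := M.actSeq σ α β init ξ ξ' with hp
  set R := 1 + ‖q 0‖ with hR
  have hR1 : 1 ≤ R := by simp [hR]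
  set A := C + c₁ + c₂ + e₀ * (c₃ + 1) with hA
  set ρ := (N : ℝ) ^ (β - 2) with hρ
  have hρ0 : 0 ≤ ρ := by positivity
  have hr := rpow_sub_two_eq hN β
  have hw := width_mul_rpow hN β
  rw [← hρ] at hr hw
  set r := (N : ℝ) ^ (β - 1) with hrdef
  have hr0 : 0 ≤ r := by positivity
  have hNρ : N * ρ = r := by rw [hr]; field_simp
  have hρr : ρ ≤ r := by
    rw [hr]
    exact div_le_self hr0 (by exact_mod_cast hN)
  have hcoef : ∀ k : ℕ, (k : ℝ) ≤ N * T → ∀ e : M.SA → ℝ,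
      ∑ s, |e s| ≤ 2 * (α + 1) * (ρ * (1 + ‖q k‖)) → ∑ s, |e s| ≤ e₀ * (ρ * R) := by
    intro k hk e he
    refine he.trans ?_
    have := (hbd N init ξ ξ' hN hi k hk).2
    calc _ ≤ 2 * (α + 1) * (ρ * (C * R)) := by gcongr
      _ = _ := by rw [he₀]; ring
  have hmono : ∀ k m : ℕ, (k : ℝ) ≤ N * T → m ≤ k → (m : ℝ) ≤ N * T := fun k m hk hm =>
    le_trans (by exact_mod_cast hm) hk
  have hemp : ∀ k : ℕ, (k : ℝ) ≤ N * T → ∀ s s',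
      |M.empKernel σ (M.train σ α β init ξ ξ' k).1 s s' - B s s'| ≤ c₃ * (r * R) + Y ∧
      |M.empKernel σ (M.train σ α β init ξ ξ' k).2 s s' - B' s s'| ≤ c₃ * (r * R) + Y' := by
    intro k hk s s'
    have hkD : 4 * κ ^ 5 * a ^ 2 * ((κ + κ ^ 2 * a) * (k * (e₀ * (ρ * R)))) ≤ c₃ * (r * R) := by
      calc _ ≤ 4 * κ ^ 5 * a ^ 2 * ((κ + κ ^ 2 * a) * (N * T * (e₀ * (ρ * R)))) := by gcongr
        _ = 4 * κ ^ 5 * a ^ 2 * ((κ + κ ^ 2 * a) * (T * e₀)) * ((N * ρ) * R) := by ring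
        _ = _ := by rw [hNρ]
    have h1 := abs_empKernel_iterate_sub_le h hF ha1
      (θ := fun k => (M.train σ α β init ξ ξ' k).1) (n := k) (D := e₀ * (ρ * R))
      (fun m hm i => ((hbd N init ξ ξ' hN hi m (hmono k m hk hm)).1 i).1) (by positivity)
      (fun m hm => by
        obtain ⟨e, -, he1, -, hE, -⟩ := exists_coeff (M := M) (σ := σ) (β := β) (init := init)
          (ξ := ξ) (ξ' := ξ') hN hα m
        exact ⟨e, he1, hcoef m (hmono k m hk hm.le) e hE⟩) s s'
    have h2 := abs_empKernel_iterate_sub_le h hF ha1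
      (θ := fun k => (M.train σ α β init ξ ξ' k).2) (n := k) (D := e₀ * (ρ * R))
      (fun m hm i => ((hbd N init ξ ξ' hN hi m (hmono k m hk hm)).1 i).2) (by positivity)
      (fun m hm => by
        obtain ⟨-, e, -, he1, -, hE⟩ := exists_coeff (M := M) (σ := σ) (β := β) (init := init)
          (ξ := ξ) (ξ' := ξ') hN hα m
        exact ⟨e, he1, hcoef m (hmono k m hk hm.le) e hE⟩) s s'
    constructor
    · have := abs_sub_le (M.empKernel σ (M.train σ α β init ξ ξ' k).1 s s')
        (M.empKernel σ init.1 s s') (B s s')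
      exact this.trans (add_le_add (h1.trans hkD) (hY s s'))
    · have := abs_sub_le (M.empKernel σ (M.train σ α β init ξ ξ' k).2 s s')
        (M.empKernel σ init.2 s s') (B' s s')
      exact this.trans (add_le_add (h2.trans hkD) (hY' s s'))
  -- increments of a displaced network, in terms of the size of the displacement
  have hinc : ∀ (θ : Params dx da N) (e : M.SA → ℝ), (∀ i, |(θ i).1| ≤ a) →
      ∑ s, |e s| ≤ e₀ * (ρ * R) →
      ‖M.net σ β (M.gradStep σ θ e) - M.net σ β θ‖ ≤ A * R / N := by
    intro θ e hθ hE
    refine (pi_norm_le_iff_of_nonneg (by positivity)).2 fun s => ?_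
    refine (abs_net_gradStep_sub_le h hF ha1 β θ hθ e s).trans ?_
    calc _ ≤ N / (N : ℝ) ^ β * (2 * κ ^ 4 * a ^ 2 * (e₀ * (ρ * R))) := by gcongr
      _ = (N / (N : ℝ) ^ β * ρ) * (c₁ * R) := by rw [hc₁]; ring
      _ = c₁ * R / N := by rw [hw]; ring
      _ ≤ A * R / N := by
        have : c₁ ≤ A := by rw [hA]; linarith
        gcongr
  have hlin : ∀ (θ : Params dx da N) (e E : M.SA → ℝ) (s : M.SA) (y : ℝ), 0 ≤ y →
      (∀ i, |(θ i).1| ≤ a) → ∑ s, |e s| ≤ e₀ * (ρ * R) →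
      (∀ s', |M.empKernel σ θ s s' - E s'| ≤ c₃ * (r * R) + y) →
      |M.net σ β (M.gradStep σ θ e) s - M.net σ β θ s -
        N / (N : ℝ) ^ β * ∑ z, e z * E z| ≤ A * (R ^ 2 * r + R * y) / N := by
    intro θ e E s y hy0 hθ hE hy
    have hy0' : 0 ≤ c₃ * (r * R) + y := by positivity
    have h1 := abs_net_gradStep_sub_sub_le h hF ha1 β θ hθ e s
    have h2 : |N / (N : ℝ) ^ β * ∑ z, e z * M.empKernel σ θ s z -
        N / (N : ℝ) ^ β * ∑ z, e z * E z| ≤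
        N / (N : ℝ) ^ β * ((∑ z, |e z|) * (c₃ * (r * R) + y)) := by
      rw [← mul_sub, ← Finset.sum_sub_distrib, abs_mul, abs_of_nonneg (by positivity)]
      refine mul_le_mul_of_nonneg_left ?_ (by positivity)
      rw [Finset.sum_mul]
      refine (Finset.abs_sum_le_sum_abs _ _).trans (Finset.sum_le_sum fun z _ => ?_)
      rw [← mul_sub, abs_mul]
      exact mul_le_mul_of_nonneg_left (hy z) (abs_nonneg _)
    have h3 : N / (N : ℝ) ^ β * (2 * κ ^ 7 * a ^ 3 * (∑ s, |e s|) ^ 2) ≤ c₂ * (R ^ 2 * r) / N := by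
      calc _ ≤ N / (N : ℝ) ^ β * (2 * κ ^ 7 * a ^ 3 * (e₀ * (ρ * R)) ^ 2) := by
            gcongr
        _ = (N / (N : ℝ) ^ β * ρ) * (c₂ * (R ^ 2 * ρ)) := by rw [hc₂]; ring
        _ ≤ (N / (N : ℝ) ^ β * ρ) * (c₂ * (R ^ 2 * r)) := by gcongr
        _ = _ := by rw [hw]; ring
    have h4 : N / (N : ℝ) ^ β * ((∑ z, |e z|) * (c₃ * (r * R) + y)) ≤
        e₀ * (R * (c₃ * (r * R) + y)) / N := by
      calc _ ≤ N / (N : ℝ) ^ β * (e₀ * (ρ * R) * (c₃ * (r * R) + y)) := by gcongr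
        _ = (N / (N : ℝ) ^ β * ρ) * (e₀ * (R * (c₃ * (r * R) + y))) := by ring
        _ = _ := by rw [hw]; ring
    refine ((abs_sub_le _ _ _).trans (add_le_add (h1.trans h3) (h2.trans h4))).trans ?_
    rw [← add_div]
    refine div_le_div_of_nonneg_right ?_ hN'.le
    have h5 : (c₂ + e₀ * c₃) * (R ^ 2 * r) ≤ A * (R ^ 2 * r) :=
      mul_le_mul_of_nonneg_right (by rw [hA]; linarith) (by positivity)
    have h6 : e₀ * (R * y) ≤ A * (R * y) :=
      mul_le_mul_of_nonneg_right (by rw [hA]; linarith [mul_nonneg he₀0 hc₃0]) (by positivity)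
    calc c₂ * (R ^ 2 * r) + e₀ * (R * (c₃ * (r * R) + y)) =
          (c₂ + e₀ * c₃) * (R ^ 2 * r) + e₀ * (R * y) := by ring
      _ ≤ A * (R ^ 2 * r) + A * (R * y) := add_le_add h5 h6
      _ = _ := by ring
  have hY0 : 0 ≤ Y := (abs_nonneg _).trans (hY M.nonempty_SA.some M.nonempty_SA.some)
  have hY0' : 0 ≤ Y' := (abs_nonneg _).trans (hY' M.nonempty_SA.some M.nonempty_SA.some)
  have hwc : ∀ k : ℕ, (k : ℝ) ≤ N * T → ∀ i, |((M.train σ α β init ξ ξ' k).1 i).1| ≤ a :=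
    fun k hk i => ((hbd N init ξ ξ' hN hi k hk).1 i).1
  have hwa : ∀ k : ℕ, (k : ℝ) ≤ N * T → ∀ i, |((M.train σ α β init ξ ξ' k).2 i).1| ≤ a :=
    fun k hk i => ((hbd N init ξ ξ' hN hi k hk).1 i).2
  refine ⟨fun k hk => ((hbd N init ξ ξ' hN hi k hk).2).trans ?_, fun k hk => ?_, fun k hk => ?_,
    fun k hk s => ?_, fun k hk s => ?_⟩
  · exact mul_le_mul_of_nonneg_right (by rw [hA]; linarith [mul_nonneg he₀0 hc₃0]) (by positivity)
  · obtain ⟨e, -, he1, -, hE, -⟩ := exists_coeff (M := M) (σ := σ) (β := β) (init := init)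
      (ξ := ξ) (ξ' := ξ') hN hα k
    rw [hq, critSeq, he1]
    exact hinc _ e (hwc k hk) (hcoef k hk e hE)
  · obtain ⟨-, e, -, he1, -, hE⟩ := exists_coeff (M := M) (σ := σ) (β := β) (init := init)
      (ξ := ξ) (ξ' := ξ') hN hα k
    rw [hp, actSeq, he1]
    exact hinc _ e (hwa k hk) (hcoef k hk e hE)
  · have h1 := hlin (M.train σ α β init ξ ξ' k).1 (M.critCoeff σ α β
      (M.train σ α β init ξ ξ' k).1 (ξ k) (ξ (k + 1))) (B s) s Y hY0 (hwc k hk)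
      (hcoef k hk _ (sum_abs_critCoeff_le hN hα _ _ _)) (fun s' => (hemp k hk s s').1)
    rw [sum_critCoeff_mul hN, ← critStep_eq] at h1
    exact h1
  · have h1 := hlin (M.train σ α β init ξ ξ' k).2 (M.actCoeff σ β k
      (M.train σ α β init ξ ξ' k).1 (M.train σ α β init ξ ξ' k).2 (ξ' k)) (B' s) s Y' hY0'
      (hwa k hk) (hcoef k hk _ (sum_abs_actCoeff_le hN hα k _ _ _))
      (fun s' => (hemp k hk s s').2)
    rw [sum_actCoeff_mul hN, ← actStep_eq] at h1
    exact h1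

end

end MDP
-- Averaging along the sample path and comparison with the limit equation
theorem abs_sum_telescope_le {S : Type*} {u : ℕ → S → ℝ} (x : ℕ → S) {n : ℕ} {b d : ℝ}
    (hb0 : ∀ s, |u 0 s| ≤ b) (hbn : ∀ s, |u n s| ≤ b)
    (hd : ∀ k < n, ∀ s, |u (k + 1) s - u k s| ≤ d) :
    |∑ k ∈ Finset.range n, (u k (x k) - u k (x (k + 1)))| ≤ 2 * b + n * d := by
  -- Summation by parts: the path only enters through the two boundary terms, and the remainder
  -- compares consecutive functions at the same point.
  have e : ∑ k ∈ Finset.range n, (u k (x k) - u k (x (k + 1))) = u 0 (x 0) - u n (x n) +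
      ∑ k ∈ Finset.range n, (u (k + 1) (x (k + 1)) - u k (x (k + 1))) := by
    rw [← Finset.sum_range_sub' (fun k => u k (x k)), ← Finset.sum_add_distrib]
    exact Finset.sum_congr rfl fun k _ => by ring
  have h1 : |∑ k ∈ Finset.range n, (u (k + 1) (x (k + 1)) - u k (x (k + 1)))| ≤ n * d := by
    refine (Finset.abs_sum_le_sum_abs _ _).trans ((Finset.sum_le_card_nsmul _ _ d
      fun k hk => hd k (Finset.mem_range.1 hk) _).trans_eq (by simp))
  rw [e]
  refine (abs_add_le _ _).trans (add_le_add ((abs_sub _ _).trans ?_) h1)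
  linarith [hb0 (x 0), hbn (x n)]

/-- The error of a left Riemann sum of a Lipschitz function. -/
theorem abs_integral_sub_riemann_le {φ : ℝ → ℝ} {T L : ℝ} (hL : 0 ≤ L)
    (hφ : ContinuousOn φ (Set.Icc 0 T))
    (hLip : ∀ t ∈ Set.Icc 0 T, ∀ t' ∈ Set.Icc 0 T, |φ t - φ t'| ≤ L * |t - t'|)
    {N n : ℕ} (hN : 0 < N) (hn : (n : ℝ) ≤ N * T) :
    |(∫ t in (0 : ℝ)..(n / N), φ t) - 1 / N * ∑ k ∈ Finset.range n, φ (k / N)| ≤ L * T / N := by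
  have hN' : (0 : ℝ) < N := by exact_mod_cast hN
  have hmem : ∀ k : ℕ, k ≤ n → (k : ℝ) / N ∈ Set.Icc 0 T := fun k hk =>
    ⟨by positivity, by
      rw [div_le_iff₀ hN', mul_comm]
      exact le_trans (by exact_mod_cast hk) hn⟩
  have hle : ∀ k : ℕ, (k : ℝ) / N ≤ ((k + 1 : ℕ) : ℝ) / N := fun k => by
    refine div_le_div_of_nonneg_right ?_ hN'.le
    push_cast; linarith
  have hsub : ∀ k < n, Set.Icc ((k : ℝ) / N) (((k + 1 : ℕ) : ℝ) / N) ⊆ Set.Icc 0 T :=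
    fun k hk => Set.Icc_subset_Icc (hmem k hk.le).1 (hmem (k + 1) hk).2
  have hint : ∀ k < n, IntervalIntegrable φ volume ((k : ℝ) / N) (((k + 1 : ℕ) : ℝ) / N) :=
    fun k hk => ContinuousOn.intervalIntegrable (by
      rw [Set.uIcc_of_le (hle k)]
      exact hφ.mono (hsub k hk))
  have hsum := intervalIntegral.sum_integral_adjacent_intervals (a := fun k : ℕ => (k : ℝ) / N) hint
  rw [Nat.cast_zero, zero_div] at hsum
  rw [← hsum, Finset.mul_sum, ← Finset.sum_sub_distrib]
  have hterm : ∀ k ∈ Finset.range n,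
      |(∫ t in ((k : ℝ) / N)..(((k + 1 : ℕ) : ℝ) / N), φ t) - 1 / N * φ (k / N)| ≤
        L / N * (1 / N) := by
    intro k hk
    have hk' := Finset.mem_range.1 hk
    have hlen : ((k + 1 : ℕ) : ℝ) / N - k / N = 1 / N := by push_cast; ring
    have e : (∫ t in ((k : ℝ) / N)..(((k + 1 : ℕ) : ℝ) / N), φ t) - 1 / N * φ (k / N) =
        ∫ t in ((k : ℝ) / N)..(((k + 1 : ℕ) : ℝ) / N), (φ t - φ (k / N)) := by
      rw [intervalIntegral.integral_sub (hint k hk') intervalIntegrable_const,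
        intervalIntegral.integral_const, hlen, smul_eq_mul]
    rw [e, ← Real.norm_eq_abs]
    refine (intervalIntegral.norm_integral_le_of_norm_le_const (C := L / N) fun t ht => ?_).trans ?_
    · rw [Set.uIoc_of_le (hle k)] at ht
      have htI : t ∈ Set.Icc 0 T := hsub k hk' ⟨ht.1.le, ht.2⟩
      refine (hLip t htI _ (hmem k hk'.le)).trans ?_
      rw [div_eq_mul_one_div L]
      refine mul_le_mul_of_nonneg_left ?_ hL
      rw [abs_of_nonneg (by linarith [ht.1])]
      linarith [ht.2]
    · rw [hlen, abs_of_pos (by positivity)]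
  refine (Finset.abs_sum_le_sum_abs _ _).trans ((Finset.sum_le_sum hterm).trans ?_)
  rw [Finset.sum_const, Finset.card_range, nsmul_eq_mul]
  calc (n : ℝ) * (L / N * (1 / N)) ≤ N * T * (L / N * (1 / N)) := by gcongr
    _ = _ := by field_simp

namespace MDP

variable {dx da : ℕ} {M : MDP dx da} {T C K : ℝ} {N : ℕ}
  {kr : M.SA → ↥M.X → ℝ} {h : ℝ → (M.SA → ℝ) → (M.SA → ℝ) → M.SA → M.SA → ℝ}

/-- The corrector at step `k`: the solution of the Poisson equation for the current force. -/
noncomputable def corrector (kr : M.SA → ↥M.X → ℝ)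
    (h : ℝ → (M.SA → ℝ) → (M.SA → ℝ) → M.SA → M.SA → ℝ) (t : ℝ) (p q : M.SA → ℝ) (s : M.SA) :
    M.SA → ℝ :=
  poissonSol (policyChain kr (M.limitPolicy t p)) (h t p q s)

theorem div_mem_Icc (hN : 0 < N) {k : ℕ} (hk : (k : ℝ) ≤ N * T) : (k : ℝ) / N ∈ Set.Icc 0 T := by
  have hN' : (0 : ℝ) < N := by exact_mod_cast hN
  exact ⟨by positivity, by rwa [div_le_iff₀ hN', mul_comm]⟩

/-- Averaging along the path: the sum of the forces is the sum of the drifts, plus a martingale,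
up to a bounded error. -/
theorem abs_sum_force_sub_le (hP : PoissonBound kr (expRate T / M.A.card) C)
    (hF : ForceBound T K h) (hN : 0 < N) (x : ℕ → M.SA) {p q : ℕ → M.SA → ℝ} {A R : ℝ}
    (hA : 1 ≤ A) (hR : 1 ≤ R) (hq : ∀ k : ℕ, (k : ℝ) ≤ N * T → 1 + ‖q k‖ ≤ A * R)
    (hqs : ∀ k : ℕ, (k : ℝ) ≤ N * T → ‖q (k + 1) - q k‖ ≤ A * R / N)
    (hps : ∀ k : ℕ, (k : ℝ) ≤ N * T → ‖p (k + 1) - p k‖ ≤ A * R / N)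
    {n : ℕ} (hn : (n : ℝ) ≤ N * T) (s : M.SA) :
    |∑ k ∈ Finset.range n, (h (k / N) (p k) (q k) s (x k) - drift kr h (k / N) (p k) (q k) s) -
      ∑ k ∈ Finset.range n, (corrector kr h (k / N) (p k) (q k) s (x (k + 1)) -
        ∑ s', policyChain kr (M.limitPolicy (k / N) (p k)) (x k) s' *
          corrector kr h (k / N) (p k) (q k) s s')| ≤
      C * K * A ^ 2 * (2 + 3 * T) * R ^ 2 := by
  have hN' : (0 : ℝ) < N := by exact_mod_cast hN
  have hT : 0 ≤ T := by
    have : (0 : ℝ) ≤ N * T := le_trans (Nat.cast_nonneg n) hn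
    exact nonneg_of_mul_nonneg_right this hN'
  have hCK : 0 ≤ C * K := mul_nonneg (by linarith [hP.one_le]) (by linarith [hF.one_le])
  have hmono : ∀ m : ℕ, m ≤ n → (m : ℝ) ≤ N * T := fun m hm =>
    le_trans (by exact_mod_cast hm) hn
  set u : ℕ → M.SA → ℝ := fun k => corrector kr h (k / N) (p k) (q k) s
  have hub : ∀ k : ℕ, (k : ℝ) ≤ N * T → ∀ s', |u k s'| ≤ C * K * (A * R) := fun k hk s' =>
    (norm_le_pi_norm (u k) s').trans ((norm_poissonSol_force_le hP hF (div_mem_Icc hN hk)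
      (p k) (q k) s).trans (mul_le_mul_of_nonneg_left (hq k hk) hCK))
  have hAR : 1 ≤ A * R := one_le_mul_of_one_le_of_one_le hA hR
  -- Time moves by `1/N` and both outputs by `A R / N`; the Lipschitz bound for the corrector costs
  -- another factor `A R`, hence the square.
  have hus : ∀ k < n, ∀ s', |u (k + 1) s' - u k s'| ≤ C * K * (3 * (A * R) ^ 2 / N) := by
    intro k hk s'
    refine (norm_le_pi_norm (u (k + 1) - u k) s').trans ((norm_poissonSol_force_sub_le hP hF
      (div_mem_Icc hN (hmono _ hk)) (div_mem_Icc hN (hmono _ hk.le)) _ _ _ _ s).trans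
      (mul_le_mul_of_nonneg_left ?_ hCK))
    have ht : |((k + 1 : ℕ) : ℝ) / N - k / N| = 1 / N := by
      rw [show ((k + 1 : ℕ) : ℝ) / N - k / N = 1 / N by push_cast; ring]
      exact abs_of_pos (by positivity)
    rw [ht]
    calc _ ≤ A * R / N + A * R * (A * R / N + 1 / N) := by
          have h1 := hqs k (hmono _ hk.le)
          have h2 := hps k (hmono _ hk.le)
          have h3 := hq k (hmono _ hk.le)
          gcongr
      _ = (A * R + A * R * (A * R) + A * R) / N := by ring
      _ ≤ _ := by
          refine div_le_div_of_nonneg_right ?_ hN'.le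
          nlinarith
  -- The Poisson equation at `x k`, with `u k (x (k + 1))` added and subtracted: a martingale
  -- increment plus a term ready to telescope.
  have hpo : ∀ k ∈ Finset.range n, h (k / N) (p k) (q k) s (x k) -
      drift kr h (k / N) (p k) (q k) s = (u k (x (k + 1)) -
        ∑ s', policyChain kr (M.limitPolicy (k / N) (p k)) (x k) s' * u k s') +
        (u k (x k) - u k (x (k + 1))) := by
    intro k hk
    have hkn := hmono k (Finset.mem_range.1 hk).le
    have := hP.equation _ (limitPolicy_mem_policySet (div_mem_Icc hN hkn) (p k))
      (h (k / N) (p k) (q k) s) (x k)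
    rw [drift, this]
    simp only [u, corrector, Matrix.mulVec, dotProduct]
    ring
  rw [Finset.sum_congr rfl hpo, Finset.sum_add_distrib, add_sub_cancel_left]
  refine (abs_sum_telescope_le x (hub 0 (hmono 0 (Nat.zero_le _))) (hub n hn) hus).trans ?_
  calc 2 * (C * K * (A * R)) + n * (C * K * (3 * (A * R) ^ 2 / N))
      ≤ 2 * (C * K * (A * R) ^ 2) + N * T * (C * K * (3 * (A * R) ^ 2 / N)) := by
        have := le_self_pow₀ hAR two_ne_zero
        gcongr
    _ = C * K * A ^ 2 * (2 + 3 * T) * R ^ 2 := by field_simp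

theorem continuousOn_drift (hP : PoissonBound kr (expRate T / M.A.card) C)
    (hF : ForceBound T K h) {P₀ Q₀ : ℝ → M.SA → ℝ} (hP₀ : ContinuousOn P₀ (Set.Icc 0 T))
    (hQ₀ : ContinuousOn Q₀ (Set.Icc 0 T)) (s : M.SA) :
    ContinuousOn (fun t => drift kr h t (P₀ t) (Q₀ t) s) (Set.Icc 0 T) := by
  intro t ht
  rw [ContinuousWithinAt, tendsto_iff_norm_sub_tendsto_zero]
  have h1 : Filter.Tendsto (fun τ => C * K * (‖Q₀ τ - Q₀ t‖ + (1 + ‖Q₀ t‖) *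
      (‖P₀ τ - P₀ t‖ + |τ - t|))) (nhdsWithin t (Set.Icc 0 T))
      (nhds (C * K * (‖Q₀ t - Q₀ t‖ + (1 + ‖Q₀ t‖) * (‖P₀ t - P₀ t‖ + |t - t|)))) := by
    have hq : ContinuousWithinAt Q₀ (Set.Icc 0 T) t := hQ₀ t ht
    have hp : ContinuousWithinAt P₀ (Set.Icc 0 T) t := hP₀ t ht
    have hi : ContinuousWithinAt (fun τ : ℝ => τ) (Set.Icc 0 T) t := continuousWithinAt_id
    exact (((hq.sub continuousWithinAt_const).norm).add (continuousWithinAt_const.mul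
      (((hp.sub continuousWithinAt_const).norm).add
        (hi.sub continuousWithinAt_const).abs))).const_mul _
  simp only [sub_self, norm_zero, abs_zero, add_zero, mul_zero] at h1
  refine squeeze_zero' (Filter.Eventually.of_forall fun _ => norm_nonneg _) ?_ h1
  filter_upwards [self_mem_nhdsWithin] with τ hτ
  exact abs_drift_sub_le hP hF hτ ht _ _ _ _ s

/-- A bootstrap for the limit system: continuity of the solution makes the drift continuous, hence
bounded on `[0, T]`, so the solution is Lipschitz. This is what the Riemann sum estimate needs. -/
theorem exists_lipschitz_of_integral {φ : ℝ → M.SA → ℝ} {y : ℝ → M.SA → ℝ} {c : ℝ}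
    (hφ : ∀ s, ContinuousOn (fun t => φ t s) (Set.Icc 0 T))
    (hy : ∀ t ∈ Set.Icc 0 T, ∀ s, y t s = c * ∫ τ in (0 : ℝ)..t, φ τ s) :
    ∃ L, 0 ≤ L ∧ ∀ t ∈ Set.Icc 0 T, ∀ t' ∈ Set.Icc 0 T, ‖y t - y t'‖ ≤ L * |t - t'| := by
  choose b hb using fun s => (isCompact_Icc (a := (0 : ℝ)) (b := T)).exists_bound_of_continuousOn
    (hφ s)
  refine ⟨|c| * ∑ s, |b s|, by positivity, fun t ht t' ht' => ?_⟩
  refine (pi_norm_le_iff_of_nonneg (by positivity)).2 fun s => ?_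
  have hi : ∀ t ∈ Set.Icc 0 T, IntervalIntegrable (fun τ => φ τ s) volume 0 t := fun t ht =>
    ContinuousOn.intervalIntegrable (by
      rw [Set.uIcc_of_le ht.1]
      exact (hφ s).mono (Set.Icc_subset_Icc_right ht.2))
  rw [Pi.sub_apply, hy t ht, hy t' ht', ← mul_sub,
    intervalIntegral.integral_interval_sub_left (hi t ht) (hi t' ht'), norm_mul, Real.norm_eq_abs,
    mul_assoc]
  refine mul_le_mul_of_nonneg_left ?_ (abs_nonneg _)
  refine (intervalIntegral.norm_integral_le_of_norm_le_const (C := ∑ s, |b s|)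
    fun τ hτ => ?_).trans_eq rfl
  have hτ' : τ ∈ Set.Icc 0 T := by
    have h1 := Set.uIoc_subset_uIcc hτ
    exact (Set.uIcc_subset_Icc ht' ht) h1
  refine (hb s τ hτ').trans ((le_abs_self _).trans ?_)
  exact Finset.single_le_sum (f := fun s => |b s|) (fun _ _ => abs_nonneg _) (Finset.mem_univ s)

/-- Regularity of a solution of the limit system. -/
structure SolutionBound (T L : ℝ) (P₀ Q₀ : ℝ → M.SA → ℝ) : Prop where
  one_le : 1 ≤ L
  lip_act : ∀ t ∈ Set.Icc 0 T, ∀ t' ∈ Set.Icc 0 T, ‖P₀ t - P₀ t'‖ ≤ L * |t - t'|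
  lip_crit : ∀ t ∈ Set.Icc 0 T, ∀ t' ∈ Set.Icc 0 T, ‖Q₀ t - Q₀ t'‖ ≤ L * |t - t'|
  crit_le : ∀ t ∈ Set.Icc 0 T, ‖Q₀ t‖ ≤ L

/-- The distance between the rescaled discrete outputs and the limit at step `k`. -/
noncomputable def outErr (N : ℕ) (p q : ℕ → M.SA → ℝ) (P₀ Q₀ : ℝ → M.SA → ℝ) (k : ℕ) : ℝ :=
  ‖q k - Q₀ (k / N)‖ + ‖p k - P₀ (k / N)‖

/-- The terms are, in order: the initial output; the accumulated linearisation error; the noise,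
from averaging and from the extra input `D`; the telescoped Poisson remainder with the Riemann sum
error; and the Lipschitz feedback of earlier errors through the drift. It serves the critic with `c
= α` and the actor with `c = 1`. -/
theorem abs_output_sub_le (hP : PoissonBound kr (expRate T / M.A.card) C)
    (hF : ForceBound T K h) (hN : 0 < N) (x : ℕ → M.SA) {p q : ℕ → M.SA → ℝ} {A R L : ℝ}
    (hA : 1 ≤ A) (hR : 1 ≤ R) (hq : ∀ k : ℕ, (k : ℝ) ≤ N * T → 1 + ‖q k‖ ≤ A * R)
    (hqs : ∀ k : ℕ, (k : ℝ) ≤ N * T → ‖q (k + 1) - q k‖ ≤ A * R / N)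
    (hps : ∀ k : ℕ, (k : ℝ) ≤ N * T → ‖p (k + 1) - p k‖ ≤ A * R / N)
    {P₀ Q₀ : ℝ → M.SA → ℝ} (hS : SolutionBound T L P₀ Q₀)
    (hP₀ : ContinuousOn P₀ (Set.Icc 0 T)) (hQ₀ : ContinuousOn Q₀ (Set.Icc 0 T))
    {y D : ℕ → M.SA → ℝ} {y₀ : ℝ → M.SA → ℝ} {c ε : ℝ} (hc : 0 ≤ c) (hε : 0 ≤ ε)
    (hy : ∀ k : ℕ, (k : ℝ) ≤ N * T → ∀ s, |y (k + 1) s - y k s -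
      c / N * (h (k / N) (p k) (q k) s (x k) + D k s)| ≤ ε / N)
    (hy₀ : ∀ t ∈ Set.Icc 0 T, ∀ s, y₀ t s = c * ∫ τ in (0 : ℝ)..t, drift kr h τ (P₀ τ) (Q₀ τ) s)
    {n : ℕ} (hn : (n : ℝ) ≤ N * T) (s : M.SA) :
    |y n s - y₀ (n / N) s| ≤ |y 0 s| + T * ε +
      c / N * |∑ k ∈ Finset.range n, (corrector kr h (k / N) (p k) (q k) s (x (k + 1)) -
        ∑ s', policyChain kr (M.limitPolicy (k / N) (p k)) (x k) s' *
          corrector kr h (k / N) (p k) (q k) s s' + D k s)| +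
      c * (C * K * A ^ 2 * (2 + 3 * T) + 5 * C * K * L ^ 2 * T) * R ^ 2 / N +
      c * (2 * C * K * L) / N * ∑ k ∈ Finset.range n, outErr N p q P₀ Q₀ k := by
  have hN' : (0 : ℝ) < N := by exact_mod_cast hN
  have hT : 0 ≤ T := by
    have : (0 : ℝ) ≤ N * T := le_trans (Nat.cast_nonneg n) hn
    exact nonneg_of_mul_nonneg_right this hN'
  have hCK : 0 ≤ C * K := mul_nonneg (by linarith [hP.one_le]) (by linarith [hF.one_le])
  have hL := hS.one_le
  have hmono : ∀ m : ℕ, m ≤ n → (m : ℝ) ≤ N * T := fun m hm =>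
    le_trans (by exact_mod_cast hm) hn
  set Φ : ℝ → ℝ := fun t => drift kr h t (P₀ t) (Q₀ t) s
  set H : ℕ → ℝ := fun k => h (k / N) (p k) (q k) s (x k)
  set F : ℕ → ℝ := fun k => drift kr h (k / N) (p k) (q k) s
  set m : ℕ → ℝ := fun k => corrector kr h (k / N) (p k) (q k) s (x (k + 1)) -
        ∑ s', policyChain kr (M.limitPolicy (k / N) (p k)) (x k) s' *
          corrector kr h (k / N) (p k) (q k) s s' with hm
  have h1 : |y n s - y 0 s - c / N * ∑ k ∈ Finset.range n, (H k + D k s)| ≤ T * ε := by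
    rw [← Finset.sum_range_sub (fun k => y k s), Finset.mul_sum, ← Finset.sum_sub_distrib]
    refine (Finset.abs_sum_le_sum_abs _ _).trans ((Finset.sum_le_card_nsmul _ _ (ε / N)
      fun k hk => hy k (hmono k (Finset.mem_range.1 hk).le) s).trans ?_)
    rw [Finset.card_range, nsmul_eq_mul]
    calc (n : ℝ) * (ε / N) ≤ N * T * (ε / N) := by gcongr
      _ = T * ε := by field_simp
  have h2 : |∑ k ∈ Finset.range n, (H k - F k) - ∑ k ∈ Finset.range n, m k| ≤
      C * K * A ^ 2 * (2 + 3 * T) * R ^ 2 :=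
    abs_sum_force_sub_le hP hF hN x hA hR hq hqs hps hn s
  have hΦL : ∀ t ∈ Set.Icc 0 T, ∀ t' ∈ Set.Icc 0 T, |Φ t - Φ t'| ≤
      5 * C * K * L ^ 2 * |t - t'| := by
    intro t ht t' ht'
    refine (abs_drift_sub_le hP hF ht ht' _ _ _ _ s).trans ?_
    have a1 := hS.lip_act t ht t' ht'
    have a2 := hS.lip_crit t ht t' ht'
    have a3 := hS.crit_le t' ht'
    calc _ ≤ C * K * (L * |t - t'| + (1 + L) * (L * |t - t'| + |t - t'|)) := by gcongr
      _ = C * K * (L + (1 + L) * (L + 1)) * |t - t'| := by ring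
      _ ≤ C * K * (5 * L ^ 2) * |t - t'| := by
          refine mul_le_mul_of_nonneg_right (mul_le_mul_of_nonneg_left ?_ hCK) (abs_nonneg _)
          nlinarith
      _ = _ := by ring
  have h3 := abs_integral_sub_riemann_le (by
      have := hL
      rw [show 5 * C * K * L ^ 2 = C * K * (5 * L ^ 2) by ring]
      positivity) (continuousOn_drift hP hF hP₀ hQ₀ s) hΦL hN hn
  have h4 : |∑ k ∈ Finset.range n, F k - ∑ k ∈ Finset.range n, Φ (k / N)| ≤
      2 * C * K * L * ∑ k ∈ Finset.range n, outErr N p q P₀ Q₀ k := by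
    rw [← Finset.sum_sub_distrib, Finset.mul_sum]
    refine (Finset.abs_sum_le_sum_abs _ _).trans (Finset.sum_le_sum fun k hk => ?_)
    have hkT := div_mem_Icc hN (hmono k (Finset.mem_range.1 hk).le)
    refine (abs_drift_sub_le hP hF hkT hkT _ _ _ _ s).trans ?_
    have a3 := hS.crit_le _ hkT
    rw [sub_self, abs_zero, add_zero, outErr]
    have a4 : ‖q k - Q₀ (k / N)‖ ≤ 2 * L * ‖q k - Q₀ (k / N)‖ :=
      le_mul_of_one_le_left (norm_nonneg _) (by linarith)
    have a5 : (1 + ‖Q₀ (k / N)‖) * ‖p k - P₀ (k / N)‖ ≤ 2 * L * ‖p k - P₀ (k / N)‖ :=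
      mul_le_mul_of_nonneg_right (by linarith) (norm_nonneg _)
    calc _ ≤ C * K * (2 * L * ‖q k - Q₀ (k / N)‖ + 2 * L * ‖p k - P₀ (k / N)‖) :=
          mul_le_mul_of_nonneg_left (add_le_add a4 a5) hCK
      _ = _ := by ring
  have hy0 := hy₀ _ (div_mem_Icc hN hn) s
  set SD := ∑ k ∈ Finset.range n, D k s
  set SH := ∑ k ∈ Finset.range n, H k
  set SF := ∑ k ∈ Finset.range n, F k
  set Sm := ∑ k ∈ Finset.range n, m k
  set SΦ := ∑ k ∈ Finset.range n, Φ (k / N)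
  set I := ∫ t in (0 : ℝ)..(n / N), Φ t
  have e1 : ∑ k ∈ Finset.range n, (H k + D k s) = SH + SD := Finset.sum_add_distrib
  have e2 : ∑ k ∈ Finset.range n, (H k - F k) = SH - SF := Finset.sum_sub_distrib _ _
  have e3 : ∑ k ∈ Finset.range n, (m k + D k s) = Sm + SD := Finset.sum_add_distrib
  rw [e1] at h1
  rw [e2] at h2
  rw [e3, hy0]
  have e4 : y n s - c * I = y 0 s + (y n s - y 0 s - c / N * (SH + SD)) + c / N * (Sm + SD) +
      (c / N * (SH - SF - Sm) - c * (I - 1 / N * SΦ)) + c / N * (SF - SΦ) := by ring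
  have hcN : 0 ≤ c / N := by positivity
  rw [e4]
  refine (abs_add_le _ _).trans (add_le_add ((abs_add_le _ _).trans (add_le_add
    ((abs_add_le _ _).trans (add_le_add ((abs_add_le _ _).trans
      (add_le_add le_rfl h1)) ?_)) ?_)) ?_)
  · rw [abs_mul, abs_of_nonneg hcN]
  · refine (abs_sub _ _).trans ?_
    rw [abs_mul, abs_mul, abs_of_nonneg hcN, abs_of_nonneg hc]
    have hR2 : 1 ≤ R ^ 2 := one_le_pow₀ hR
    have hnn : 0 ≤ 5 * C * K * L ^ 2 * T / N := by
      rw [show 5 * C * K * L ^ 2 * T / N = C * K * (5 * L ^ 2 * T / N) by ring]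
      positivity
    calc _ ≤ c / N * (C * K * A ^ 2 * (2 + 3 * T) * R ^ 2) +
          c * (5 * C * K * L ^ 2 * T / N * R ^ 2) :=
          add_le_add (mul_le_mul_of_nonneg_left h2 hcN)
            (mul_le_mul_of_nonneg_left (h3.trans (le_mul_of_one_le_right hnn hR2)) hc)
      _ = _ := by ring
  · rw [abs_mul, abs_of_nonneg hcN]
    calc _ ≤ c / N * (2 * C * K * L * ∑ k ∈ Finset.range n, outErr N p q P₀ Q₀ k) :=
          mul_le_mul_of_nonneg_left h4 hcN
      _ = _ := by ring

end MDP

/-! ### The noise terms and the Grönwall estimate -/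

namespace MDP

variable {dx da : ℕ} {M : MDP dx da} {T C K b : ℝ} {N : ℕ}

/-- The function whose compensated values along the critic path are the martingale increments in
the critic output. -/
noncomputable def critMart (B : M.SA → M.SA → ℝ) (t : ℝ) (p q : M.SA → ℝ) (x s s' : M.SA) : ℝ :=
  corrector M.trans (M.critForce B) t p q s s' + M.gamma * B s x * q s'

/-- The value at step `n` of the martingale in the critic output. -/
noncomputable def critNoise (B : M.SA → M.SA → ℝ) (N : ℕ) (ξ : ℕ → M.SA) (p q : ℕ → M.SA → ℝ)
    (n : ℕ) (s : M.SA) : ℝ :=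
  ∑ k ∈ Finset.range n, (M.critMart B (k / N) (p k) (q k) (ξ k) s (ξ (k + 1)) -
    ∑ s', policyChain M.trans (M.limitPolicy (k / N) (p k)) (ξ k) s' *
      M.critMart B (k / N) (p k) (q k) (ξ k) s s')

/-- The value at step `n` of the martingale in the actor output. -/
noncomputable def actNoise (B : M.SA → M.SA → ℝ) (N : ℕ) (ξ' : ℕ → M.SA) (p q : ℕ → M.SA → ℝ)
    (n : ℕ) (s : M.SA) : ℝ :=
  ∑ k ∈ Finset.range n, (corrector M.transAux (M.actForce B) (k / N) (p k) (q k) s (ξ' (k + 1)) -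
    ∑ s', policyChain M.transAux (M.limitPolicy (k / N) (p k)) (ξ' k) s' *
      corrector M.transAux (M.actForce B) (k / N) (p k) (q k) s s')

/-- The critic has two noises driven by the same `ξ (k + 1)`: the corrector's, and that of using the
sampled next value in the temporal difference in place of its conditional mean. Merged, they form
one martingale. -/
theorem critNoise_eq (B : M.SA → M.SA → ℝ) (N : ℕ) (ξ : ℕ → M.SA) (p q : ℕ → M.SA → ℝ)
    (n : ℕ) (s : M.SA) : M.critNoise B N ξ p q n s = ∑ k ∈ Finset.range n,
      (corrector M.trans (M.critForce B) (k / N) (p k) (q k) s (ξ (k + 1)) -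
        ∑ s', policyChain M.trans (M.limitPolicy (k / N) (p k)) (ξ k) s' *
          corrector M.trans (M.critForce B) (k / N) (p k) (q k) s s' +
        M.gamma * B s (ξ k) * (q k (ξ (k + 1)) -
          Matrix.mulVec (policyChain M.trans (M.limitPolicy (k / N) (p k))) (q k) (ξ k))) := by
  refine Finset.sum_congr rfl fun k _ => ?_
  simp only [critMart, mul_add, Finset.sum_add_distrib, Matrix.mulVec, dotProduct]
  rw [mul_sub, Finset.mul_sum]
  have : ∀ s', policyChain M.trans (M.limitPolicy (k / N) (p k)) (ξ k) s' *
      (M.gamma * B s (ξ k) * q k s') = M.gamma * B s (ξ k) *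
      (policyChain M.trans (M.limitPolicy (k / N) (p k)) (ξ k) s' * q k s') := fun s' => by ring
  simp only [this]
  ring

/-- The error between the discrete outputs and the limit in terms of a process `w` that bounds the
scaled initial outputs, kernel fluctuations and martingales. -/
theorem exists_outErr_le {α β A L : ℝ} (hα : 0 < α) (hβ : β ∈ Set.Ioo (1 / 2 : ℝ) 1) (hT : 0 < T)
    {B B' : M.SA → M.SA → ℝ} {P₀ Q₀ : ℝ → M.SA → ℝ} (hA : 1 ≤ A)
    (hPc : PoissonBound M.trans (expRate T / M.A.card) C)
    (hPa : PoissonBound M.transAux (expRate T / M.A.card) C)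
    (hFc : ForceBound T K (M.critForce B)) (hFa : ForceBound T K (M.actForce B'))
    (hS : SolutionBound T L P₀ Q₀)
    (hP₀ : ContinuousOn P₀ (Set.Icc 0 T)) (hQ₀ : ContinuousOn Q₀ (Set.Icc 0 T))
    (hq₀ : ∀ t ∈ Set.Icc 0 T, ∀ s, Q₀ t s =
      α * ∫ τ in (0 : ℝ)..t, drift M.trans (M.critForce B) τ (P₀ τ) (Q₀ τ) s)
    (hp₀ : ∀ t ∈ Set.Icc 0 T, ∀ s, P₀ t s =
      ∫ τ in (0 : ℝ)..t, drift M.transAux (M.actForce B') τ (P₀ τ) (Q₀ τ) s) :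
    ∃ Γ : ℝ, 0 ≤ Γ ∧ ∀ (N : ℕ) (ξ ξ' : ℕ → M.SA) (Y Y' : ℝ) (p q : ℕ → M.SA → ℝ) (w : ℕ → ℝ),
      0 < N → 0 ≤ Y → 0 ≤ Y' → TrainBound (β := β) M α T N A ξ ξ' B B' Y Y' p q →
      (∀ n, 1 ≤ w n) → (∀ n, ‖q 0‖ ≤ (N : ℝ) ^ (1 / 2 - β) * w n) →
      (∀ n, ‖p 0‖ ≤ (N : ℝ) ^ (1 / 2 - β) * w n) →
      (∀ n, Y ≤ (Real.sqrt N)⁻¹ * w n) → (∀ n, Y' ≤ (Real.sqrt N)⁻¹ * w n) →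
      (∀ n s, |M.critNoise B N ξ p q n s| ≤ Real.sqrt N * ((1 + ‖q 0‖) * w n)) →
      (∀ n s, |M.actNoise B' N ξ' p q n s| ≤ Real.sqrt N * ((1 + ‖q 0‖) * w n)) →
      ∀ n : ℕ, (n : ℝ) ≤ N * T → outErr N p q P₀ Q₀ n ≤
        Γ * ((N : ℝ) ^ (β - 1) + (N : ℝ) ^ (1 / 2 - β)) *
          (w n ^ 2 + 1 / N * ∑ k ∈ Finset.range n, w k ^ 2) := by
  have hC := hPc.one_le
  have hK := hFc.one_le
  have hL := hS.one_le
  -- `c₁` multiplies the averaging and Riemann errors, `c₂` the Lipschitz feedback, and `c₃` all the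
  -- error sources; `α + 1` dominates both prefactors `α` and 1.
  set c₁ := C * K * A ^ 2 * (2 + 3 * T) + 5 * C * K * L ^ 2 * T with hc₁
  have hc₁0 : 0 ≤ c₁ := by positivity
  set c₂ := (α + 1) * (2 * C * K * L) with hc₂
  have hc₂0 : 0 ≤ c₂ := by positivity
  set c₃ := 2 + 12 * T * A + 2 * (α + 1) + 4 * (α + 1) * c₁ with hc₃
  have hc₃0 : 0 ≤ c₃ := by positivity
  refine ⟨2 * c₃ * (1 + 2 * c₂ * Real.exp (2 * c₂ * T)), by positivity, ?_⟩
  intro N ξ ξ' Y Y' p q w hN hY hY' hTB hw hq hp hYw hYw' hMc hMa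
  have hN' : (0 : ℝ) < N := by exact_mod_cast hN
  have hN1 : (1 : ℝ) ≤ N := by exact_mod_cast hN
  set r := (N : ℝ) ^ (β - 1)
  set r' := (N : ℝ) ^ (1 / 2 - β)
  have hr0 : 0 ≤ r := by positivity
  have hr'0 : 0 ≤ r' := by positivity
  have hr1 : r' ≤ 1 := Real.rpow_le_one_of_one_le_of_nonpos hN1 (by linarith [hβ.1])
  have hsq : (Real.sqrt N)⁻¹ ≤ r' := by
    rw [Real.sqrt_eq_rpow, ← Real.rpow_neg hN'.le]
    exact Real.rpow_le_rpow_of_exponent_le hN1 (by linarith [hβ.2])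
  have hsq' : Real.sqrt N / N = (Real.sqrt N)⁻¹ := by
    rw [Real.sqrt_div_self', one_div]
  have hNr : 1 / (N : ℝ) ≤ r := by
    rw [one_div, ← Real.rpow_neg_one]
    exact Real.rpow_le_rpow_of_exponent_le hN1 (by linarith [hβ.1])
  set R := 1 + ‖q 0‖ with hR
  have hR1 : 1 ≤ R := by simp [hR]
  -- As `N^(1/2-β) ≤ 1`, the initial critic is at most `w n`. The factors `R²` and `R * w n` in the
  -- error are therefore absorbed in `w n ^ 2`.
  have hRw : ∀ n, R ≤ 2 * w n := fun n => by
    have : r' * w n ≤ 1 * w n := mul_le_mul_of_nonneg_right hr1 (by linarith [hw n])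
    linarith [hq n, hw n]
  -- the error of either output
  have hmain : ∀ (n : ℕ) (c y₀ Ym m X S : ℝ), 0 ≤ c → c ≤ α + 1 → 0 ≤ S → y₀ ≤ r' * w n →
      Ym ≤ (Real.sqrt N)⁻¹ * w n → m ≤ Real.sqrt N * (R * w n) →
      X ≤ y₀ + T * (A * (R ^ 2 * r + R * Ym)) + c / N * m + c * c₁ * R ^ 2 / N +
        c * (2 * C * K * L) / N * S →
      X ≤ c₃ * ((r + r') * w n ^ 2) + c₂ / N * S := by
    intro n c y₀ Ym m X S hc0 hc hS0 hy hYm hm hX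
    have hwn := hw n
    have hR2 : R ^ 2 ≤ 4 * w n ^ 2 := by
      have := pow_le_pow_left₀ (by linarith) (hRw n) 2
      linarith [mul_pow 2 (w n) 2]
    have hw2 : w n ≤ w n ^ 2 := le_self_pow₀ hwn two_ne_zero
    have hRY : R * Ym ≤ 2 * (r' * w n ^ 2) := by
      calc R * Ym ≤ (2 * w n) * (r' * w n) := by
            have : Ym ≤ r' * w n := hYm.trans (by gcongr)
            calc R * Ym ≤ R * (r' * w n) := by gcongr
              _ ≤ _ := by
                have := hRw n
                gcongr
        _ = _ := by ring
    have i1 : y₀ ≤ r' * w n ^ 2 := hy.trans (by gcongr)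
    have i2 : T * (A * (R ^ 2 * r + R * Ym)) ≤
        T * (A * (4 * w n ^ 2 * r + 2 * (r' * w n ^ 2))) := by
      gcongr
    have i3 : c / N * m ≤ (α + 1) * (2 * (r' * w n ^ 2)) := by
      calc c / N * m ≤ c / N * (Real.sqrt N * (R * w n)) := by gcongr
        _ = c * (Real.sqrt N / N) * (R * w n) := by ring
        _ ≤ (α + 1) * r' * (2 * w n * w n) := by
            rw [hsq']
            have := hRw n
            gcongr
        _ = _ := by ring
    have i4 : c * c₁ * R ^ 2 / N ≤ (α + 1) * c₁ * (4 * w n ^ 2) * r := by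
      calc c * c₁ * R ^ 2 / N = c * c₁ * R ^ 2 * (1 / N) := by ring
        _ ≤ _ := by gcongr
    have i5 : c * (2 * C * K * L) / N * S ≤ c₂ / N * S := by
      calc _ ≤ (α + 1) * (2 * C * K * L) / N * S := by gcongr
        _ = _ := by rw [hc₂]
    set V := w n ^ 2
    have hV : 0 ≤ V := by positivity
    have hrV : 0 ≤ r * V := by positivity
    have hr'V : 0 ≤ r' * V := by positivity
    have hTA : 0 ≤ T * A := by positivity
    have j1 : r' * V + T * (A * (4 * V * r + 2 * (r' * V))) + (α + 1) * (2 * (r' * V)) +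
        (α + 1) * c₁ * (4 * V) * r ≤ c₃ * ((r + r') * V) := by
      have k1 : c₃ * ((r + r') * V) =
          (2 + 12 * T * A + 2 * (α + 1) + 4 * (α + 1) * c₁) * (r * V) +
          (2 + 12 * T * A + 2 * (α + 1) + 4 * (α + 1) * c₁) * (r' * V) := by rw [hc₃]; ring
      have k2 : 0 ≤ (α + 1) * c₁ * (r' * V) := by positivity
      have k3 : 0 ≤ T * A * (r * V) := by positivity
      have k4 : 0 ≤ T * A * (r' * V) := by positivity
      have k5 : 0 ≤ (α + 1) * (r * V) := by positivity
      rw [k1]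
      linarith
    linarith
  -- `critForce` contains the conditional mean of the next critic value; the choice of `D` restores
  -- the sampled one, so that force plus `D` is the actual temporal difference times the kernel.
  have hcond := fun (n : ℕ) (hn : (n : ℝ) ≤ N * T) (s : M.SA) =>
    abs_output_sub_le hPc hFc hN ξ hA hR1
    hTB.crit_le hTB.crit_step hTB.act_step hS hP₀ hQ₀ (y := q)
    (D := fun k s => M.gamma * B s (ξ k) * (q k (ξ (k + 1)) -
      Matrix.mulVec (policyChain M.trans (M.limitPolicy (k / N) (p k))) (q k) (ξ k)))
    (c := α) (ε := A * (R ^ 2 * r + R * Y)) hα.le (by positivity)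
    (fun k hk s => by
      have := hTB.crit_lin k hk s
      refine le_trans (le_of_eq ?_) this
      congr 2
      simp only [critForce]
      ring) hq₀ hn s
  have hcona := fun (n : ℕ) (hn : (n : ℝ) ≤ N * T) (s : M.SA) =>
    abs_output_sub_le hPa hFa hN ξ' hA hR1
    hTB.crit_le hTB.crit_step hTB.act_step hS hP₀ hQ₀ (y := p) (D := fun _ _ => 0)
    (c := 1) (ε := A * (R ^ 2 * r + R * Y')) zero_le_one (by positivity)
    (fun k hk s => by simpa using hTB.act_lin k hk s) (by simpa using hp₀) hn s
  have hS0 : ∀ n, 0 ≤ ∑ k ∈ Finset.range n, outErr N p q P₀ Q₀ k := fun n =>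
    Finset.sum_nonneg fun k _ => add_nonneg (norm_nonneg _) (norm_nonneg _)
  have hrec : ∀ n ≤ ⌊N * T⌋₊, outErr N p q P₀ Q₀ n ≤ 2 * c₃ * ((r + r') * w n ^ 2) +
      2 * c₂ / N * ∑ k ∈ Finset.range n, outErr N p q P₀ Q₀ k := by
    intro n hn
    have hnT : (n : ℝ) ≤ N * T := (Nat.le_floor_iff (by positivity)).1 hn
    have hx : 0 ≤ c₃ * ((r + r') * w n ^ 2) +
        c₂ / N * ∑ k ∈ Finset.range n, outErr N p q P₀ Q₀ k := by
      have := hS0 n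
      positivity
    have h1 : ‖q n - Q₀ (n / N)‖ ≤ _ := (pi_norm_le_iff_of_nonneg hx).2 fun s => by
      refine hmain n α |q 0 s| Y _ _ _ hα.le (by linarith) (hS0 n)
        ((norm_le_pi_norm (q 0) s).trans (hq n)) (hYw n) (hMc n s) ?_
      rw [critNoise_eq]
      exact hcond n hnT s
    have h2 : ‖p n - P₀ (n / N)‖ ≤ _ := (pi_norm_le_iff_of_nonneg hx).2 fun s => by
      refine hmain n 1 |p 0 s| Y' _ _ _ zero_le_one (by linarith) (hS0 n)
        ((norm_le_pi_norm (p 0) s).trans (hp n)) (hYw' n) (hMa n s) ?_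
      have := hcona n hnT s
      simp only [add_zero] at this
      exact this
    rw [outErr]
    refine (add_le_add h1 h2).trans_eq (by ring)
  intro n hn
  have hgr := discrete_gronwall (by positivity) (fun k => by positivity) hrec n
    ((Nat.le_floor_iff (by positivity)).2 hn)
  have hexp := one_add_div_pow_le_exp (c := 2 * c₂) (T := T) (by positivity) hN hn
  have hW : 0 ≤ ∑ k ∈ Finset.range n, w k ^ 2 := Finset.sum_nonneg fun k _ => sq_nonneg _
  rw [← Finset.mul_sum, ← Finset.mul_sum] at hgr
  refine hgr.trans ?_
  set E := Real.exp (2 * c₂ * T)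
  set W := ∑ k ∈ Finset.range n, w k ^ 2
  have hE : 0 ≤ E := Real.exp_nonneg _
  calc _ ≤ 2 * c₃ * ((r + r') * w n ^ 2) + 2 * c₂ / N * (E * (2 * c₃ * ((r + r') * W))) := by
        gcongr
    _ = 2 * c₃ * (r + r') * (w n ^ 2 + 2 * c₂ * E * (1 / N * W)) := by ring
    _ ≤ 2 * c₃ * (r + r') * ((1 + 2 * c₂ * E) * (w n ^ 2 + 1 / N * W)) := by
        have a1 : 0 ≤ 2 * c₂ * E * w n ^ 2 := by positivity
        have a2 : 0 ≤ 1 / N * W := by positivity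
        gcongr
        linarith
    _ = _ := by ring

end MDP
-- Measurability of the run and conditional laws of the two paths
theorem measurable_poissonSol {S : Type*} [Fintype S] [DecidableEq S] {Z : Type*}
    [MeasurableSpace Z] [TopologicalSpace Z] [OpensMeasurableSpace Z] {P : Z → Matrix S S ℝ}
    {h : Z → S → ℝ} (hP : Continuous P) (hh : Continuous h) (s : S) :
    Measurable fun z => poissonSol (P z) (h z) s := by
  have hA : Continuous fun z => poissonMatrix (P z) := by
    unfold poissonMatrix
    fun_prop
  -- Adjugate times inverted determinant; inversion on `ℝ` is measurable also at 0, so invertibility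
  -- is not needed.
  simp only [poissonSol, Matrix.mulVec, dotProduct, Matrix.inv_def, Ring.inverse_eq_inv',
    Matrix.smul_apply, smul_eq_mul]
  refine Finset.measurable_fun_sum _ fun s' _ => ?_
  refine Measurable.mul (Measurable.mul (hA.matrix_det.measurable.inv) ?_) ?_
  · exact (hA.matrix_adjugate.matrix_elem s s').measurable
  · exact ((continuous_apply s').comp hh).measurable

namespace MDP

variable {dx da : ℕ} {M : MDP dx da} {σ : ℝ → ℝ} {α β : ℝ} {N : ℕ}

section Continuity

theorem continuous_softmax : Continuous M.softmax := by
  refine continuous_pi fun s => ?_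
  unfold softmax
  refine Continuous.div ?_ ?_ fun P => (sum_exp_pos P s).ne'
  · fun_prop
  · fun_prop

theorem continuous_limitPolicy (t : ℝ) : Continuous (M.limitPolicy t) := by
  refine continuous_pi fun s => ?_
  unfold limitPolicy explore
  have := continuous_softmax (M := M)
  fun_prop

theorem continuous_policyChain (k : M.SA → ↥M.X → ℝ) : Continuous (policyChain k) := by
  refine continuous_matrix fun i j => ?_
  simp only [policyChain, Matrix.of_apply]
  fun_prop

theorem continuous_critForce (B : M.SA → M.SA → ℝ) (t : ℝ) (s : M.SA) :
    Continuous fun z : (M.SA → ℝ) × (M.SA → ℝ) => M.critForce B t z.1 z.2 s := by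
  refine continuous_pi fun s' => ?_
  unfold critForce
  have h1 : Continuous fun z : (M.SA → ℝ) × (M.SA → ℝ) =>
      Matrix.mulVec (policyChain M.trans (M.limitPolicy t z.1)) z.2 :=
    ((continuous_policyChain M.trans).comp
      ((continuous_limitPolicy t).comp continuous_fst)).matrix_mulVec continuous_snd
  have h2 := (continuous_apply s').comp h1
  have h3 : Continuous fun z : (M.SA → ℝ) × (M.SA → ℝ) => z.2 s' := by fun_prop
  exact continuous_const.mul ((continuous_const.add (continuous_const.mul h2)).sub h3)

theorem continuous_actForce (B : M.SA → M.SA → ℝ) (t : ℝ) (s : M.SA) :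
    Continuous fun z : (M.SA → ℝ) × (M.SA → ℝ) => M.actForce B t z.1 z.2 s := by
  refine continuous_pi fun s' => ?_
  unfold actForce
  have := continuous_softmax (M := M)
  fun_prop

theorem measurable_corrector {kr : M.SA → ↥M.X → ℝ}
    {h : ℝ → (M.SA → ℝ) → (M.SA → ℝ) → M.SA → M.SA → ℝ} {t : ℝ} {s : M.SA}
    (hh : Continuous fun z : (M.SA → ℝ) × (M.SA → ℝ) => h t z.1 z.2 s) (s' : M.SA) :
    Measurable fun z : (M.SA → ℝ) × (M.SA → ℝ) => corrector kr h t z.1 z.2 s s' :=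
  measurable_poissonSol ((continuous_policyChain kr).comp
    ((continuous_limitPolicy t).comp continuous_fst)) hh s'

end Continuity

section Measurability

theorem measurable_net (hσ : Measurable σ) (β : ℝ) :
    Measurable fun θ : Params dx da N => M.net σ β θ := by
  refine measurable_pi_lambda _ fun s => ?_
  unfold net
  refine Measurable.const_mul (Finset.measurable_fun_sum _ fun i _ => ?_) _
  have h1 : Measurable fun θ : Params dx da N => θ i := measurable_pi_apply i
  exact h1.fst.mul (hσ.comp (h1.snd.inner measurable_const))

theorem measurable_critStep (hσ : Measurable σ) (s s' : M.SA) :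
    Measurable fun ω : Params dx da N => M.critStep σ α β ω s s' := by
  refine measurable_pi_lambda _ fun i => ?_
  unfold critStep
  have h1 : Measurable fun θ : Params dx da N => θ i := measurable_pi_apply i
  have h2 : ∀ s, Measurable fun θ : Params dx da N => inner ℝ (θ i).2 (M.feat s) := fun s =>
    h1.snd.inner measurable_const
  have h3 := measurable_deriv σ
  have hq : ∀ s, Measurable fun θ : Params dx da N => M.net σ β θ s := fun s =>
    (measurable_pi_apply s).comp (measurable_net hσ β)
  have hδ : Measurable fun ω : Params dx da N => critRate α β N / (N : ℝ) ^ β *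
    (M.reward s + M.gamma * M.net σ β ω s' - M.net σ β ω s) :=
    ((((hq s').const_mul _).const_add _).sub (hq s)).const_mul _
  exact (h1.fst.add (hδ.mul (hσ.comp (h2 s)))).prodMk
    (h1.snd.add (((hδ.mul h1.fst).mul (h3.comp (h2 s))).smul_const _))

theorem measurable_actStep (hσ : Measurable σ) (k : ℕ) (s : M.SA) :
    Measurable fun z : Params dx da N × Params dx da N => M.actStep σ β k z.1 z.2 s := by
  refine measurable_pi_lambda _ fun i => ?_
  unfold actStep
  have h1 : Measurable fun z : Params dx da N × Params dx da N => z.2 i :=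
    (measurable_pi_apply i).comp measurable_snd
  have h2 : ∀ s, Measurable fun z : Params dx da N × Params dx da N =>
      inner ℝ (z.2 i).2 (M.feat s) := fun s => h1.snd.inner measurable_const
  have h3 := measurable_deriv σ
  have hδ : Measurable fun z : Params dx da N × Params dx da N =>
      actRate β N k / (N : ℝ) ^ β * M.net σ β z.1 s :=
    ((measurable_pi_apply s).comp ((measurable_net hσ β).comp measurable_fst)).const_mul _
  have hf : ∀ s, Measurable fun z : Params dx da N × Params dx da N =>
      M.softmax (M.net σ β z.2) s := fun s => (measurable_pi_apply s).comp
    (continuous_softmax.measurable.comp ((measurable_net hσ β).comp measurable_snd))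
  refine (h1.fst.add (hδ.mul ((hσ.comp (h2 s)).sub (Finset.measurable_fun_sum _ fun a _ =>
    (hf _).mul (hσ.comp (h2 _)))))).prodMk (h1.snd.add (hδ.smul
      (((h1.fst.mul (h3.comp (h2 s))).smul_const _).sub (Finset.measurable_fun_sum _ fun a _ =>
        (((hf _).mul h1.fst).mul (h3.comp (h2 _))).smul_const _))))

variable {Ω : Type*} {init : Ω → Params dx da N × Params dx da N} {ξ ξ' : ℕ → Ω → M.SA}

theorem history_mono : Monotone (M.history init ξ ξ') := fun _ _ hij =>
  sup_le_sup le_rfl (iSup₂_le fun l hl => le_iSup₂_of_le l (hl.trans hij) le_rfl)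

theorem measurable_init_history (k : ℕ) : Measurable[M.history init ξ ξ' k] init :=
  (comap_measurable init).mono le_sup_left le_rfl

theorem measurable_crit_history (k : ℕ) : Measurable[M.history init ξ ξ' k] (ξ k) :=
  (comap_measurable (ξ k)).mono
    (le_sup_of_le_right (le_iSup₂_of_le k le_rfl le_sup_left)) le_rfl

theorem measurable_act_history (k : ℕ) : Measurable[M.history init ξ ξ' k] (ξ' k) :=
  (comap_measurable (ξ' k)).mono
    (le_sup_of_le_right (le_iSup₂_of_le k le_rfl le_sup_right)) le_rfl

theorem measurable_params (hσ : Measurable σ) (k : ℕ) :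
    Measurable[M.history init ξ ξ' k] (M.params σ α β init ξ ξ' k) := by
  induction k with
  | zero => exact measurable_init_history 0
  | succ k ih =>
    have hm : M.history init ξ ξ' k ≤ M.history init ξ ξ' (k + 1) := history_mono (Nat.le_succ k)
    have hp := ih.mono hm le_rfl
    have h1 : Measurable[M.history init ξ ξ' (k + 1)] fun ω => M.critStep σ α β
        (M.params σ α β init ξ ξ' k ω).1 (ξ k ω) (ξ (k + 1) ω) :=
      measurable_apply_of_finite (f := fun ω s' => M.critStep σ α β
        (M.params σ α β init ξ ξ' k ω).1 (ξ k ω) s') (fun s' =>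
        measurable_apply_of_finite (f := fun ω s => M.critStep σ α β
          (M.params σ α β init ξ ξ' k ω).1 s s')
          (fun s => (measurable_critStep hσ s s').comp (measurable_fst.comp hp))
          ((measurable_crit_history k).mono hm le_rfl)) (measurable_crit_history (k + 1))
    have h2 : Measurable[M.history init ξ ξ' (k + 1)] fun ω => M.actStep σ β k
        (M.params σ α β init ξ ξ' k ω).1 (M.params σ α β init ξ ξ' k ω).2 (ξ' k ω) :=
      measurable_apply_of_finite (f := fun ω s => M.actStep σ β k
        (M.params σ α β init ξ ξ' k ω).1 (M.params σ α β init ξ ξ' k ω).2 s)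
        (fun s => (measurable_actStep hσ k s).comp hp)
        ((measurable_act_history k).mono hm le_rfl)
    exact h1.prodMk h2

/-- The critic outputs of a run as random vectors. -/
noncomputable def critRv (M : MDP dx da) (σ : ℝ → ℝ) (α β : ℝ)
    (init : Ω → Params dx da N × Params dx da N) (ξ ξ' : ℕ → Ω → M.SA) (k : ℕ) (ω : Ω) :
    M.SA → ℝ :=
  M.critSeq σ α β (init ω) (fun j => ξ j ω) (fun j => ξ' j ω) k

/-- The actor outputs of a run as random vectors. -/
noncomputable def actRv (M : MDP dx da) (σ : ℝ → ℝ) (α β : ℝ)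
    (init : Ω → Params dx da N × Params dx da N) (ξ ξ' : ℕ → Ω → M.SA) (k : ℕ) (ω : Ω) :
    M.SA → ℝ :=
  M.actSeq σ α β (init ω) (fun j => ξ j ω) (fun j => ξ' j ω) k

theorem measurable_critRv (hσ : Measurable σ) (k : ℕ) :
    Measurable[M.history init ξ ξ' k] (M.critRv σ α β init ξ ξ' k) :=
  (measurable_net hσ β).comp (measurable_fst.comp (measurable_params hσ k))

theorem measurable_actRv (hσ : Measurable σ) (k : ℕ) :
    Measurable[M.history init ξ ξ' k] (M.actRv σ α β init ξ ξ' k) :=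
  (measurable_net hσ β).comp (measurable_snd.comp (measurable_params hσ k))

variable [mΩ : MeasurableSpace Ω] {μ : Measure Ω} {νC νB : Measure ℝ} {νW νU : Measure (Feat dx da)}

theorem IsRun.history_le (hr : M.IsRun μ σ α β νC νB νW νU init ξ ξ') (k : ℕ) :
    M.history init ξ ξ' k ≤ mΩ :=
  sup_le hr.measurable_init.comap_le (iSup₂_le fun j _ =>
    sup_le (hr.measurable_crit j).comap_le (hr.measurable_act j).comap_le)

theorem hasCondLaw_policyChain (hr : M.IsRun μ σ α β νC νB νW νU init ξ ξ') (hσ : Measurable σ)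
    {kr : M.SA → ↥M.X → ℝ} (hk : IsKernel kr) {x : ℕ → Ω → M.SA}
    (hx : ∀ k, Measurable[M.history init ξ ξ' k] (x k))
    (hlaw : ∀ k s, μ[(x (k + 1) ⁻¹' {s}).indicator (fun _ => (1 : ℝ)) | M.history init ξ ξ' k]
      =ᵐ[μ] fun ω => policyChain kr (M.limitPolicy (k / N) (M.actRv σ α β init ξ ξ' k ω))
        (x k ω) s) :
    HasCondLaw μ (M.history init ξ ξ') x fun k ω s =>
      policyChain kr (M.limitPolicy (k / N) (M.actRv σ α β init ξ ξ' k ω)) (x k ω) s := by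
  -- The lower bound is taken at the current time `k / N`, so the conditional laws are probability
  -- vectors at every step, with no horizon.
  have hg : ∀ (k : ℕ) (ω : Ω), M.limitPolicy (k / N) (M.actRv σ α β init ξ ξ' k ω) ∈
      M.policySet (expRate (k / N) / M.A.card) := fun k ω =>
    limitPolicy_mem_policySet ⟨by positivity, le_rfl⟩ _
  refine ⟨history_mono, hr.history_le, hx, fun k ω s => policyChain_nonneg hk
    (div_nonneg (expRate_pos _).le (Nat.cast_nonneg _)) (hg k ω) _ _,
    fun k ω => sum_policyChain hk (hg k ω) _, fun k s => ?_, hlaw⟩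
  refine measurable_apply_of_finite (f := fun ω s' => policyChain kr
    (M.limitPolicy (k / N) (M.actRv σ α β init ξ ξ' k ω)) s' s) (fun s' => ?_) (hx k)
  have h1 : Continuous fun P => policyChain kr (M.limitPolicy (k / N) P) s' s :=
    ((continuous_policyChain kr).comp (continuous_limitPolicy _)).matrix_elem s' s
  exact h1.measurable.comp (measurable_actRv hσ k)

theorem IsRun.hasCondLaw_crit (hr : M.IsRun μ σ α β νC νB νW νU init ξ ξ') (hσ : Measurable σ) :
    HasCondLaw μ (M.history init ξ ξ') ξ fun k ω s => policyChain M.trans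
      (M.limitPolicy (k / N) (M.actRv σ α β init ξ ξ' k ω)) (ξ k ω) s :=
  hasCondLaw_policyChain hr hσ M.isKernel_trans measurable_crit_history hr.law_crit_succ

theorem IsRun.hasCondLaw_act (hr : M.IsRun μ σ α β νC νB νW νU init ξ ξ') (hσ : Measurable σ) :
    HasCondLaw μ (M.history init ξ ξ') ξ' fun k ω s => policyChain M.transAux
      (M.limitPolicy (k / N) (M.actRv σ α β init ξ ξ' k ω)) (ξ' k ω) s :=
  hasCondLaw_policyChain hr hσ M.isKernel_transAux measurable_act_history hr.law_act_succ

theorem IsRun.map_fst_init [IsProbabilityMeasure νC] [IsProbabilityMeasure νB]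
    [IsProbabilityMeasure νW] [IsProbabilityMeasure νU]
    (hr : M.IsRun μ σ α β νC νB νW νU init ξ ξ') :
    Measurable (fun ω => (init ω).1) ∧
      μ.map (fun ω => (init ω).1) = Measure.pi fun _ => νC.prod νW := by
  have h : MeasurePreserving init μ _ := ⟨hr.measurable_init, hr.law_init⟩
  have := measurePreserving_fst.comp h
  exact ⟨this.measurable, this.map_eq⟩

theorem IsRun.map_snd_init [IsProbabilityMeasure νC] [IsProbabilityMeasure νB]
    [IsProbabilityMeasure νW] [IsProbabilityMeasure νU]
    (hr : M.IsRun μ σ α β νC νB νW νU init ξ ξ') :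
    Measurable (fun ω => (init ω).2) ∧
      μ.map (fun ω => (init ω).2) = Measure.pi fun _ => νB.prod νU := by
  have h : MeasurePreserving init μ _ := ⟨hr.measurable_init, hr.law_init⟩
  have := measurePreserving_snd.comp h
  exact ⟨this.measurable, this.map_eq⟩

theorem ae_forall_abs_fst_le {ν : Measure ℝ} {ν' : Measure (Feat dx da)} [IsProbabilityMeasure ν]
    [IsProbabilityMeasure ν'] {K : ℝ} (hK : ∀ᵐ c ∂ν, |c| ≤ K) {θ : Ω → Params dx da N}
    (hθ : Measurable θ) (hlaw : μ.map θ = Measure.pi fun _ => ν.prod ν') :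
    ∀ᵐ ω ∂μ, ∀ i, |(θ ω i).1| ≤ K := by
  refine ae_all_iff.2 fun i => ?_
  have h1 : MeasurePreserving θ μ (Measure.pi fun _ => ν.prod ν') := ⟨hθ, hlaw⟩
  have h2 := (measurePreserving_fst (μ := ν) (ν := ν')).comp
    ((measurePreserving_eval (fun _ : Fin N => ν.prod ν') i).comp h1)
  exact h2.quasiMeasurePreserving.ae hK

end Measurability

/-! ### Fluctuations of the initial outputs and kernels -/

section Initial

theorem ae_prod_abs_fst_le {ν : Measure ℝ} {ν' : Measure (Feat dx da)} [IsProbabilityMeasure ν']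
    {K₀ : ℝ} (hK : ∀ᵐ c ∂ν, |c| ≤ K₀) : ∀ᵐ z ∂ν.prod ν', |z.1| ≤ K₀ :=
  (measurePreserving_fst (μ := ν) (ν := ν')).quasiMeasurePreserving.ae hK

variable {κ K₀ : ℝ} {ν : Measure ℝ} {ν' : Measure (Feat dx da)} [IsProbabilityMeasure ν]
  [IsProbabilityMeasure ν'] {Ω : Type*} [MeasurableSpace Ω] {μ : Measure Ω}
  {θ : Ω → Params dx da N}

theorem measurable_unitKernel (hσ : Measurable σ) (s s' : M.SA) :
    Measurable (M.unitKernel σ s s') := by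
  unfold unitKernel
  have h2 : ∀ s, Measurable fun z : ℝ × Feat dx da => inner ℝ z.2 (M.feat s) := fun s =>
    measurable_snd.inner measurable_const
  have h3 := measurable_deriv σ
  exact ((hσ.comp (h2 s)).mul (hσ.comp (h2 s'))).add ((((measurable_fst.pow_const 2).mul
    (h3.comp (h2 s))).mul (h3.comp (h2 s'))).mul_const _)

theorem abs_bPair_le (h : SmoothBound σ κ) (hF : ∀ s, ‖M.feat s‖ ≤ κ) (hK₀ : 1 ≤ K₀)
    (hK : ∀ᵐ c ∂ν, |c| ≤ K₀) (s s' : M.SA) :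
    |M.bPair σ (ν.prod ν') s s'| ≤ 2 * κ ^ 4 * K₀ ^ 2 := by
  have h1 := norm_integral_le_of_norm_le_const (μ := ν.prod ν') (f := M.unitKernel σ s s')
    (C := 2 * κ ^ 4 * K₀ ^ 2) ((ae_prod_abs_fst_le hK).mono fun z hz =>
      abs_unitKernel_le h hF hK₀ s s' hz)
  rw [probReal_univ, mul_one] at h1
  exact h1

/-- The scaled initial outputs have exponential moments. -/
theorem expBound_net_init (hσ : Measurable σ) (h : SmoothBound σ κ) (hK₀ : 1 ≤ K₀)
    (hK : ∀ᵐ c ∂ν, |c| ≤ K₀) (h0 : ∫ c, c ∂ν = 0) (hN : 0 < N) (hθ : Measurable θ)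
    (hlaw : μ.map θ = Measure.pi fun _ => ν.prod ν') (β : ℝ) (s : M.SA) :
    ExpBound μ (2 * Real.exp (1 / 2)) fun ω =>
      (K₀ * κ)⁻¹ * ((N : ℝ) ^ (β - 1 / 2) * M.net σ β (θ ω) s) := by
  have hN' : (0 : ℝ) < N := by exact_mod_cast hN
  have hκ := h.one_le
  have hin : Measurable fun w : Feat dx da => σ (inner ℝ w (M.feat s)) :=
    hσ.comp (measurable_id.inner measurable_const)
  have := expBound_sum_iid (μ := μ) (ν := ν.prod ν')
    (φ := fun z => z.1 * σ (inner ℝ z.2 (M.feat s)))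
    (measurable_fst.mul (hin.comp measurable_snd)) (b := K₀ * κ) (by positivity)
    ((ae_prod_abs_fst_le hK).mono fun z hz => by
      rw [abs_mul]
      exact mul_le_mul hz (h.abs_le _) (abs_nonneg _) (by linarith))
    -- Outer and inner weight of a unit are independent, so the centred outer weight makes the whole
    -- unit centred.
    (by rw [integral_prod_mul (fun c : ℝ => c) (fun w => σ (inner ℝ w (M.feat s))), h0, zero_mul])
    hN hθ hlaw
  convert this using 2 with ω
  rw [net, mul_inv, mul_inv, mul_inv, Real.rpow_sub hN', ← Real.sqrt_eq_rpow]
  have : (N : ℝ) ^ β ≠ 0 := (Real.rpow_pos_of_pos hN' _).ne'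
  field_simp

/-- The scaled fluctuations of the initial empirical kernels have exponential moments. -/
theorem expBound_empKernel_init (hσ : Measurable σ) (h : SmoothBound σ κ)
    (hF : ∀ s, ‖M.feat s‖ ≤ κ) (hK₀ : 1 ≤ K₀) (hK : ∀ᵐ c ∂ν, |c| ≤ K₀) (hN : 0 < N)
    (hθ : Measurable θ) (hlaw : μ.map θ = Measure.pi fun _ => ν.prod ν') (s s' : M.SA) :
    ExpBound μ (2 * Real.exp (1 / 2)) fun ω => (4 * κ ^ 4 * K₀ ^ 2)⁻¹ *
      (Real.sqrt N * (M.empKernel σ (θ ω) s s' - M.bPair σ (ν.prod ν') s s')) := by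
  have hN' : (0 : ℝ) < N := by exact_mod_cast hN
  have hκ := h.one_le
  have hb := abs_bPair_le (ν' := ν') h hF hK₀ hK s s'
  have hmK := measurable_unitKernel (M := M) hσ s s'
  have hae := ae_prod_abs_fst_le (ν' := ν') hK
  have hint : Integrable (M.unitKernel σ s s') (ν.prod ν') :=
    Integrable.of_bound hmK.aestronglyMeasurable (2 * κ ^ 4 * K₀ ^ 2)
      (hae.mono fun z hz => abs_unitKernel_le h hF hK₀ s s' hz)
  have := expBound_sum_iid (μ := μ) (ν := ν.prod ν')
    (φ := fun z => M.unitKernel σ s s' z - M.bPair σ (ν.prod ν') s s')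
    (hmK.sub_const _) (b := 4 * κ ^ 4 * K₀ ^ 2) (by positivity)
    (hae.mono fun z hz => by
      refine (abs_sub _ _).trans ?_
      linarith [abs_unitKernel_le h hF hK₀ s s' hz])
    (by
      rw [integral_sub hint (integrable_const _)]
      simp only [integral_const, probReal_univ, one_smul]
      exact sub_self _)
    hN hθ hlaw
  convert this using 2 with ω
  rw [Finset.sum_sub_distrib, empKernel]
  simp only [Finset.sum_const, Finset.card_univ, Fintype.card_fin, nsmul_eq_mul]
  have hs : Real.sqrt N * Real.sqrt N = N := Real.mul_self_sqrt hN'.le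
  have hs0 : Real.sqrt N ≠ 0 := (Real.sqrt_pos.2 hN').ne'
  rw [mul_inv (4 * κ ^ 4 * K₀ ^ 2), mul_assoc ((4 * κ ^ 4 * K₀ ^ 2)⁻¹)]
  refine congrArg ((4 * κ ^ 4 * K₀ ^ 2)⁻¹ * ·) ?_
  rw [eq_inv_mul_iff_mul_eq₀ hs0, ← mul_assoc, hs]
  field_simp

end Initial

end MDP
-- From exponential moments to moments of the error
theorem one_add_sum_pow_le {J : Type*} [Fintype J] {x : J → ℝ} (hx : ∀ j, 0 ≤ x j) (m : ℕ) :
    (1 + ∑ j, x j) ^ (m + 1) ≤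
      2 ^ (m + 1) * (1 + (Fintype.card J : ℝ) ^ m * ∑ j, x j ^ (m + 1)) := by
  have h0 : 0 ≤ ∑ j, x j := Finset.sum_nonneg fun j _ => hx j
  have h1 := add_pow_le zero_le_one h0 (m + 1)
  have h2 := pow_sum_le_card_mul_sum_pow (s := Finset.univ) (fun j _ => hx j) m
  rw [Finset.card_univ] at h2
  rw [one_pow] at h1
  refine h1.trans ?_
  have h3 : (2 : ℝ) ^ (m + 1 - 1) ≤ 2 ^ (m + 1) := pow_le_pow_right₀ (by norm_num) (by omega)
  have h4 : 0 ≤ (∑ j, x j) ^ (m + 1) := by positivity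
  calc _ ≤ (2 : ℝ) ^ (m + 1) * (1 + (∑ j, x j) ^ (m + 1)) := by gcongr
    _ ≤ _ := by gcongr

section Moments

variable {Ω : Type*} [MeasurableSpace Ω] {μ : Measure Ω} {J : Type*} [Fintype J]

/-- The constant in the bound for the moments of `c (1 + ∑ |X_j|)`. -/
noncomputable def momentConst (c K : ℝ) (J m : ℕ) : ℝ :=
  c ^ (m + 1) * (2 ^ (m + 1) * (1 + (J : ℝ) ^ m * (J * ((m + 1).factorial * K))))

theorem momentConst_nonneg {c K : ℝ} (hc : 0 ≤ c) (hK : 0 ≤ K) (J m : ℕ) :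
    0 ≤ momentConst c K J m := by unfold momentConst; positivity

theorem lintegral_pow_one_add_sum_le [IsProbabilityMeasure μ] {c K : ℝ} (hc : 0 ≤ c)
    (hK : 0 ≤ K) {X : J → Ω → ℝ} (hX : ∀ j, ExpBound μ K (X j)) (m : ℕ) :
    ∫⁻ ω, ENNReal.ofReal ((c * (1 + ∑ j, |X j ω|)) ^ (m + 1)) ∂μ ≤
      ENNReal.ofReal (momentConst c K (Fintype.card J) m) := by
  have hmeas : ∀ j, Measurable fun ω => ENNReal.ofReal (|X j ω| ^ (m + 1)) := fun j =>
    ((hX j).measurable.abs.pow_const _).ennreal_ofReal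
  have hsum : ∫⁻ ω, ENNReal.ofReal (∑ j, |X j ω| ^ (m + 1)) ∂μ ≤
      ENNReal.ofReal (Fintype.card J * ((m + 1).factorial * K)) := by
    calc _ = ∫⁻ ω, ∑ j, ENNReal.ofReal (|X j ω| ^ (m + 1)) ∂μ := by
          refine lintegral_congr fun ω => ENNReal.ofReal_sum_of_nonneg fun j _ => by positivity
      _ = ∑ j, ∫⁻ ω, ENNReal.ofReal (|X j ω| ^ (m + 1)) ∂μ :=
          lintegral_finsetSum _ fun j _ => hmeas j
      _ ≤ ∑ j : J, ENNReal.ofReal ((m + 1).factorial * K) :=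
          Finset.sum_le_sum fun j _ => (hX j).lintegral_pow_le (m + 1)
      _ = _ := by
          rw [Finset.sum_const, Finset.card_univ, nsmul_eq_mul,
            ← ENNReal.ofReal_natCast (Fintype.card J), ← ENNReal.ofReal_mul (Nat.cast_nonneg _)]
  have hmS : Measurable fun ω => ENNReal.ofReal (∑ j, |X j ω| ^ (m + 1)) :=
    (Finset.measurable_fun_sum _ fun j _ => (hX j).measurable.abs.pow_const _).ennreal_ofReal
  have hn : ∀ ω, 0 ≤ ∑ j, |X j ω| ^ (m + 1) := fun ω => Finset.sum_nonneg fun j _ => by positivity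
  calc _ ≤ ∫⁻ ω, ENNReal.ofReal (c ^ (m + 1) * 2 ^ (m + 1)) * (1 +
        ENNReal.ofReal ((Fintype.card J : ℝ) ^ m) *
          ENNReal.ofReal (∑ j, |X j ω| ^ (m + 1))) ∂μ := by
        refine lintegral_mono fun ω => ?_
        rw [← ENNReal.ofReal_mul (by positivity), ← ENNReal.ofReal_one,
          ← ENNReal.ofReal_add zero_le_one (by have := hn ω; positivity),
          ← ENNReal.ofReal_mul (by positivity)]
        refine ENNReal.ofReal_le_ofReal ?_
        rw [mul_pow, mul_assoc]
        exact mul_le_mul_of_nonneg_left (one_add_sum_pow_le (fun j => abs_nonneg _) m)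
          (by positivity)
    _ = ENNReal.ofReal (c ^ (m + 1) * 2 ^ (m + 1)) * (1 +
        ENNReal.ofReal ((Fintype.card J : ℝ) ^ m) *
          ∫⁻ ω, ENNReal.ofReal (∑ j, |X j ω| ^ (m + 1)) ∂μ) := by
        have hm1 : Measurable fun ω => 1 + ENNReal.ofReal ((Fintype.card J : ℝ) ^ m) *
            ENNReal.ofReal (∑ j, |X j ω| ^ (m + 1)) := measurable_const.add (hmS.const_mul _)
        rw [lintegral_const_mul _ hm1, lintegral_add_left measurable_const,
          lintegral_const_mul _ hmS]
        simp
    _ ≤ ENNReal.ofReal (c ^ (m + 1) * 2 ^ (m + 1)) * (1 +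
        ENNReal.ofReal ((Fintype.card J : ℝ) ^ m) *
          ENNReal.ofReal (Fintype.card J * ((m + 1).factorial * K))) := by gcongr
    _ = _ := by
        rw [← ENNReal.ofReal_mul (by positivity), ← ENNReal.ofReal_one,
          ← ENNReal.ofReal_add zero_le_one (by positivity), ← ENNReal.ofReal_mul (by positivity),
          momentConst, mul_assoc]

theorem sum_div_pow_le {y : ℕ → ℝ} (hy : ∀ k, 0 ≤ y k) {T : ℝ} {N n : ℕ}
    (hN : 0 < N) (hn : (n : ℝ) ≤ N * T) (p : ℕ) :
    (1 / (N : ℝ) * ∑ k ∈ Finset.range n, y k) ^ (p + 1) ≤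
      T ^ p / N * ∑ k ∈ Finset.range n, y k ^ (p + 1) := by
  have hN' : (0 : ℝ) < N := by exact_mod_cast hN
  have h := pow_sum_le_card_mul_sum_pow (s := Finset.range n) (fun k _ => hy k) p
  rw [Finset.card_range] at h
  have hs : 0 ≤ ∑ k ∈ Finset.range n, y k ^ (p + 1) :=
    Finset.sum_nonneg fun k _ => pow_nonneg (hy k) _
  calc _ = (1 / (N : ℝ)) ^ (p + 1) * (∑ k ∈ Finset.range n, y k) ^ (p + 1) := mul_pow _ _ _
    _ ≤ (1 / (N : ℝ)) ^ (p + 1) * ((N * T) ^ p * ∑ k ∈ Finset.range n, y k ^ (p + 1)) := by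
        refine mul_le_mul_of_nonneg_left (h.trans ?_) (by positivity)
        gcongr
    _ = _ := by
        have : (1 / (N : ℝ)) ^ p * (N : ℝ) ^ p = 1 := by
          rw [← mul_pow, one_div_mul_cancel hN'.ne', one_pow]
        rw [mul_pow, pow_succ]
        linear_combination (T ^ p * (1 / (N : ℝ)) * ∑ k ∈ Finset.range n, y k ^ (p + 1)) * this

/-- By convexity, a time average over at most `N T` steps has moments controlled by those at the
single times; bounds uniform in `k` suffice, without any bound on the maximum over `k`. -/
theorem lintegral_pow_add_average_le {T : ℝ} (hT : 0 < T) {N n : ℕ} (hN : 0 < N)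
    (hn : (n : ℝ) ≤ N * T) {w : ℕ → Ω → ℝ} (hw : ∀ k ≤ n, Measurable (w k)) {p : ℕ} {B : ℝ}
    (hB : 0 ≤ B) (hwB : ∀ k ≤ n, ∫⁻ ω, ENNReal.ofReal ((w k ω ^ 2) ^ (p + 1)) ∂μ ≤
      ENNReal.ofReal B) :
    ∫⁻ ω, ENNReal.ofReal ((w n ω ^ 2 + 1 / N * ∑ k ∈ Finset.range n, w k ω ^ 2) ^ (p + 1)) ∂μ ≤
      ENNReal.ofReal (2 ^ (p + 1) * ((1 + T ^ (p + 1)) * B)) := by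
  have hN' : (0 : ℝ) < N := by exact_mod_cast hN
  have hmeas : ∀ k ≤ n, Measurable fun ω => ENNReal.ofReal ((w k ω ^ 2) ^ (p + 1)) := fun k hk =>
    (((hw k hk).pow_const _).pow_const _).ennreal_ofReal
  have hlt : ∀ k ∈ Finset.range n, k ≤ n := fun k hk => (Finset.mem_range.1 hk).le
  calc _ ≤ ∫⁻ ω, ENNReal.ofReal (2 ^ (p + 1)) * (ENNReal.ofReal ((w n ω ^ 2) ^ (p + 1)) +
        ENNReal.ofReal (T ^ p / N) * ∑ k ∈ Finset.range n,
          ENNReal.ofReal ((w k ω ^ 2) ^ (p + 1))) ∂μ := by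
        refine lintegral_mono fun ω => ?_
        have hs : 0 ≤ ∑ k ∈ Finset.range n, (w k ω ^ 2) ^ (p + 1) :=
          Finset.sum_nonneg fun k _ => by positivity
        have hs1 : 0 ≤ 1 / (N : ℝ) * ∑ k ∈ Finset.range n, w k ω ^ 2 :=
          mul_nonneg (by positivity) (Finset.sum_nonneg fun k _ => by positivity)
        rw [← ENNReal.ofReal_sum_of_nonneg fun k _ => by positivity,
          ← ENNReal.ofReal_mul (by positivity), ← ENNReal.ofReal_add (by positivity)
          (by positivity), ← ENNReal.ofReal_mul (by positivity)]
        refine ENNReal.ofReal_le_ofReal ((add_pow_le (sq_nonneg _) hs1 (p + 1)).trans ?_)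
        have h3 : (2 : ℝ) ^ (p + 1 - 1) ≤ 2 ^ (p + 1) :=
          pow_le_pow_right₀ (by norm_num) (by omega)
        have h4 := sum_div_pow_le (y := fun k => w k ω ^ 2) (fun k => sq_nonneg _) hN hn p
        calc _ ≤ (2 : ℝ) ^ (p + 1) * ((w n ω ^ 2) ^ (p + 1) +
              (1 / (N : ℝ) * ∑ k ∈ Finset.range n, w k ω ^ 2) ^ (p + 1)) := by gcongr
          _ ≤ _ := by gcongr
    _ = ENNReal.ofReal (2 ^ (p + 1)) * (∫⁻ ω, ENNReal.ofReal ((w n ω ^ 2) ^ (p + 1)) ∂μ +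
        ENNReal.ofReal (T ^ p / N) * ∑ k ∈ Finset.range n,
          ∫⁻ ω, ENNReal.ofReal ((w k ω ^ 2) ^ (p + 1)) ∂μ) := by
        have hm2 : Measurable fun ω => ∑ k ∈ Finset.range n,
            ENNReal.ofReal ((w k ω ^ 2) ^ (p + 1)) :=
          Finset.measurable_fun_sum _ fun k hk => hmeas k (hlt k hk)
        have hm1 : Measurable fun ω => ENNReal.ofReal ((w n ω ^ 2) ^ (p + 1)) +
            ENNReal.ofReal (T ^ p / N) * ∑ k ∈ Finset.range n,
              ENNReal.ofReal ((w k ω ^ 2) ^ (p + 1)) := (hmeas n le_rfl).add (hm2.const_mul _)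
        rw [lintegral_const_mul _ hm1, lintegral_add_left (hmeas n le_rfl),
          lintegral_const_mul _ hm2, lintegral_finsetSum _ fun k hk => hmeas k (hlt k hk)]
    _ ≤ ENNReal.ofReal (2 ^ (p + 1)) * (ENNReal.ofReal B +
        ENNReal.ofReal (T ^ p / N) * ∑ k ∈ Finset.range n, ENNReal.ofReal B) := by
        have h1 := hwB n le_rfl
        have h2 := Finset.sum_le_sum fun k hk => hwB k (hlt k hk)
        gcongr
    _ = ENNReal.ofReal (2 ^ (p + 1) * (B + T ^ p / N * (n * B))) := by
        rw [Finset.sum_const, Finset.card_range, nsmul_eq_mul, ← ENNReal.ofReal_natCast n,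
          ← ENNReal.ofReal_mul (Nat.cast_nonneg _), ← ENNReal.ofReal_mul (by positivity),
          ← ENNReal.ofReal_add hB (by positivity), ← ENNReal.ofReal_mul (by positivity)]
    _ ≤ _ := by
        refine ENNReal.ofReal_le_ofReal (mul_le_mul_of_nonneg_left ?_ (by positivity))
        have : T ^ p / N * (n * B) ≤ T ^ p / N * (N * T * B) := by gcongr
        calc B + T ^ p / N * (n * B) ≤ B + T ^ p / N * (N * T * B) := by gcongr
          _ = _ := by rw [pow_succ]; field_simp

end Moments

/-! ### Exponential moments of the noise of a run -/

namespace MDP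

variable {dx da : ℕ} {M : MDP dx da} {σ : ℝ → ℝ} {α β : ℝ} {N : ℕ} {Ω : Type*}
  {init : Ω → Params dx da N × Params dx da N} {ξ ξ' : ℕ → Ω → M.SA}

theorem measurable_corrector_rv (hσ : Measurable σ) (kr : M.SA → ↥M.X → ℝ)
    {h : ℝ → (M.SA → ℝ) → (M.SA → ℝ) → M.SA → M.SA → ℝ} {s : M.SA}
    (hh : ∀ t, Continuous fun z : (M.SA → ℝ) × (M.SA → ℝ) => h t z.1 z.2 s) (k : ℕ) (s' : M.SA) :
    Measurable[M.history init ξ ξ' k] fun ω => corrector kr h (k / N)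
      (M.actRv σ α β init ξ ξ' k ω) (M.critRv σ α β init ξ ξ' k ω) s s' := by
  have hz : Measurable[M.history init ξ ξ' k] fun ω =>
      (M.actRv σ α β init ξ ξ' k ω, M.critRv σ α β init ξ ξ' k ω) :=
    (measurable_actRv hσ k).prodMk (measurable_critRv hσ k)
  have h1 : Measurable fun z : (M.SA → ℝ) × (M.SA → ℝ) => corrector kr h (k / N) z.1 z.2 s s' :=
    measurable_corrector (kr := kr) (h := h) (t := k / N) (s := s) (hh _) s'
  generalize corrector kr h = F at h1 ⊢
  exact h1.comp hz

theorem measurable_critMart_rv (hσ : Measurable σ) (B : M.SA → M.SA → ℝ) (k : ℕ) (s s' : M.SA) :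
    Measurable[M.history init ξ ξ' k] fun ω => M.critMart B (k / N)
      (M.actRv σ α β init ξ ξ' k ω) (M.critRv σ α β init ξ ξ' k ω) (ξ k ω) s s' := by
  unfold critMart
  have h1 : Measurable[M.history init ξ ξ' k] fun ω => B s (ξ k ω) :=
    measurable_apply_of_finite (f := fun (_ : Ω) x => B s x)
      (fun _ => measurable_const) (measurable_crit_history k)
  have h2 : Measurable[M.history init ξ ξ' k] fun ω => M.critRv σ α β init ξ ξ' k ω s' :=
    (measurable_pi_apply s').comp (measurable_critRv hσ k)
  exact (measurable_corrector_rv hσ M.trans (fun t => continuous_critForce B t s) k s').add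
    ((h1.const_mul _).mul h2)

variable [mΩ : MeasurableSpace Ω] {μ : Measure Ω} [IsProbabilityMeasure μ]
  {νC νB : Measure ℝ} {νW νU : Measure (Feat dx da)}

/-- The increments are bounded only by a random `D`. As `D` is measurable at every step it can be
divided out inside the conditional expectations, leaving a martingale with integrands bounded by 1.
In the application `D` is a multiple of `1 + ‖q_0‖`. -/
theorem expBound_compensated {F : ℕ → MeasurableSpace Ω} {x : ℕ → Ω → M.SA}
    {q G : ℕ → Ω → M.SA → ℝ} (h : HasCondLaw μ F x q)
    (hG : ∀ k s, Measurable[F k] fun ω => G k ω s) {D : Ω → ℝ} (hD : ∀ k, Measurable[F k] D)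
    (hD0 : ∀ ω, 0 < D ω) {n : ℕ} (hN : 0 < N) {T : ℝ} (hn : (n : ℝ) ≤ N * T)
    (hGD : ∀ k < n, ∀ᵐ ω ∂μ, ∀ s, |G k ω s| ≤ D ω) :
    ExpBound μ (2 * Real.exp (2 * T)) fun ω => (Real.sqrt N)⁻¹ *
      ((∑ k ∈ Finset.range n, (G k ω (x (k + 1) ω) - ∑ s, q k ω s * G k ω s)) / D ω) := by
  have := h.expBound_martSum (G := fun k ω s => G k ω s / D ω)
    (fun k s => (hG k s).div (hD k)) hN hn (fun k hk => (hGD k hk).mono fun ω hω s => by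
      rw [abs_div, abs_of_pos (hD0 ω)]
      exact div_le_one_of_le₀ (hω s) (hD0 ω).le)
  convert this using 3 with ω
  rw [martSum, Finset.sum_div]
  refine Finset.sum_congr rfl fun k _ => ?_
  rw [sub_div, Finset.sum_div]
  simp only [mul_div_assoc]

theorem IsRun.expBound_critNoise (hr : M.IsRun μ σ α β νC νB νW νU init ξ ξ') (hσ : Measurable σ)
    (hN : 0 < N) {B : M.SA → M.SA → ℝ} {c T : ℝ} (hc : 0 < c) {n : ℕ} (hn : (n : ℝ) ≤ N * T)
    (s : M.SA)
    (hbd : ∀ k : ℕ, (k : ℝ) ≤ N * T → ∀ᵐ ω ∂μ, ∀ s', |M.critMart B (k / N)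
      (M.actRv σ α β init ξ ξ' k ω) (M.critRv σ α β init ξ ξ' k ω) (ξ k ω) s s'| ≤
        c * (1 + ‖M.critRv σ α β init ξ ξ' 0 ω‖)) :
    ExpBound μ (2 * Real.exp (2 * T)) fun ω => (Real.sqrt N)⁻¹ *
      (M.critNoise B N (fun k => ξ k ω) (fun k => M.actRv σ α β init ξ ξ' k ω)
        (fun k => M.critRv σ α β init ξ ξ' k ω) n s /
          (c * (1 + ‖M.critRv σ α β init ξ ξ' 0 ω‖))) := by
  have hG : ∀ k s', Measurable[M.history init ξ ξ' k] fun ω => M.critMart B (k / N)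
      (M.actRv σ α β init ξ ξ' k ω) (M.critRv σ α β init ξ ξ' k ω) (ξ k ω) s s' :=
    fun k s' => measurable_critMart_rv hσ B k s s'
  have hD : ∀ k, Measurable[M.history init ξ ξ' k] fun ω =>
      c * (1 + ‖M.critRv σ α β init ξ ξ' 0 ω‖) := fun k =>
    (measurable_const.add (measurable_norm.comp ((measurable_critRv hσ 0).mono
      (history_mono (Nat.zero_le k)) le_rfl))).const_mul c
  have := expBound_compensated (hr.hasCondLaw_crit hσ) hG hD (fun ω => by positivity) hN hn
    (fun k hk => hbd k (le_trans (by exact_mod_cast hk.le) hn))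
  simp only [critNoise]
  exact this

theorem IsRun.expBound_actNoise (hr : M.IsRun μ σ α β νC νB νW νU init ξ ξ') (hσ : Measurable σ)
    (hN : 0 < N) {B : M.SA → M.SA → ℝ} {c T : ℝ} (hc : 0 < c) {n : ℕ} (hn : (n : ℝ) ≤ N * T)
    (s : M.SA)
    (hbd : ∀ k : ℕ, (k : ℝ) ≤ N * T → ∀ᵐ ω ∂μ, ∀ s', |corrector M.transAux (M.actForce B) (k / N)
      (M.actRv σ α β init ξ ξ' k ω) (M.critRv σ α β init ξ ξ' k ω) s s'| ≤
        c * (1 + ‖M.critRv σ α β init ξ ξ' 0 ω‖)) :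
    ExpBound μ (2 * Real.exp (2 * T)) fun ω => (Real.sqrt N)⁻¹ *
      (M.actNoise B N (fun k => ξ' k ω) (fun k => M.actRv σ α β init ξ ξ' k ω)
        (fun k => M.critRv σ α β init ξ ξ' k ω) n s /
          (c * (1 + ‖M.critRv σ α β init ξ ξ' 0 ω‖))) := by
  have hG : ∀ k s', Measurable[M.history init ξ ξ' k] fun ω => corrector M.transAux
      (M.actForce B) (k / N) (M.actRv σ α β init ξ ξ' k ω) (M.critRv σ α β init ξ ξ' k ω) s s' :=
    fun k s' => measurable_corrector_rv hσ M.transAux (fun t => continuous_actForce B t s) k s'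
  have hD : ∀ k, Measurable[M.history init ξ ξ' k] fun ω =>
      c * (1 + ‖M.critRv σ α β init ξ ξ' 0 ω‖) := fun k =>
    (measurable_const.add (measurable_norm.comp ((measurable_critRv hσ 0).mono
      (history_mono (Nat.zero_le k)) le_rfl))).const_mul c
  have := expBound_compensated (hr.hasCondLaw_act hσ) hG hD (fun ω => by positivity) hN hn
    (fun k hk => hbd k (le_trans (by exact_mod_cast hk.le) hn))
  simp only [actNoise]
  exact this

end MDP
-- Assembling the rate in `L_p`
theorem abs_le_of_abs_scaled_le {d a x c S : ℝ} (hd : 0 < d) (hdc : d ≤ c) (ha : 0 < a)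
    (h : |d⁻¹ * (a * x)| ≤ S) : |x| ≤ a⁻¹ * (c * S) := by
  have hS : 0 ≤ S := (abs_nonneg _).trans h
  rw [abs_mul, abs_mul, abs_of_pos (inv_pos.2 hd), abs_of_pos ha, inv_mul_le_iff₀ hd] at h
  rw [le_inv_mul_iff₀ ha]
  exact h.trans (mul_le_mul_of_nonneg_right hdc hS)

theorem rate_pow_le {x y : ℝ} {N : ℕ} (p : ℕ) :
    ((N : ℝ) ^ x + (N : ℝ) ^ y) ^ p ≤
      2 ^ p * ((N : ℝ) ^ ((p : ℝ) * x) + (N : ℝ) ^ ((p : ℝ) * y)) := by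
  have hN : (0 : ℝ) ≤ N := Nat.cast_nonneg N
  have e : ∀ z : ℝ, (N : ℝ) ^ ((p : ℝ) * z) = ((N : ℝ) ^ z) ^ p := fun z => by
    rw [mul_comm, Real.rpow_mul hN, Real.rpow_natCast]
  rw [e, e]
  refine (add_pow_le (by positivity) (by positivity) p).trans ?_
  gcongr
  · norm_num
  · omega

/-- The supremum over time is outside the integral, so the pointwise bound may fail on a null set
that depends on `t`. -/
theorem supLpError_le {Ω E : Type*} [MeasurableSpace Ω] {μ : Measure Ω} {T D B : ℝ} {p N : ℕ}
    {Y : ℝ → Ω → E → ℝ} {y : ℝ → E → ℝ} {V : ℕ → Ω → ℝ} (hD : 0 ≤ D)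
    (h : ∀ t ∈ Set.Icc 0 T, ∀ᵐ ω ∂μ, ∀ e, |Y t ω e - y t e| ≤ D * V ⌊(N : ℝ) * t⌋₊ ω)
    (hV : ∀ n : ℕ, (n : ℝ) ≤ N * T → ∫⁻ ω, ENNReal.ofReal (V n ω ^ p) ∂μ ≤ ENNReal.ofReal B) :
    supLpError μ T p Y y ≤ ENNReal.ofReal (D ^ p * B) := by
  refine iSup₂_le fun t ht => ?_
  have hn : ((⌊(N : ℝ) * t⌋₊ : ℕ) : ℝ) ≤ N * T :=
    (Nat.floor_le (mul_nonneg (Nat.cast_nonneg N) ht.1)).trans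
      (mul_le_mul_of_nonneg_left ht.2 (Nat.cast_nonneg N))
  calc _ ≤ ∫⁻ ω, ENNReal.ofReal (D ^ p) * ENNReal.ofReal (V ⌊(N : ℝ) * t⌋₊ ω ^ p) ∂μ := by
        refine lintegral_mono_ae ((h t ht).mono fun ω hω => iSup_le fun e => ?_)
        rw [← ENNReal.ofReal_mul (by positivity), ← mul_pow]
        exact ENNReal.ofReal_le_ofReal (pow_le_pow_left₀ (abs_nonneg _) (hω e) p)
    _ = ENNReal.ofReal (D ^ p) * ∫⁻ ω, ENNReal.ofReal (V ⌊(N : ℝ) * t⌋₊ ω ^ p) ∂μ :=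
        lintegral_const_mul' _ _ ENNReal.ofReal_ne_top
    _ ≤ ENNReal.ofReal (D ^ p) * ENNReal.ofReal B := by gcongr; exact hV _ hn
    _ = _ := (ENNReal.ofReal_mul (by positivity)).symm

namespace MDP

variable {dx da : ℕ} {M : MDP dx da} {σ : ℝ → ℝ} {α β κ K₀ T C K L b : ℝ} {N : ℕ}
  {B B' : M.SA → M.SA → ℝ} {P₀ Q₀ : ℝ → M.SA → ℝ}

/-- The limit critic starts at zero, so its Lipschitz bound also bounds its size on `[0, T]`. -/
theorem exists_solutionBound (hT : 0 < T) (hPc : PoissonBound M.trans (expRate T / M.A.card) C)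
    (hPa : PoissonBound M.transAux (expRate T / M.A.card) C)
    (hFc : ForceBound T K (M.critForce B)) (hFa : ForceBound T K (M.actForce B'))
    (hP₀ : ContinuousOn P₀ (Set.Icc 0 T)) (hQ₀ : ContinuousOn Q₀ (Set.Icc 0 T))
    (hq₀ : ∀ t ∈ Set.Icc 0 T, ∀ s, Q₀ t s =
      α * ∫ τ in (0 : ℝ)..t, drift M.trans (M.critForce B) τ (P₀ τ) (Q₀ τ) s)
    (hp₀ : ∀ t ∈ Set.Icc 0 T, ∀ s, P₀ t s =
      ∫ τ in (0 : ℝ)..t, drift M.transAux (M.actForce B') τ (P₀ τ) (Q₀ τ) s) :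
    ∃ L, SolutionBound T L P₀ Q₀ := by
  obtain ⟨a, ha, hQ⟩ := exists_lipschitz_of_integral (continuousOn_drift hPc hFc hP₀ hQ₀) hq₀
  obtain ⟨a', ha', hP⟩ := exists_lipschitz_of_integral (c := 1) (y := P₀)
    (continuousOn_drift hPa hFa hP₀ hQ₀) fun t ht s => by rw [one_mul]; exact hp₀ t ht s
  have h0 : (0 : ℝ) ∈ Set.Icc 0 T := ⟨le_rfl, hT.le⟩
  have hQ0 : Q₀ 0 = 0 := funext fun s => by simp [hq₀ 0 h0 s]
  have haT : 0 ≤ a * T := by positivity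
  refine ⟨1 + a + a' + a * T, by linarith, fun t ht t' ht' => (hP t ht t' ht').trans ?_,
    fun t ht t' ht' => (hQ t ht t' ht').trans ?_, fun t ht => ?_⟩
  · exact mul_le_mul_of_nonneg_right (by linarith) (abs_nonneg _)
  · exact mul_le_mul_of_nonneg_right (by linarith) (abs_nonneg _)
  · have h1 := hQ t ht 0 h0
    rw [hQ0, sub_zero, sub_zero, abs_of_nonneg ht.1] at h1
    have h2 : a * t ≤ a * T := mul_le_mul_of_nonneg_left ht.2 ha
    linarith

theorem abs_critMart_le (hPc : PoissonBound M.trans (expRate T / M.A.card) C)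
    (hFc : ForceBound T K (M.critForce B)) (hB : ∀ s s', |B s s'| ≤ b) {t : ℝ}
    (ht : t ∈ Set.Icc 0 T) (p q : M.SA → ℝ) (x s s' : M.SA) :
    |M.critMart B t p q x s s'| ≤ (C * K + b) * (1 + ‖q‖) := by
  have h1 : |corrector M.trans (M.critForce B) t p q s s'| ≤ C * K * (1 + ‖q‖) :=
    (norm_le_pi_norm (corrector M.trans (M.critForce B) t p q s) s').trans
      (norm_poissonSol_force_le hPc hFc ht p q s)
  have h2 : |M.gamma * B s x * q s'| ≤ b * ‖q‖ := by
    have hb : 0 ≤ b := (abs_nonneg _).trans (hB s x)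
    rw [abs_mul, abs_mul, abs_of_pos M.gamma_mem.1]
    refine mul_le_mul ?_ (norm_le_pi_norm q s') (abs_nonneg _) hb
    calc _ ≤ 1 * b := mul_le_mul M.gamma_mem.2.le (hB s x) (abs_nonneg _) zero_le_one
      _ = b := one_mul b
  have hb : 0 ≤ b := (abs_nonneg _).trans (hB s x)
  refine (abs_add_le _ _).trans ((add_le_add h1 h2).trans ?_)
  nlinarith

section Fluctuation

variable {Ω : Type*} [mΩ : MeasurableSpace Ω] {μ : Measure Ω} [IsProbabilityMeasure μ]
  {init : Ω → Params dx da N × Params dx da N} {ξ ξ' : ℕ → Ω → M.SA}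
  {νC νB : Measure ℝ} {νW νU : Measure (Feat dx da)} [IsProbabilityMeasure νC]
  [IsProbabilityMeasure νB] [IsProbabilityMeasure νW] [IsProbabilityMeasure νU]

/-- The initial outputs, the fluctuations of the initial kernels and the martingales are bounded by
scaled sums of variables with exponential moments. -/
theorem IsRun.exists_fluctuation (hr : M.IsRun μ σ α β νC νB νW νU init ξ ξ') (hσ : Measurable σ)
    (h : SmoothBound σ κ) (hF : ∀ s, ‖M.feat s‖ ≤ κ) (hK₀ : 1 ≤ K₀)
    (hKC : ∀ᵐ c ∂νC, |c| ≤ K₀) (hKB : ∀ᵐ c ∂νB, |c| ≤ K₀)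
    (hC0 : ∫ c, c ∂νC = 0) (hB0 : ∫ c, c ∂νB = 0) (hN : 0 < N) {a c : ℝ} (ha : 0 < a)
    (hca : a ≤ c) (hc1 : K₀ * κ ≤ c) (hc2 : 4 * κ ^ 4 * K₀ ^ 2 ≤ c)
    (hcrit : ∀ s, ∀ k : ℕ, (k : ℝ) ≤ N * T → ∀ᵐ ω ∂μ, ∀ s', |M.critMart B (k / N)
      (M.actRv σ α β init ξ ξ' k ω) (M.critRv σ α β init ξ ξ' k ω) (ξ k ω) s s'| ≤
        a * (1 + ‖M.critRv σ α β init ξ ξ' 0 ω‖))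
    (hact : ∀ s, ∀ k : ℕ, (k : ℝ) ≤ N * T → ∀ᵐ ω ∂μ, ∀ s', |corrector M.transAux (M.actForce B')
      (k / N) (M.actRv σ α β init ξ ξ' k ω) (M.critRv σ α β init ξ ξ' k ω) s s'| ≤
        a * (1 + ‖M.critRv σ α β init ξ ξ' 0 ω‖)) :
    ∃ X : ℕ → Fin 6 × M.SA × M.SA → Ω → ℝ,
      (∀ n : ℕ, (n : ℝ) ≤ N * T → ∀ j,
        ExpBound μ (2 * Real.exp (1 / 2) + 2 * Real.exp (2 * T)) (X n j)) ∧
      ∀ n ω s s', ∀ S, S = c * (1 + ∑ j, |X n j ω|) →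
        |M.critRv σ α β init ξ ξ' 0 ω s| ≤ (N : ℝ) ^ (1 / 2 - β) * S ∧
        |M.actRv σ α β init ξ ξ' 0 ω s| ≤ (N : ℝ) ^ (1 / 2 - β) * S ∧
        |M.empKernel σ (init ω).1 s s' - M.bPair σ (νC.prod νW) s s'| ≤ (Real.sqrt N)⁻¹ * S ∧
        |M.empKernel σ (init ω).2 s s' - M.bPair σ (νB.prod νU) s s'| ≤ (Real.sqrt N)⁻¹ * S ∧
        |M.critNoise B N (fun k => ξ k ω) (fun k => M.actRv σ α β init ξ ξ' k ω)
          (fun k => M.critRv σ α β init ξ ξ' k ω) n s| ≤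
            Real.sqrt N * ((1 + ‖M.critRv σ α β init ξ ξ' 0 ω‖) * S) ∧
        |M.actNoise B' N (fun k => ξ' k ω) (fun k => M.actRv σ α β init ξ ξ' k ω)
          (fun k => M.critRv σ α β init ξ ξ' k ω) n s| ≤
            Real.sqrt N * ((1 + ‖M.critRv σ α β init ξ ξ' 0 ω‖) * S) := by
  have hN' : (0 : ℝ) < N := by exact_mod_cast hN
  have hκ := h.one_le
  obtain ⟨hm1, hl1⟩ := hr.map_fst_init
  obtain ⟨hm2, hl2⟩ := hr.map_snd_init
  have hsq : 0 < Real.sqrt N := Real.sqrt_pos.2 hN'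
  -- Six families: initial outputs and initial kernel deviations of the two networks, and the two
  -- martingales. Only the last two depend on `n`, and only the kernels use the second pair; a
  -- common index set lets one sum dominate all of them.
  let X : ℕ → Fin 6 × M.SA × M.SA → Ω → ℝ := fun n j ω =>
    ![(K₀ * κ)⁻¹ * ((N : ℝ) ^ (β - 1 / 2) * M.net σ β (init ω).1 j.2.1),
      (K₀ * κ)⁻¹ * ((N : ℝ) ^ (β - 1 / 2) * M.net σ β (init ω).2 j.2.1),
      (4 * κ ^ 4 * K₀ ^ 2)⁻¹ * (Real.sqrt N *
        (M.empKernel σ (init ω).1 j.2.1 j.2.2 - M.bPair σ (νC.prod νW) j.2.1 j.2.2)),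
      (4 * κ ^ 4 * K₀ ^ 2)⁻¹ * (Real.sqrt N *
        (M.empKernel σ (init ω).2 j.2.1 j.2.2 - M.bPair σ (νB.prod νU) j.2.1 j.2.2)),
      (Real.sqrt N)⁻¹ * (M.critNoise B N (fun k => ξ k ω) (fun k => M.actRv σ α β init ξ ξ' k ω)
        (fun k => M.critRv σ α β init ξ ξ' k ω) n j.2.1 /
          (a * (1 + ‖M.critRv σ α β init ξ ξ' 0 ω‖))),
      (Real.sqrt N)⁻¹ * (M.actNoise B' N (fun k => ξ' k ω) (fun k => M.actRv σ α β init ξ ξ' k ω)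
        (fun k => M.critRv σ α β init ξ ξ' k ω) n j.2.1 /
          (a * (1 + ‖M.critRv σ α β init ξ ξ' 0 ω‖)))] j.1
  refine ⟨X, fun n hn j => ?_, fun n ω s s' S hS => ?_⟩
  · have e1 : 2 * Real.exp (1 / 2) ≤ 2 * Real.exp (1 / 2) + 2 * Real.exp (2 * T) := by
      linarith [Real.exp_pos (2 * T)]
    have e2 : 2 * Real.exp (2 * T) ≤ 2 * Real.exp (1 / 2) + 2 * Real.exp (2 * T) := by
      linarith [Real.exp_pos (1 / 2)]
    obtain ⟨i, s, s'⟩ := j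
    fin_cases i
    · exact (expBound_net_init hσ h hK₀ hKC hC0 hN hm1 hl1 β s).mono e1
    · exact (expBound_net_init hσ h hK₀ hKB hB0 hN hm2 hl2 β s).mono e1
    · exact (expBound_empKernel_init hσ h hF hK₀ hKC hN hm1 hl1 s s').mono e1
    · exact (expBound_empKernel_init hσ h hF hK₀ hKB hN hm2 hl2 s s').mono e1
    · exact (hr.expBound_critNoise hσ hN ha hn s (hcrit s)).mono e2
    · exact (hr.expBound_actNoise hσ hN ha hn s (hact s)).mono e2
  · have hX : ∀ j, |X n j ω| ≤ 1 + ∑ j, |X n j ω| := fun j => by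
      have := Finset.single_le_sum (f := fun j => |X n j ω|) (fun _ _ => abs_nonneg _)
        (Finset.mem_univ j)
      linarith
    have hR : 0 < 1 + ‖M.critRv σ α β init ξ ξ' 0 ω‖ := by positivity
    have hrw : ((N : ℝ) ^ (β - 1 / 2))⁻¹ = (N : ℝ) ^ (1 / 2 - β) := by
      rw [← Real.rpow_neg hN'.le, neg_sub]
    have hnz : ∀ x : ℝ, (Real.sqrt N)⁻¹ * (x / (a * (1 + ‖M.critRv σ α β init ξ ξ' 0 ω‖))) =
        a⁻¹ * ((Real.sqrt N * (1 + ‖M.critRv σ α β init ξ ξ' 0 ω‖))⁻¹ * x) := fun x => by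
      rw [mul_inv, div_eq_mul_inv, mul_inv]; ring
    have hrp : 0 < (N : ℝ) ^ (β - 1 / 2) := by positivity
    rw [hS]
    refine ⟨?_, ?_, ?_, ?_, ?_, ?_⟩
    · rw [← hrw]
      exact abs_le_of_abs_scaled_le (by positivity) hc1 hrp (hX (0, s, s'))
    · rw [← hrw]
      exact abs_le_of_abs_scaled_le (by positivity) hc1 hrp (hX (1, s, s'))
    · exact abs_le_of_abs_scaled_le (by positivity) hc2 hsq (hX (2, s, s'))
    · exact abs_le_of_abs_scaled_le (by positivity) hc2 hsq (hX (3, s, s'))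
    · have h1 := abs_le_of_abs_scaled_le ha hca (inv_pos.2 (mul_pos hsq hR))
        ((congrArg abs (hnz _)).symm.trans_le (hX (4, s, s')))
      rwa [inv_inv, mul_assoc] at h1
    · have h1 := abs_le_of_abs_scaled_le ha hca (inv_pos.2 (mul_pos hsq hR))
        ((congrArg abs (hnz _)).symm.trans_le (hX (5, s, s')))
      rwa [inv_inv, mul_assoc] at h1

end Fluctuation

/-- The error at time `t` in terms of the error at the preceding step. -/
theorem abs_sub_le_of_outErr_le {p q : ℕ → M.SA → ℝ} {Γ V : ℝ} (hβ : 0 ≤ β) (hN : 0 < N)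
    (hS : SolutionBound T L P₀ Q₀) (hV : 1 ≤ V) {t : ℝ} (ht : t ∈ Set.Icc 0 T)
    (h : outErr N p q P₀ Q₀ ⌊(N : ℝ) * t⌋₊ ≤
      Γ * ((N : ℝ) ^ (β - 1) + (N : ℝ) ^ (1 / 2 - β)) * V) (s : M.SA) :
    |p ⌊(N : ℝ) * t⌋₊ s - P₀ t s| ≤
        (Γ + L) * ((N : ℝ) ^ (β - 1) + (N : ℝ) ^ (1 / 2 - β)) * V ∧
      |q ⌊(N : ℝ) * t⌋₊ s - Q₀ t s| ≤
        (Γ + L) * ((N : ℝ) ^ (β - 1) + (N : ℝ) ^ (1 / 2 - β)) * V := by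
  have hN' : (0 : ℝ) < N := by exact_mod_cast hN
  have hNt : 0 ≤ (N : ℝ) * t := mul_nonneg hN'.le ht.1
  set n := ⌊(N : ℝ) * t⌋₊
  have hn1 : (n : ℝ) ≤ N * t := Nat.floor_le hNt
  have hn2 : (N : ℝ) * t < n + 1 := Nat.lt_floor_add_one _
  have hmem : (n : ℝ) / N ∈ Set.Icc 0 T :=
    div_mem_Icc hN (hn1.trans (mul_le_mul_of_nonneg_left ht.2 hN'.le))
  have hdist : |(n : ℝ) / N - t| ≤ (N : ℝ) ^ (β - 1) + (N : ℝ) ^ (1 / 2 - β) := by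
    have h1 : |(n : ℝ) / N - t| ≤ 1 / N := by
      rw [abs_sub_comm, abs_of_nonneg (sub_nonneg.2 ((div_le_iff₀' hN').2 hn1)), le_div_iff₀ hN',
        sub_mul, div_mul_cancel₀ _ hN'.ne']
      linarith
    have h2 : 1 / (N : ℝ) ≤ (N : ℝ) ^ (β - 1) := by
      rw [one_div, ← Real.rpow_neg_one]
      exact Real.rpow_le_rpow_of_exponent_le (by exact_mod_cast hN) (by linarith)
    have h3 : 0 ≤ (N : ℝ) ^ (1 / 2 - β) := by positivity
    linarith
  set r := (N : ℝ) ^ (β - 1) + (N : ℝ) ^ (1 / 2 - β)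
  have hr : 0 ≤ r := (abs_nonneg _).trans hdist
  have hL : 0 ≤ L := by linarith [hS.one_le]
  have hLr : L * |(n : ℝ) / N - t| ≤ L * r * V :=
    (mul_le_mul_of_nonneg_left hdist hL).trans (le_mul_of_one_le_right (by positivity) hV)
  have key : ∀ y : M.SA → ℝ, ∀ y₀ : ℝ → M.SA → ℝ, ‖y - y₀ (n / N)‖ ≤ Γ * r * V →
      ‖y₀ (n / N) - y₀ t‖ ≤ L * |(n : ℝ) / N - t| → |y s - y₀ t s| ≤ (Γ + L) * r * V := by
    intro y y₀ h1 h2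
    calc |y s - y₀ t s| ≤ ‖y - y₀ t‖ := norm_le_pi_norm (y - y₀ t) s
      _ ≤ ‖y - y₀ (n / N)‖ + ‖y₀ (n / N) - y₀ t‖ := norm_sub_le_norm_sub_add_norm_sub _ _ _
      _ ≤ Γ * r * V + L * r * V := add_le_add h1 (h2.trans hLr)
      _ = _ := by ring
  have h1 := norm_nonneg (q n - Q₀ (n / N))
  have h2 := norm_nonneg (p n - P₀ (n / N))
  unfold outErr at h
  exact ⟨key _ P₀ (by linarith) (hS.lip_act _ hmem _ ht),
    key _ Q₀ (by linarith) (hS.lip_crit _ hmem _ ht)⟩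

end MDP

namespace MDP

variable {dx da : ℕ} {M : MDP dx da} {σ : ℝ → ℝ} {α β T : ℝ} {P₀ Q₀ : ℝ → M.SA → ℝ}
  {νC νB : Measure ℝ} {νW νU : Measure (Feat dx da)}
  [IsProbabilityMeasure νC] [IsProbabilityMeasure νB] [IsProbabilityMeasure νW]
  [IsProbabilityMeasure νU]

/-- The rate of convergence in `L_{p+1}`. -/
theorem exists_supLpError_le (hE : M.Ergodic) (hσ : ContDiff ℝ 3 σ)
    (hσb : ∃ K : ℝ, ∀ j ≤ 3, ∀ x : ℝ, |iteratedDeriv j σ x| ≤ K)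
    (hα : 0 < α) (hβ : β ∈ Set.Ioo (1 / 2 : ℝ) 1)
    (hC : ∃ K : ℝ, ∀ᵐ c ∂νC, |c| ≤ K) (hB : ∃ K : ℝ, ∀ᵐ b ∂νB, |b| ≤ K)
    (hC0 : ∫ c, c ∂νC = 0) (hB0 : ∫ b, b ∂νB = 0) (hT : 0 < T) (p : ℕ)
    (hsol : M.IsLimitSolution σ α (νC.prod νW) (νB.prod νU) T P₀ Q₀) :
    ∃ R : ℝ, 0 ≤ R ∧ ∀ N : ℕ, 0 < N → ∀ (Ω : Type u) [MeasurableSpace Ω] (μ : Measure Ω)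
      [IsProbabilityMeasure μ] (init : Ω → Params dx da N × Params dx da N) (ξ ξ' : ℕ → Ω → M.SA),
      M.IsRun μ σ α β νC νB νW νU init ξ ξ' →
        supLpError μ T (p + 1) (M.actOut σ α β init ξ ξ') P₀ ≤ ENNReal.ofReal
          (R * ((N : ℝ) ^ (((p + 1 : ℕ) : ℝ) * (β - 1)) +
            (N : ℝ) ^ (((p + 1 : ℕ) : ℝ) * (1 / 2 - β)))) ∧
        supLpError μ T (p + 1) (M.critOut σ α β init ξ ξ') Q₀ ≤ ENNReal.ofReal
          (R * ((N : ℝ) ^ (((p + 1 : ℕ) : ℝ) * (β - 1)) +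
            (N : ℝ) ^ (((p + 1 : ℕ) : ℝ) * (1 / 2 - β)))) := by
  have hσm : Measurable σ := hσ.continuous.measurable
  obtain ⟨κ₀, hκ₀⟩ := exists_smoothBound hσ hσb
  obtain ⟨κ, hSm, hF⟩ : ∃ κ, SmoothBound σ κ ∧ ∀ s, ‖M.feat s‖ ≤ κ :=
    ⟨max κ₀ (∑ s, ‖M.feat s‖), hκ₀ _ (le_max_left _ _), fun s =>
      (Finset.single_le_sum (f := fun s => ‖M.feat s‖) (fun _ _ => norm_nonneg _)
        (Finset.mem_univ s)).trans (le_max_right _ _)⟩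
  have hκ := hSm.one_le
  obtain ⟨KC, hKC⟩ := hC
  obtain ⟨KB, hKB⟩ := hB
  obtain ⟨K₀, hK₀, hKC, hKB⟩ : ∃ K₀ : ℝ, 1 ≤ K₀ ∧ (∀ᵐ c ∂νC, |c| ≤ K₀) ∧ ∀ᵐ c ∂νB, |c| ≤ K₀ :=
    ⟨max 1 (max KC KB), le_max_left _ _,
      hKC.mono fun _ h => h.trans ((le_max_left _ _).trans (le_max_right _ _)),
      hKB.mono fun _ h => h.trans ((le_max_right _ _).trans (le_max_right _ _))⟩
  obtain ⟨b, hb⟩ : ∃ b, b = 2 * κ ^ 4 * K₀ ^ 2 := ⟨_, rfl⟩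
  have hb1 : 1 ≤ b := by
    have h1 : 1 ≤ κ ^ 4 := one_le_pow₀ hκ
    have h2 : 1 ≤ K₀ ^ 2 := one_le_pow₀ hK₀
    rw [hb]
    nlinarith
  have hBc : ∀ s s', |M.bPair σ (νC.prod νW) s s'| ≤ b := fun s s' =>
    hb ▸ abs_bPair_le hSm hF hK₀ hKC s s'
  have hBa : ∀ s s', |M.bPair σ (νB.prod νU) s s'| ≤ b := fun s s' =>
    hb ▸ abs_bPair_le hSm hF hK₀ hKB s s'
  have hFc := forceBound_critForce (T := T) hb1 hBc
  have hFa := forceBound_actForce (T := T) hb1 hBa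
  obtain ⟨K, hK⟩ : ∃ K, K = b * (4 * Fintype.card M.SA + 8) := ⟨_, rfl⟩
  rw [← hK] at hFc hFa
  have hc : 0 < expRate T / M.A.card := div_pos (expRate_pos T) M.card_A_pos
  obtain ⟨C₁, hC₁⟩ := exists_poissonBound M.isKernel_trans (fun f hf => (hE f hf).1) hc
  obtain ⟨C₂, hC₂⟩ := exists_poissonBound M.isKernel_transAux (fun f hf => (hE f hf).2) hc
  obtain ⟨C, hPc, hPa⟩ : ∃ C, PoissonBound M.trans (expRate T / M.A.card) C ∧
      PoissonBound M.transAux (expRate T / M.A.card) C :=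
    ⟨max C₁ C₂, hC₁ _ (le_max_left _ _), hC₂ _ (le_max_right _ _)⟩
  have hq₀ : ∀ t ∈ Set.Icc 0 T, ∀ s, Q₀ t s = α * ∫ τ in (0 : ℝ)..t,
      drift M.trans (M.critForce (M.bPair σ (νC.prod νW))) τ (P₀ τ) (Q₀ τ) s := by
    intro t ht s
    rw [hsol.eq_crit t ht s]
    refine congrArg (α * ·) (intervalIntegral.integral_congr fun τ hτ => ?_)
    rw [Set.uIcc_of_le ht.1] at hτ
    exact drift_critForce_eq (T := T) σ _ ⟨hτ.1, hτ.2.trans ht.2⟩ _ _ s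
  have hp₀ : ∀ t ∈ Set.Icc 0 T, ∀ s, P₀ t s = ∫ τ in (0 : ℝ)..t,
      drift M.transAux (M.actForce (M.bPair σ (νB.prod νU))) τ (P₀ τ) (Q₀ τ) s := by
    intro t ht s
    rw [hsol.eq_act t ht s]
    exact intervalIntegral.integral_congr fun τ _ => drift_actForce_eq σ _ τ _ _ s
  have hcP := hsol.continuousOn_act
  have hcQ := hsol.continuousOn_crit
  obtain ⟨L, hS⟩ := exists_solutionBound hT hPc hPa hFc hFa hcP hcQ hq₀ hp₀
  obtain ⟨A, hA, hTB⟩ := exists_trainBound (M := M) (α := α) hSm hF hα hβ.2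
    (zero_le_one.trans hK₀) hT
  obtain ⟨Γ, hΓ, hout⟩ := exists_outErr_le hα hβ hT hA hPc hPa hFc hFa hS hcP hcQ hq₀ hp₀
  have hC1 := hPc.one_le
  have hK1 := hFc.one_le
  have hL1 := hS.one_le
  have hCK : 0 < C * K := by positivity
  -- `C * K + b` bounds the martingale integrands relative to `1 + ‖q_k‖`, and `A` is the growth of
  -- the critic from step 0.
  obtain ⟨a, ha⟩ : ∃ a, a = (C * K + b) * A := ⟨_, rfl⟩
  have ha0 : 0 < a := by rw [ha]; positivity
  obtain ⟨c, hc1, hcκ, hcb, hca⟩ : ∃ c : ℝ, 1 ≤ c ∧ K₀ * κ ≤ c ∧ 4 * κ ^ 4 * K₀ ^ 2 ≤ c ∧ a ≤ c :=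
    ⟨1 + K₀ * κ + 4 * κ ^ 4 * K₀ ^ 2 + a, by
      have h1 : 0 ≤ K₀ * κ := by positivity
      have h2 : 0 ≤ 4 * κ ^ 4 * K₀ ^ 2 := by positivity
      exact ⟨by linarith, by linarith, by linarith, by linarith⟩⟩
  -- The error is quadratic in `w`, so its moment of order `p + 1` needs order `2 p + 2` of `w`;
  -- `momentConst` is indexed by one less than the order.
  obtain ⟨m, hm⟩ : ∃ m, m = momentConst c (2 * Real.exp (1 / 2) + 2 * Real.exp (2 * T))
    (Fintype.card (Fin 6 × M.SA × M.SA)) (2 * p + 1) := ⟨_, rfl⟩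
  have hm0 : 0 ≤ m := by rw [hm]; exact momentConst_nonneg (by linarith) (by positivity) _ _
  obtain ⟨m', hm'⟩ : ∃ m', m' = 2 ^ (p + 1) * ((1 + T ^ (p + 1)) * m) := ⟨_, rfl⟩
  have hm'0 : 0 ≤ m' := by rw [hm']; positivity
  refine ⟨(Γ + L) ^ (p + 1) * 2 ^ (p + 1) * m', by positivity, ?_⟩
  intro N hN Ω _ μ _ init ξ ξ' hr
  have hN' : (0 : ℝ) < N := by exact_mod_cast hN
  obtain ⟨hm1, hl1⟩ := hr.map_fst_init
  obtain ⟨hm2, hl2⟩ := hr.map_snd_init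
  -- The largest deviation of the initial critic kernel over all entries; `Y'` is the same for the
  -- actor.
  let Y : Ω → ℝ := fun ω => ‖fun z : M.SA × M.SA =>
    M.empKernel σ (init ω).1 z.1 z.2 - M.bPair σ (νC.prod νW) z.1 z.2‖
  let Y' : Ω → ℝ := fun ω => ‖fun z : M.SA × M.SA =>
    M.empKernel σ (init ω).2 z.1 z.2 - M.bPair σ (νB.prod νU) z.1 z.2‖
  have hY : ∀ ω s s', |M.empKernel σ (init ω).1 s s' - M.bPair σ (νC.prod νW) s s'| ≤ Y ω :=
    fun ω s s' => norm_le_pi_norm (fun z : M.SA × M.SA =>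
      M.empKernel σ (init ω).1 z.1 z.2 - M.bPair σ (νC.prod νW) z.1 z.2) (s, s')
  have hY' : ∀ ω s s', |M.empKernel σ (init ω).2 s s' - M.bPair σ (νB.prod νU) s s'| ≤ Y' ω :=
    fun ω s s' => norm_le_pi_norm (fun z : M.SA × M.SA =>
      M.empKernel σ (init ω).2 z.1 z.2 - M.bPair σ (νB.prod νU) z.1 z.2) (s, s')
  have hTBae : ∀ᵐ ω ∂μ, TrainBound M α β T N A (fun k => ξ k ω) (fun k => ξ' k ω)
      (M.bPair σ (νC.prod νW)) (M.bPair σ (νB.prod νU)) (Y ω) (Y' ω)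
      (fun k => M.actRv σ α β init ξ ξ' k ω) (fun k => M.critRv σ α β init ξ ξ' k ω) := by
    filter_upwards [ae_forall_abs_fst_le hKC hm1 hl1, ae_forall_abs_fst_le hKB hm2 hl2]
      with ω h1 h2
    exact hTB N (init ω) _ _ _ _ _ _ hN (fun i => ⟨h1 i, h2 i⟩) (hY ω) (hY' ω)
  have hcrit : ∀ s, ∀ k : ℕ, (k : ℝ) ≤ N * T → ∀ᵐ ω ∂μ, ∀ s',
      |M.critMart (M.bPair σ (νC.prod νW)) (k / N) (M.actRv σ α β init ξ ξ' k ω)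
        (M.critRv σ α β init ξ ξ' k ω) (ξ k ω) s s'| ≤
          a * (1 + ‖M.critRv σ α β init ξ ξ' 0 ω‖) := by
    intro s k hk
    filter_upwards [hTBae] with ω hω s'
    refine (abs_critMart_le hPc hFc hBc (div_mem_Icc hN hk) _ _ _ s s').trans ?_
    rw [ha, mul_assoc (C * K + b)]
    exact mul_le_mul_of_nonneg_left (hω.crit_le k hk) (by positivity)
  have hact : ∀ s, ∀ k : ℕ, (k : ℝ) ≤ N * T → ∀ᵐ ω ∂μ, ∀ s',
      |corrector M.transAux (M.actForce (M.bPair σ (νB.prod νU))) (k / N)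
        (M.actRv σ α β init ξ ξ' k ω) (M.critRv σ α β init ξ ξ' k ω) s s'| ≤
          a * (1 + ‖M.critRv σ α β init ξ ξ' 0 ω‖) := by
    intro s k hk
    filter_upwards [hTBae] with ω hω s'
    refine (norm_le_pi_norm (corrector M.transAux _ _ _ _ s) s').trans
      ((norm_poissonSol_force_le hPa hFa (div_mem_Icc hN hk) _ _ s).trans ?_)
    rw [ha, mul_assoc (C * K + b)]
    exact mul_le_mul (by linarith) (hω.crit_le k hk) (by positivity) (by positivity)
  obtain ⟨X, hX, hXb⟩ := hr.exists_fluctuation hσm hSm hF hK₀ hKC hKB hC0 hB0 hN ha0 hca hcκ hcb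
    hcrit hact
  -- The envelope fed to `exists_outErr_le`; `c ≥ 1` ensures `w ≥ 1`, which is used to absorb lower
  -- powers of `w` and the time discretisation error.
  let w : ℕ → Ω → ℝ := fun n ω => c * (1 + ∑ j, |X n j ω|)
  have hw1 : ∀ n ω, 1 ≤ w n ω := fun n ω => one_le_mul_of_one_le_of_one_le hc1
    (le_add_of_nonneg_right (Finset.sum_nonneg fun _ _ => abs_nonneg _))
  have hw0 : ∀ n ω, 0 ≤ w n ω := fun n ω => zero_le_one.trans (hw1 n ω)
  have hwm : ∀ n : ℕ, (n : ℝ) ≤ N * T → Measurable (w n) := fun n hn =>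
    ((Finset.measurable_fun_sum _ fun j _ => (hX n hn j).measurable.abs).const_add 1).const_mul c
  have hwp : ∀ n : ℕ, (n : ℝ) ≤ N * T →
      ∫⁻ ω, ENNReal.ofReal ((w n ω ^ 2) ^ (p + 1)) ∂μ ≤ ENNReal.ofReal m := by
    intro n hn
    have h1 := lintegral_pow_one_add_sum_le (c := c) (by linarith) (by positivity) (hX n hn)
      (2 * p + 1)
    rw [← hm] at h1
    simp only [← pow_mul]
    exact h1
  let V : ℕ → Ω → ℝ := fun n ω => w n ω ^ 2 + 1 / N * ∑ k ∈ Finset.range n, w k ω ^ 2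
  have hV1 : ∀ n ω, 1 ≤ V n ω := fun n ω => (one_le_pow₀ (hw1 n ω)).trans
    (le_add_of_nonneg_right (mul_nonneg (by positivity) (Finset.sum_nonneg fun _ _ => sq_nonneg _)))
  have hVp : ∀ n : ℕ, (n : ℝ) ≤ N * T →
      ∫⁻ ω, ENNReal.ofReal (V n ω ^ (p + 1)) ∂μ ≤ ENNReal.ofReal m' := by
    intro n hn
    have hle : ∀ k ≤ n, (k : ℝ) ≤ N * T := fun k hk => le_trans (by exact_mod_cast hk) hn
    rw [hm']
    exact lintegral_pow_add_average_le hT hN hn (fun k hk => hwm k (hle k hk)) hm0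
      fun k hk => hwp k (hle k hk)
  obtain ⟨r, hrr⟩ : ∃ r, r = (N : ℝ) ^ (β - 1) + (N : ℝ) ^ (1 / 2 - β) := ⟨_, rfl⟩
  have hr0 : 0 ≤ r := by rw [hrr]; positivity
  have herr : ∀ t ∈ Set.Icc 0 T, ∀ᵐ ω ∂μ, ∀ s,
      |M.actOut σ α β init ξ ξ' t ω s - P₀ t s| ≤ (Γ + L) * r * V ⌊(N : ℝ) * t⌋₊ ω ∧
        |M.critOut σ α β init ξ ξ' t ω s - Q₀ t s| ≤ (Γ + L) * r * V ⌊(N : ℝ) * t⌋₊ ω := by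
    intro t ht
    obtain ⟨s₀⟩ := M.nonempty_SA
    filter_upwards [hTBae] with ω hω
    have hrp : 0 ≤ (N : ℝ) ^ (1 / 2 - β) := by positivity
    have hn : ((⌊(N : ℝ) * t⌋₊ : ℕ) : ℝ) ≤ N * T :=
      (Nat.floor_le (mul_nonneg hN'.le ht.1)).trans (mul_le_mul_of_nonneg_left ht.2 hN'.le)
    have h1 := hout N (fun k => ξ k ω) (fun k => ξ' k ω) (Y ω) (Y' ω)
      (fun k => M.actRv σ α β init ξ ξ' k ω) (fun k => M.critRv σ α β init ξ ξ' k ω)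
      (fun k => w k ω) hN (norm_nonneg _) (norm_nonneg _) hω (fun n => hw1 n ω)
      (fun n => (pi_norm_le_iff_of_nonneg (mul_nonneg hrp (hw0 n ω))).2 fun s =>
        (hXb n ω s s₀ _ rfl).1)
      (fun n => (pi_norm_le_iff_of_nonneg (mul_nonneg hrp (hw0 n ω))).2 fun s =>
        (hXb n ω s s₀ _ rfl).2.1)
      (fun n => (pi_norm_le_iff_of_nonneg (mul_nonneg (by positivity) (hw0 n ω))).2 fun z =>
        (hXb n ω z.1 z.2 _ rfl).2.2.1)
      (fun n => (pi_norm_le_iff_of_nonneg (mul_nonneg (by positivity) (hw0 n ω))).2 fun z =>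
        (hXb n ω z.1 z.2 _ rfl).2.2.2.1)
      (fun n s => (hXb n ω s s₀ _ rfl).2.2.2.2.1) (fun n s => (hXb n ω s s₀ _ rfl).2.2.2.2.2) _ hn
    rw [hrr]
    exact abs_sub_le_of_outErr_le (by linarith [hβ.1]) hN hS (hV1 _ ω) ht h1
  have hfin : ENNReal.ofReal (((Γ + L) * r) ^ (p + 1) * m') ≤ ENNReal.ofReal
      ((Γ + L) ^ (p + 1) * 2 ^ (p + 1) * m' * ((N : ℝ) ^ (((p + 1 : ℕ) : ℝ) * (β - 1)) +
        (N : ℝ) ^ (((p + 1 : ℕ) : ℝ) * (1 / 2 - β)))) := by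
    refine ENNReal.ofReal_le_ofReal ?_
    have h1 := rate_pow_le (x := β - 1) (y := 1 / 2 - β) (N := N) (p + 1)
    rw [← hrr] at h1
    calc _ = (Γ + L) ^ (p + 1) * r ^ (p + 1) * m' := by rw [mul_pow]
      _ ≤ (Γ + L) ^ (p + 1) * (2 ^ (p + 1) * ((N : ℝ) ^ (((p + 1 : ℕ) : ℝ) * (β - 1)) +
        (N : ℝ) ^ (((p + 1 : ℕ) : ℝ) * (1 / 2 - β)))) * m' := by gcongr
      _ = _ := by ring
  have hD : 0 ≤ (Γ + L) * r := by positivity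
  exact ⟨(supLpError_le hD (fun t ht => (herr t ht).mono fun ω h s => (h s).1) hVp).trans hfin,
    (supLpError_le hD (fun t ht => (herr t ht).mono fun ω h s => (h s).2) hVp).trans hfin⟩

end MDP

theorem tendsto_rate_zero {β : ℝ} (hβ : β ∈ Set.Ioo (1 / 2 : ℝ) 1) {p : ℝ} (hp : 0 < p) (R : ℝ) :
    Filter.Tendsto (fun N : ℕ => R * ((N : ℝ) ^ (p * (β - 1)) + (N : ℝ) ^ (p * (1 / 2 - β))))
      Filter.atTop (nhds 0) := by
  have h : ∀ y : ℝ, y < 0 → Filter.Tendsto (fun N : ℕ => (N : ℝ) ^ (p * y)) Filter.atTop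
      (nhds 0) := fun y hy => by
    have h1 := (tendsto_rpow_neg_atTop (y := -(p * y)) (by nlinarith)).comp
      tendsto_natCast_atTop_atTop
    rw [neg_neg] at h1
    exact h1
  have h1 := ((h (β - 1) (by linarith [hβ.2])).add (h (1 / 2 - β) (by linarith [hβ.1]))).const_mul R
  rwa [add_zero, mul_zero] at h1

end ActorCritic

theorem theorem3 {dx da : ℕ} (M : MDP dx da)
    (hErg : M.Ergodic) (hLip : M.LipschitzStationary)
    (σ : ℝ → ℝ) (hσ : ContDiff ℝ 3 σ)
    (hσb : ∃ K : ℝ, ∀ j ≤ 3, ∀ x : ℝ, |iteratedDeriv j σ x| ≤ K)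
    (α β : ℝ) (hα : 0 < α) (hβ : β ∈ Set.Ioo (1 / 2 : ℝ) 1)
    (νC νB : Measure ℝ) [IsProbabilityMeasure νC] [IsProbabilityMeasure νB]
    (νW νU : Measure (Feat dx da)) [IsProbabilityMeasure νW] [IsProbabilityMeasure νU]
    (hC : ∃ K : ℝ, ∀ᵐ c ∂νC, |c| ≤ K) (hB : ∃ K : ℝ, ∀ᵐ b ∂νB, |b| ≤ K)
    (hC0 : ∫ c, c ∂νC = 0) (hB0 : ∫ b, b ∂νB = 0)
    (hW : Integrable (fun w => ‖w‖) νW) (hU : Integrable (fun w => ‖w‖) νU)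
    (T : ℝ) (hT : 0 < T) (p : ℕ) (hp : 1 ≤ p)
    (P₀ Q₀ : ℝ → M.SA → ℝ)
    (hsol : M.IsLimitSolution σ α (νC.prod νW) (νB.prod νU) T P₀ Q₀) :
    -- convergence in `L_p`
    (∀ ε : ℝ, 0 < ε → ∃ N₀ : ℕ, ∀ N : ℕ, N₀ < N →
      ∀ (Ω : Type u) [MeasurableSpace Ω] (μ : Measure Ω) [IsProbabilityMeasure μ]
        (init : Ω → Params dx da N × Params dx da N) (ξ ξ' : ℕ → Ω → M.SA),
        M.IsRun μ σ α β νC νB νW νU init ξ ξ' →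
        supLpError μ T p (M.actOut σ α β init ξ ξ') P₀ ≤ ENNReal.ofReal ε ∧
        supLpError μ T p (M.critOut σ α β init ξ ξ') Q₀ ≤ ENNReal.ofReal ε) ∧
    -- the rate
    (∃ (C : ℝ) (N₀ : ℕ), ∀ N : ℕ, N₀ < N →
      ∀ (Ω : Type u) [MeasurableSpace Ω] (μ : Measure Ω) [IsProbabilityMeasure μ]
        (init : Ω → Params dx da N × Params dx da N) (ξ ξ' : ℕ → Ω → M.SA),
        M.IsRun μ σ α β νC νB νW νU init ξ ξ' →
        supLpError μ T p (M.actOut σ α β init ξ ξ') P₀ ≤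
          ENNReal.ofReal
            (C * ((N : ℝ) ^ ((p : ℝ) * (β - 1)) + (N : ℝ) ^ ((p : ℝ) * (1 / 2 - β)))) ∧
        supLpError μ T p (M.critOut σ α β init ξ ξ') Q₀ ≤
          ENNReal.ofReal
            (C * ((N : ℝ) ^ ((p : ℝ) * (β - 1)) + (N : ℝ) ^ ((p : ℝ) * (1 / 2 - β))))) := by
  obtain ⟨p, rfl⟩ : ∃ q, p = q + 1 := ⟨p - 1, by omega⟩
  obtain ⟨R, hR, h⟩ := MDP.exists_supLpError_le.{u} hErg hσ hσb hα hβ hC hB hC0 hB0 hT p hsol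
  -- The rate holds from `N = 1` on, and it implies the convergence because both exponents are
  -- negative for `1/2 < β < 1`.
  refine ⟨fun ε hε => ?_, R, 0, fun N hN => h N hN⟩
  have hlim := tendsto_rate_zero hβ (p := ((p + 1 : ℕ) : ℝ)) (by positivity) R
  obtain ⟨N₀, hN₀⟩ := Filter.eventually_atTop.1 (hlim.eventually_le_const hε)
  refine ⟨N₀, fun N hN Ω _ μ _ init ξ ξ' hr => ?_⟩
  have hle := ENNReal.ofReal_le_ofReal (hN₀ N hN.le)
  obtain ⟨h1, h2⟩ := h N (by omega) Ω μ init ξ ξ' hr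
  exact ⟨h1.trans hle, h2.trans hle⟩
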